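/- **Setting.** Let $d\in\{2,3\}$ and let $\Omega\subset\mathbb R^d$ be a bounded domain (open and connected). Let $\mathcal T_h$ be a partition of $\Omega$ into finitely many closed convex polytopes $K$ with nonempty, pairwise disjoint interiors, without hanging nodes (distinct elements meet in a common face or not at all), such that $\Omega$ is the interior of $\bigcup_{K\in\mathcal T_h}K$; $h_K$ is the diameter of $K$. An interior facet $F\in\mathcal F_h^i$ is a $(d-1)$-dimensional intersection $F=K^+\cap K^-$ of two elements, numbered in an arbitrary but fixed way; $n_F$ is the unit normal to $F$ pointing from $K^+$ to $K^-$. With $\phi^\pm$ the traces of $\phi$ on $F$ from within $K^\pm$, put $[\![\phi]\!]=\phi^+-\phi^-$ and $\{\!\{\phi\}\!\}=\frac12(\phi^++\phi^-)$. For each $K\in\mathcal T_h$ let $V_k(K)\subset H^1(K)^d$ be a linear space of vector-valued piecewise polynomials on $K$, and let $C_{\rm inv}>0$ be a constant for which the local inverse inequality $\|\nabla v\|_{L^2(K)}\le C_{\rm inv}h_K^{-1}\|v\|_{L^2(K)}$ holds for all $K\in\mathcal T_h$ and $v\in V_k(K)$. Define $$V_h=\{v\in H({\rm div};\Omega):\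 v|_K\in V_k(K)\ \forall K\in\mathcal T_h,\ v\cdot n|_{\partial\Omega}=0\}$$ and, for a fixed $\varepsilon>0$, $$V(h)=V_h+\bigl(H^1_0(\Omega)^d\cap H^{3/2+\varepsilon}(\mathcal T_h)^d\bigr),$$ where $H^s(\mathcal T_h)$ consists of the functions whose restriction to each $K$ lies in $H^s(K)$. Let $T>0$ and let $\beta\in L^\infty(0,T;L^\infty(\Omega)^d)$ satisfy, for almost every $t$, $\nabla\cdot\beta(t)=0$ in $\Omega$ (weakly) and $\beta(t)\cdot n=0$ on $\partial\Omega$; write $\|\beta\|_\infty=\|\beta\|_{L^\infty(0,T;L^\infty)}$. On a facet, $\beta\cdot n_F$ is the normal trace in the sense of Green's formula. Let $\gamma>0$. With $\beta=\beta(t)$ and $\nabla_h$ the elementwise gradient, set for $w\in V(h)$, $v_h\in V_h$ $$c_h(\beta;w,v_h)=\int_\Omega(\beta\cdot\nabla_h)w\cdot v_h\,dx-\sum_{F\in\mathcal F_h^i}\int_F(\beta\cdot n_F)[\![w]\!]\cdot\{\!\{v_h\}\!\}\,ds+\sum_{F\in\mathcal F_h^i}\int_F\frac\gamma2|\beta\cdot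 n_F|[\![w]\!]\cdot[\![v_h]\!]\,ds,$$ $$|w|_{\beta,{\rm upw}}^2=\sum_{F\in\mathcal F_h^i}\int_F\frac\gamma2|\beta\cdot n_F|\,|[\![w]\!]|^2\,ds,$$ $$\|w\|_{\beta,\sharp}^2=\|w\|_{L^2(\Omega)}^2+|w|_{\beta,{\rm upw}}^2+\|\beta\|_\infty^2\sum_{K\in\mathcal T_h}h_K^{-2}\|w\|_{L^2(K)}^2+\|\beta\|_\infty\sum_{K\in\mathcal T_h}\|w\|_{L^2(\partial K)}^2 .$$ **Lemma (boundedness of the convection term).** Let $M_{\rm cnv}=\max\{1,C_{\rm inv}^2,\gamma^{-1}\}$. Then for almost every $t\in(0,T]$, for all $w\in V(h)$, $v_h\in V_h$ and all $\varepsilon_1,\varepsilon_2>0$, $$|c_h(\beta;w,v_h)|\le M_{\rm cnv}\Bigl(\frac1{2\varepsilon_1}+\frac1{\varepsilon_2}\Bigr)\|w\|_{\beta,\sharp}^2+\frac{\varepsilon_1}2\|v_h\|_{L^2(\Omega)}^2+\varepsilon_2|v_h|_{\beta,{\rm upw}}^2 .$$ -/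

import Mathlib

open MeasureTheory Filter Topology
open scoped ENNReal ContDiff RealInnerProductSpace

noncomputable section

namespace HdivFEM

/-- `ℝ^d` with the Euclidean norm. -/
abbrev Euc (d : ℕ) : Type := EuclideanSpace ℝ (Fin d)

variable {d : ℕ}

/-- The `i`-th standard basis vector. -/
def stdVec (i : Fin d) : Euc d := EuclideanSpace.single i 1

/-- Surface measure on the boundary of `K`: the (Lebesgue-normalised) `(d-1)`-dimensional
Hausdorff measure restricted to `∂K`. -/
def bdryMeasure (K : Set (Euc d)) : Measure (Euc d) := (μHE[d - 1]).restrict (frontier K)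

/-! ### Sobolev spaces on the interior of a set `K`, vector-valued functions -/

/-- `g` is the weak partial derivative `∂_i w` on (the interior of) `K`. -/
def HasWeakPartial (K : Set (Euc d)) (i : Fin d) (w g : Euc d → Euc d) : Prop :=
  ∀ φ : Euc d → ℝ, ContDiff ℝ ∞ φ → HasCompactSupport φ → tsupport φ ⊆ interior K →
    ∫ x in K, (fderiv ℝ φ x (stdVec i)) • w x = - ∫ x in K, φ x • g x

/-- The Gagliardo integral `∫_K ∫_K |w(x)-w(y)|² / |x-y|^(d+2θ)`. -/
def gagliardo (K : Set (Euc d)) (θ : ℝ) (w : Euc d → Euc d) : ℝ≥0∞ :=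
  ∫⁻ x in K, ∫⁻ y in K, ‖w x - w y‖ₑ ^ 2 / ‖x - y‖ₑ ^ ((d : ℝ) + 2 * θ)

/-- Membership in `H^(m+θ)(K)`, `0 ≤ θ < 1`: all weak derivatives up to order `m` are in `L²(K)`
and, if `θ > 0`, those of order `m` have finite Gagliardo seminorm of order `θ`. -/
def MemSobolev (K : Set (Euc d)) : ℕ → ℝ → (Euc d → Euc d) → Prop
  | 0, θ, w => MemLp w 2 (volume.restrict K) ∧ (0 < θ → gagliardo K θ w < ⊤)
  | m + 1, θ, w => MemLp w 2 (volume.restrict K) ∧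
      ∀ i, ∃ g, HasWeakPartial K i w g ∧ MemSobolev K m θ g

/-- The Sobolev space `H^s(K)`, `s ≥ 0` real. -/
def MemH (K : Set (Euc d)) (s : ℝ) (w : Euc d → Euc d) : Prop :=
  MemSobolev K ⌊s⌋₊ (Int.fract s) w

open Classical in
/-- The weak partial derivative `∂_i w ∈ L²(K)` (unique up to null sets when it exists). -/
def weakPartial (K : Set (Euc d)) (i : Fin d) (w : Euc d → Euc d) : Euc d → Euc d :=
  if h : ∃ g, MemLp g 2 (volume.restrict K) ∧ HasWeakPartial K i w g then h.choose else 0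

/-- The `H¹`-seminorm `‖∇w‖_{L²(K)}` (Frobenius norm of the Jacobian). -/
def h1Semi (K : Set (Euc d)) (w : Euc d → Euc d) : ℝ :=
  √(∑ i, ∫ x in K, ‖weakPartial K i w x‖ ^ 2)

/-- The `L²(K)`-norm. -/
def l2Norm (K : Set (Euc d)) (w : Euc d → Euc d) : ℝ := √(∫ x in K, ‖w x‖ ^ 2)

/-- `τ ∈ L²(∂K)` is the trace of `w ∈ H¹(K)`: the trace map is the continuous extension to `H¹(K)`
of the restriction `φ ↦ φ|_∂K` of functions that are smooth up to the boundary. -/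
def IsTrace (K : Set (Euc d)) (w τ : Euc d → Euc d) : Prop :=
  MemLp τ 2 (bdryMeasure K) ∧
  ∃ φ : ℕ → Euc d → Euc d, (∀ n, ContDiff ℝ ∞ (φ n)) ∧
    Tendsto (fun n => eLpNorm (fun x => φ n x - w x) 2 (volume.restrict K)) atTop (𝓝 0) ∧
    (∀ i, Tendsto (fun n => eLpNorm (fun x => fderiv ℝ (φ n) x (stdVec i) - weakPartial K i w x) 2
      (volume.restrict K)) atTop (𝓝 0)) ∧
    Tendsto (fun n => eLpNorm (fun x => φ n x - τ x) 2 (bdryMeasure K)) atTop (𝓝 0)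

open Classical in
/-- The trace of `w` on `∂K`, taken from within `K`. -/
def trace (K : Set (Euc d)) (w : Euc d → Euc d) : Euc d → Euc d :=
  if h : ∃ τ, IsTrace K w τ then h.choose else 0

/-! ### Divergence and normal trace -/

/-- `q` is the weak divergence of `b` on (the interior of) `K`. -/
def HasWeakDiv (K : Set (Euc d)) (b : Euc d → Euc d) (q : Euc d → ℝ) : Prop :=
  ∀ φ : Euc d → ℝ, ContDiff ℝ ∞ φ → HasCompactSupport φ → tsupport φ ⊆ interior K →
    ∫ x in K, fderiv ℝ φ x (b x) = - ∫ x in K, q x * φ x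

/-- `g` is the outer normal trace `b · n_K` on `∂K` of a field `b` with divergence `q`, in the sense
of Green's formula `∫_K b·∇φ + ∫_K (∇·b) φ = ∫_∂K (b·n_K) φ`. -/
def HasNormalTrace (K : Set (Euc d)) (b : Euc d → Euc d) (q g : Euc d → ℝ) : Prop :=
  ∀ φ : Euc d → ℝ, ContDiff ℝ ∞ φ → HasCompactSupport φ →
    (∫ x in K, fderiv ℝ φ x (b x)) + (∫ x in K, q x * φ x) = ∫ x, g x * φ x ∂(bdryMeasure K)

open Classical in
/-- The outer normal trace `b · n_K ∈ L^∞(∂K)` of a bounded divergence-free field `b`. -/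
def normalTrace (K : Set (Euc d)) (b : Euc d → Euc d) : Euc d → ℝ :=
  if h : ∃ g, MemLp g ⊤ (bdryMeasure K) ∧ HasNormalTrace K b 0 g then h.choose else 0

/-! ### Meshes -/

/-- A convex polytope with nonempty interior. -/
def IsPolytope (K : Set (Euc d)) : Prop :=
  Bornology.IsBounded K ∧ (interior K).Nonempty ∧
    ∃ S : Finset (Euc d × ℝ), K = {x | ∀ p ∈ S, ⟪p.1, x⟫ ≤ p.2}

/-- `K` and `K'` share a facet: their intersection has dimension `d - 1`. -/
def ShareFacet (K K' : Set (Euc d)) : Prop :=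
  (K ∩ K').Nonempty ∧ Module.finrank ℝ (vectorSpan ℝ (K ∩ K')) + 1 = d

/-- A partition of `Ω` into finitely many (closed) convex polytopes without hanging nodes, with an
orientation of the interior facets. -/
structure Mesh (Ω : Set (Euc d)) where
  cells : Finset (Set (Euc d))
  polytope : ∀ K ∈ cells, IsPolytope K
  /-- The elements fill the domain. -/
  cover : Ω = interior (⋃ K ∈ cells, K)
  disjoint : ∀ K ∈ cells, ∀ K' ∈ cells, K ≠ K' → Disjoint (interior K) (interior K')
  /-- No hanging nodes: distinct elements meet in a common face (or not at all). -/
  conforming : ∀ K ∈ cells, ∀ K' ∈ cells, K ≠ K' → IsExposed ℝ K (K ∩ K')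
  /-- The interior facets `F = K⁺ ∩ K⁻`, as pairs `(K⁺, K⁻)`: one (arbitrary, fixed) order
  of the two adjacent elements. The facet normal `n_F` points from `K⁺` to `K⁻`. -/
  intFacets : Finset (Set (Euc d) × Set (Euc d))
  facet_mem : ∀ F ∈ intFacets, F.1 ∈ cells ∧ F.2 ∈ cells ∧ F.1 ≠ F.2 ∧ ShareFacet F.1 F.2
  facet_orient : ∀ K ∈ cells, ∀ K' ∈ cells, K ≠ K' → ShareFacet K K' →
    Xor ((K, K') ∈ intFacets) ((K', K) ∈ intFacets)

/-- The surface measure on the interior facet `F = K⁺ ∩ K⁻`. -/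
def facetMeasure (F : Set (Euc d) × Set (Euc d)) : Measure (Euc d) :=
  (μHE[d - 1]).restrict (F.1 ∩ F.2)

/-- Jump `w⁺ - w⁻` across an interior facet. -/
def jump (F : Set (Euc d) × Set (Euc d)) (w : Euc d → Euc d) (x : Euc d) : Euc d :=
  trace F.1 w x - trace F.2 w x

/-- Average `(w⁺ + w⁻)/2` on an interior facet. -/
def avg (F : Set (Euc d) × Set (Euc d)) (w : Euc d → Euc d) (x : Euc d) : Euc d :=
  (1 / 2 : ℝ) • (trace F.1 w x + trace F.2 w x)

/-- `b · n_F` on an interior facet; `n_F` is the outer normal of `K⁺`. -/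
def facetFlux (F : Set (Euc d) × Set (Euc d)) (b : Euc d → Euc d) : Euc d → ℝ :=
  normalTrace F.1 b

/-! ### Function spaces -/

/-- `p` is a vector-valued piecewise polynomial on `K`: `K` is a finite union of polytopes on the
interior of each of which `p` is a polynomial (for a polynomial on `K`, the only piece is `K`). -/
def IsPiecewisePolynomial (K : Set (Euc d)) (p : Euc d → Euc d) : Prop :=
  ∃ P : Finset (Set (Euc d)), (∀ S ∈ P, IsPolytope S) ∧ K = ⋃ S ∈ P, S ∧
    ∀ S ∈ P, ∃ q : Fin d → MvPolynomial (Fin d) ℝ,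
      ∀ x ∈ interior S, ∀ i, p x i = MvPolynomial.eval (fun j => x j) (q i)

/-- `v ∈ H(div; Ω)` with `v · n = 0` on `∂Ω`. -/
def MemHdivZero (Ω : Set (Euc d)) (v : Euc d → Euc d) : Prop :=
  MemLp v 2 (volume.restrict Ω) ∧
  ∃ q : Euc d → ℝ, MemLp q 2 (volume.restrict Ω) ∧ HasWeakDiv Ω v q ∧ HasNormalTrace Ω v q 0

variable {Ω : Set (Euc d)}

/-- The discrete velocity space `V_h` with local spaces `V_k(K) = Vloc K`. -/
def discreteSpace (𝒯 : Mesh Ω) (Vloc : Set (Euc d) → Submodule ℝ (Euc d → Euc d)) :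
    Set (Euc d → Euc d) :=
  {v | MemHdivZero Ω v ∧ ∀ K ∈ 𝒯.cells, ∃ p ∈ Vloc K, v =ᵐ[volume.restrict K] p}

/-- `V ∩ H^s(𝒯_h)` where `V = H¹₀(Ω)` and `H^s(𝒯_h)` is the broken Sobolev space. -/
def smoothSpace (𝒯 : Mesh Ω) (s : ℝ) : Set (Euc d → Euc d) :=
  {u | MemH Ω 1 u ∧ IsTrace Ω u 0 ∧ ∀ K ∈ 𝒯.cells, MemH K s u}

/-- The compound space `V(h) = V_h + (V ∩ H^{3/2+ε}(𝒯_h))`. -/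
def compoundSpace (𝒯 : Mesh Ω) (Vloc : Set (Euc d) → Submodule ℝ (Euc d → Euc d)) (ε : ℝ) :
    Set (Euc d → Euc d) :=
  {w | ∃ v ∈ discreteSpace 𝒯 Vloc, ∃ u ∈ smoothSpace 𝒯 (3 / 2 + ε), w = v + u}

/-! ### The convection term and its norms (`b` is the convective field at a fixed time) -/

/-- The convective form with upwinding,
`c_h(b; w, v) = ∫_Ω (b·∇_h)w·v - ∑_F ∫_F (b·n_F) ⟦w⟧·{v} + ∑_F ∫_F (γ/2) |b·n_F| ⟦w⟧·⟦v⟧`,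
the sums being over the interior facets. -/
def convForm (𝒯 : Mesh Ω) (γ : ℝ) (b w v : Euc d → Euc d) : ℝ :=
  (∑ K ∈ 𝒯.cells, ∫ x in K, ⟪∑ i, b x i • weakPartial K i w x, v x⟫)
  - (∑ F ∈ 𝒯.intFacets, ∫ x, facetFlux F b x * ⟪jump F w x, avg F v x⟫ ∂(facetMeasure F))
  + ∑ F ∈ 𝒯.intFacets,
      ∫ x, γ / 2 * |facetFlux F b x| * ⟪jump F w x, jump F v x⟫ ∂(facetMeasure F)

/-- The squared upwind seminorm `|w|²_{b,upw}`. -/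
def upwSq (𝒯 : Mesh Ω) (γ : ℝ) (b w : Euc d → Euc d) : ℝ :=
  ∑ F ∈ 𝒯.intFacets, ∫ x, γ / 2 * |facetFlux F b x| * ‖jump F w x‖ ^ 2 ∂(facetMeasure F)

/-- The squared norm `‖w‖²_{b,♯}`; `B` stands for `‖β‖_∞` and `h_K` is the diameter of `K`. -/
def sharpSq (𝒯 : Mesh Ω) (γ B : ℝ) (b w : Euc d → Euc d) : ℝ :=
  l2Norm Ω w ^ 2 + upwSq 𝒯 γ b w
  + B ^ 2 * ∑ K ∈ 𝒯.cells, (Metric.diam K)⁻¹ ^ 2 * l2Norm K w ^ 2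
  + B * ∑ K ∈ 𝒯.cells, ∫ x, ‖trace K w x‖ ^ 2 ∂(bdryMeasure K)

/-- The `L^∞(0,T; L^∞(Ω))`-norm of a time-dependent field, with values in `[0, ∞]`. -/
def eSupNorm (Ω : Set (Euc d)) (T : ℝ) (β : ℝ → Euc d → Euc d) : ℝ≥0∞ :=
  essSup (fun t => eLpNorm (β t) ⊤ (volume.restrict Ω)) (volume.restrict (Set.Ioc 0 T))

/-- A convective velocity `β ∈ L^∞(0,T; L^∞(Ω))` with `∇·β = 0` in `Ω` and `β·n = 0` on `∂Ω`. -/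
structure IsConvectiveField (Ω : Set (Euc d)) (T : ℝ) (β : ℝ → Euc d → Euc d) : Prop where
  meas : AEStronglyMeasurable (Function.uncurry β)
    ((volume.restrict (Set.Ioc 0 T)).prod (volume.restrict Ω))
  bounded : eSupNorm Ω T β < ⊤
  divFree : ∀ᵐ t ∂(volume.restrict (Set.Ioc 0 T)), HasWeakDiv Ω (β t) 0
  noPenetration : ∀ᵐ t ∂(volume.restrict (Set.Ioc 0 T)), HasNormalTrace Ω (β t) 0 0

end HdivFEM

end

open HdivFEM

/-!
On an element `K`, a bounded field `b` with `∇·b = 0` has a normal trace with `|b·n_K| ≤ ‖b‖_∞`, and the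
product rule `∫_K (b·∇w)·v + ∫_K w·(b·∇v) = ∫_∂K (b·n_K) w·v` holds for `w, v ∈ H¹(K)`
(`IsHalfSpaceRep.green`). Since `b` is divergence free in all of `Ω` and has no flux through `∂Ω`, the
outer fluxes of the elements cancel almost everywhere on the skeleton
(`Mesh.ae_sum_normalTrace_eq_zero`). Summing the product rule over the elements therefore leaves
`∑_F ∫_F (b·n_F) ⟦w·v⟧`, and `⟦w·v⟧ = ⟦w⟧·{v} + {w}·⟦v⟧` turns the convective form into
`-∑_K ∫_K w·(b·∇v) + ∑_F ∫_F (b·n_F) {w}·⟦v⟧ + ∑_F ∫_F (γ/2) |b·n_F| ⟦w⟧·⟦v⟧` (`Mesh.convForm_eq`).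
Now the derivative is on the discrete function, where the inverse inequality applies, and both facet
terms contain `⟦v⟧`, so that Young's inequality absorbs them into the upwind seminorm of `v`
(`abs_sum_integral_weakPartial_le`, `Mesh.facet_young`, `Mesh.abs_convForm_le`).

The existence of the traces rests on smooth cut-off functions of a polytope that vanish near its
boundary: their gradients concentrate on the facets and converge to the surface measure
(`IsHalfSpaceRep.tendsto_integral_layer`). Testing the weak divergence with them bounds
`|∫_K b·∇φ|` by `‖b‖_∞ ∫_∂K |φ|`, and duality of `L¹` and `L^∞` gives the normal trace
(`IsHalfSpaceRep.normalTrace_spec`). Applied to the field `|φ|² (x - z)` with `z` in the interior of `K`,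
the same limit is Green's formula behind the trace inequality
(`IsHalfSpaceRep.exists_trace_inequality`); with the density of smooth functions in `H¹(K)`, by
contraction towards `z` and mollification, it yields the trace of `H¹` functions
(`IsHalfSpaceRep.exists_isTrace`).

On the skeleton, almost every boundary point of an element lies in the relative interior of a facet,
where the element is locally a half-space. Elements with disjoint interiors that meet there have opposite
normals, so at most two of them do, and they share an interior facet (`Mesh.ae_skeleton`).
-/

namespace HdivFEM

variable {d : ℕ}

/-! ### Convex polytopes as intersections of half-spaces -/

/-- The signed distance from `x` to the hyperplane `⟪p.1, ·⟫ = p.2` (if `‖p.1‖ = 1`), positive on the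
inner side. -/
noncomputable def gap (p : Euc d × ℝ) (x : Euc d) : ℝ := p.2 - ⟪p.1, x⟫

/-- `S` is a set of half-spaces with unit outer normals whose intersection is the bounded convex body
`K`. Members of `S` may be redundant, but no half-space is listed twice. -/
structure IsHalfSpaceRep (K : Set (Euc d)) (S : Finset (Euc d × ℝ)) : Prop where
  unit : ∀ p ∈ S, ‖p.1‖ = 1
  eq : K = {x | ∀ p ∈ S, 0 ≤ gap p x}
  bounded : Bornology.IsBounded K
  nonempty : (interior K).Nonempty

@[fun_prop]
theorem continuous_gap (p : Euc d × ℝ) : Continuous (gap p) := by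
  unfold gap; fun_prop

@[fun_prop]
theorem contDiff_gap (p : Euc d × ℝ) : ContDiff ℝ ∞ (gap p) :=
  contDiff_const.sub (contDiff_const.inner ℝ contDiff_id)

theorem gap_add_smul (p : Euc d × ℝ) (x v : Euc d) (t : ℝ) :
    gap p (x + t • v) = gap p x - t * ⟪p.1, v⟫ := by
  simp only [gap, inner_add_right, inner_smul_right]; ring

theorem IsPolytope.exists_isHalfSpaceRep {K : Set (Euc d)} (hK : IsPolytope K) :
    ∃ S, IsHalfSpaceRep K S := by
  classical
  obtain ⟨hb, hi, S, hS⟩ := hK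
  refine ⟨(S.filter (fun p => p.1 ≠ 0)).image (fun p => (‖p.1‖⁻¹ • p.1, ‖p.1‖⁻¹ * p.2)),
    ?_, ?_, hb, hi⟩
  · intro q hq
    simp only [Finset.mem_image, Finset.mem_filter] at hq
    obtain ⟨p, ⟨_, hp⟩, rfl⟩ := hq
    simp [norm_smul, hp]
  · obtain ⟨z, hz⟩ := hi
    have hz := interior_subset hz
    rw [hS] at hz ⊢
    have key : ∀ p : Euc d × ℝ, p.1 ≠ 0 → ∀ x,
        0 ≤ gap (‖p.1‖⁻¹ • p.1, ‖p.1‖⁻¹ * p.2) x ↔ ⟪p.1, x⟫ ≤ p.2 := by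
      intro p hp x
      have : 0 < ‖p.1‖⁻¹ := by positivity
      simp only [gap, real_inner_smul_left, sub_nonneg]
      exact mul_le_mul_iff_right₀ this
    ext x
    simp only [Set.mem_ofPred_eq, Finset.mem_image, Finset.mem_filter]
    constructor
    · rintro h q ⟨p, ⟨hp, hp0⟩, rfl⟩
      exact (key p hp0 x).2 (h p hp)
    · intro h p hp
      by_cases hp0 : p.1 = 0
      · have := hz p hp
        simpa [hp0] using this
      · exact (key p hp0 x).1 (h _ ⟨p, ⟨hp, hp0⟩, rfl⟩)

theorem hyperplane_eq {p : Euc d × ℝ} (hp : ‖p.1‖ = 1) :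
    {x : Euc d | ⟪p.1, x⟫ = ⟪p.1, p.2 • p.1⟫} = {x | gap p x = 0} := by
  ext x
  simp only [Set.mem_ofPred_eq, gap, inner_smul_right, real_inner_self_eq_norm_sq, hp]
  constructor <;> intro h <;> linarith

namespace IsHalfSpaceRep

variable {K : Set (Euc d)} {S : Finset (Euc d × ℝ)}

theorem isClosed (h : IsHalfSpaceRep K S) : IsClosed K := by
  rw [h.eq]
  simp only [Set.ofPred_forall]
  exact isClosed_biInter fun p _ => isClosed_le continuous_const (continuous_gap p)

theorem measurableSet_facet (h : IsHalfSpaceRep K S) (p : Euc d × ℝ) :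
    MeasurableSet (K ∩ {x | gap p x = 0}) :=
  (h.isClosed.inter (isClosed_eq (continuous_gap p) continuous_const)).measurableSet

theorem isCompact (h : IsHalfSpaceRep K S) : IsCompact K :=
  Metric.isCompact_of_isClosed_isBounded h.isClosed h.bounded

theorem convex (h : IsHalfSpaceRep K S) : Convex ℝ K := by
  rw [h.eq]
  simp only [Set.ofPred_forall]
  refine convex_iInter₂ fun p _ => ?_
  have : {x : Euc d | 0 ≤ gap p x} = {x | ⟪p.1, x⟫ ≤ p.2} := by
    ext x; simp [gap]
  rw [this]
  exact convex_halfSpace_le (innerₛₗ ℝ p.1).isLinear p.2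

theorem interior_eq (h : IsHalfSpaceRep K S) : interior K = {x | ∀ p ∈ S, 0 < gap p x} := by
  apply Set.Subset.antisymm
  · intro x hx p hp
    by_contra! hle
    have hc : Tendsto (fun t : ℝ => x + t • p.1) (𝓝[>] 0) (𝓝 x) := by
      have : Continuous (fun t : ℝ => x + t • p.1) := by fun_prop
      simpa using (this.tendsto 0).mono_left nhdsWithin_le_nhds
    have h1 := hc.eventually (mem_interior_iff_mem_nhds.1 hx)
    obtain ⟨t, ht, ht0⟩ := (h1.and self_mem_nhdsWithin).exists
    have ht0 : 0 < t := ht0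
    have ht : x + t • p.1 ∈ K := ht
    rw [h.eq] at ht
    have := ht p hp
    rw [gap_add_smul, real_inner_self_eq_norm_sq, h.unit p hp] at this
    linarith
  · apply interior_maximal
    · intro x hx
      rw [h.eq]
      exact fun p hp => (hx p hp).le
    · simp only [Set.ofPred_forall]
      exact isOpen_biInter_finset fun p _ => isOpen_lt continuous_const (continuous_gap p)

theorem frontier_eq (h : IsHalfSpaceRep K S) :
    frontier K = ⋃ p ∈ S, K ∩ {x | gap p x = 0} := by
  rw [h.isClosed.frontier_eq, h.interior_eq]
  ext x
  simp only [Set.mem_sdiff, Set.mem_ofPred_eq, Set.mem_iUnion, Set.mem_inter_iff, not_forall, not_lt,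
    exists_prop]
  constructor
  · rintro ⟨hx, p, hp, hle⟩
    have hx' := hx
    rw [h.eq] at hx'
    exact ⟨p, hp, hx, le_antisymm hle (hx' p hp)⟩
  · rintro ⟨p, hp, hx, he⟩
    exact ⟨hx, p, hp, he.le⟩

end IsHalfSpaceRep

/-! ### Hausdorff measure on hyperplanes -/

theorem finrank_orthogonal_span_unit {n : Euc d} (hn : ‖n‖ = 1) :
    Module.finrank ℝ (ℝ ∙ n)ᗮ = d - 1 := by
  have h0 : n ≠ 0 := by rintro rfl; simp at hn
  have h1 := (ℝ ∙ n).finrank_add_finrank_orthogonal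
  rw [finrank_span_singleton h0, finrank_euclideanSpace_fin] at h1
  omega

/-- A convex set of affine dimension less than `d - 1` has no surface measure. -/
theorem surface_eq_zero_of_finrank_lt {A : Set (Euc d)} (hA : Convex ℝ A)
    (h : A.Nonempty → Module.finrank ℝ (vectorSpan ℝ A) < d - 1) :
    (μHE[d - 1] : Measure (Euc d)) A = 0 := by
  rcases A.eq_empty_or_nonempty with rfl | hne
  · simp
  have hdim := Real.Convex.dimH_eq_finrank_vectorSpan hA hne
  have hlt : dimH A < (((d - 1 : ℕ) : NNReal) : ℝ≥0∞) := by
    rw [hdim]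
    exact_mod_cast h hne
  have := hausdorffMeasure_of_dimH_lt hlt
  rw [Measure.euclideanHausdorffMeasure_def, Measure.smul_apply]
  have h2 : (μH[((d - 1 : ℕ) : ℝ)] : Measure (Euc d)) A = 0 := by
    rwa [NNReal.coe_natCast] at this
  rw [h2, smul_zero]

theorem vectorSpan_le_orthogonal {A : Set (Euc d)} {n : Euc d} {c : ℝ}
    (h : ∀ x ∈ A, ⟪n, x⟫ = c) : vectorSpan ℝ A ≤ (ℝ ∙ n)ᗮ := by
  rw [vectorSpan, Submodule.span_le]
  rintro _ ⟨x, hx, y, hy, rfl⟩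
  rw [SetLike.mem_coe, Submodule.mem_orthogonal_singleton_iff_inner_right]
  simp [inner_sub_right, h x hx, h y hy]

theorem eq_or_eq_neg_of_inner_sq_eq_one {m n : Euc d} (hm : ‖m‖ = 1) (hn : ‖n‖ = 1)
    (h : ⟪m, n⟫ ^ 2 = 1) : m = n ∨ m = -n := by
  rcases (sq_eq_sq_iff_eq_or_eq_neg.1 (h.trans (one_pow 2).symm)) with h | h
  · exact Or.inl ((inner_eq_one_iff_of_norm_eq_one hm hn).1 h)
  · right
    refine (inner_eq_one_iff_of_norm_eq_one (𝕜 := ℝ) hm (by simpa using hn)).1 ?_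
    simp [h]

namespace IsHalfSpaceRep

variable {K : Set (Euc d)} {S : Finset (Euc d × ℝ)}

/-- Two different facet hyperplanes of a polytope meet in a set without surface measure. They
cannot coincide with opposite normals, because `K` has interior points. -/
theorem surface_hyperplanes_inter (h : IsHalfSpaceRep K S) {p q : Euc d × ℝ} (hp : p ∈ S)
    (hq : q ∈ S) (hpq : p ≠ q) :
    (μHE[d - 1] : Measure (Euc d)) {x | gap p x = 0 ∧ gap q x = 0} = 0 := by
  have hmem : ∀ x ∈ {x : Euc d | gap p x = 0 ∧ gap q x = 0}, ⟪p.1, x⟫ = p.2 ∧ ⟪q.1, x⟫ = q.2 := by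
    rintro x ⟨h1, h2⟩
    constructor <;> [have := h1; have := h2] <;> simp only [gap] at this <;> linarith
  apply surface_eq_zero_of_finrank_lt
  · intro x hx y hy a b _ _ hab
    have hx := hmem x hx
    have hy := hmem y hy
    have e1 : p.2 - (a * p.2 + b * p.2) = 0 := by rw [← add_mul, hab]; ring
    have e2 : q.2 - (a * q.2 + b * q.2) = 0 := by rw [← add_mul, hab]; ring
    constructor <;> simp only [gap, inner_add_right, inner_smul_right, hx, hy, e1, e2]
  · rintro ⟨x, hx⟩
    rw [← finrank_orthogonal_span_unit (h.unit p hp)]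
    apply Submodule.finrank_lt_finrank_of_lt
    refine lt_of_le_of_ne (vectorSpan_le_orthogonal fun y hy => (hmem y hy).1) fun heq => ?_
    have hle : (ℝ ∙ p.1)ᗮ ≤ (ℝ ∙ q.1)ᗮ := by
      rw [← heq]; exact vectorSpan_le_orthogonal fun y hy => (hmem y hy).2
    have hv : q.1 - ⟪p.1, q.1⟫ • p.1 ∈ (ℝ ∙ p.1)ᗮ := by
      rw [Submodule.mem_orthogonal_singleton_iff_inner_right, inner_sub_right, inner_smul_right,
        real_inner_self_eq_norm_sq, h.unit p hp]
      ring
    have hv' := hle hv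
    rw [Submodule.mem_orthogonal_singleton_iff_inner_right, inner_sub_right, inner_smul_right,
      real_inner_self_eq_norm_sq, h.unit q hq, real_inner_comm] at hv'
    rcases eq_or_eq_neg_of_inner_sq_eq_one (h.unit p hp) (h.unit q hq)
      (by rw [real_inner_comm]; linarith) with e | e
    · apply hpq
      refine Prod.ext e ?_
      rw [← (hmem x hx).1, ← (hmem x hx).2, e]
    · obtain ⟨z, hz⟩ := h.nonempty
      rw [h.interior_eq] at hz
      have h1 := hz p hp
      have h2 := hz q hq
      have h3 := (hmem x hx).1
      have h4 := (hmem x hx).2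
      simp only [gap, e, inner_neg_left] at h1 h2 h3
      linarith

end IsHalfSpaceRep

/-- Coordinates adapted to the hyperplane through `p₀` with unit normal `n`: the point with foot
`p₀ + y` at (signed) depth `s` below the hyperplane. -/
noncomputable def slicePoint (n p₀ : Euc d) (z : (ℝ ∙ n)ᗮ × ℝ) : Euc d := p₀ + z.1 - z.2 • n

theorem measurePreserving_slicePoint {n : Euc d} (hn : ‖n‖ = 1) (p₀ : Euc d) :
    MeasurePreserving (slicePoint n p₀) := by
  have hor : (ℝ ∙ n)ᗮᗮ = ℝ ∙ n := Submodule.orthogonal_orthogonal _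
  have hn' : n ∈ (ℝ ∙ n)ᗮᗮ := by rw [hor]; exact Submodule.mem_span_singleton_self n
  have h0 : n ≠ 0 := by rintro rfl; simp at hn
  let L : ℝ →ₗᵢ[ℝ] (ℝ ∙ n)ᗮᗮ :=
    { toLinearMap := LinearMap.toSpanSingleton ℝ _ (-⟨n, hn'⟩)
      norm_map' := fun t => by
        simp [norm_smul, hn] }
  let e : ℝ ≃ₗᵢ[ℝ] (ℝ ∙ n)ᗮᗮ := L.toLinearIsometryEquiv (by
    rw [Module.finrank_self, hor, finrank_span_singleton h0])
  have h1 := ((ℝ ∙ n)ᗮ.measurePreserving_measurableEquivProd p₀).symm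
  rw [InnerProductSpace.euclideanHausdorffMeasure_eq_volume] at h1
  have h2 : MeasurePreserving (Prod.map (id : (ℝ ∙ n)ᗮ → (ℝ ∙ n)ᗮ) e) :=
    (MeasurePreserving.id _).prod e.measurePreserving
  convert h1.comp h2 using 1
  ext1 z
  have he : ((e z.2 : (ℝ ∙ n)ᗮᗮ) : Euc d) = -(z.2 • n) := by
    simp [e, L]
  simp only [slicePoint, Function.comp_apply, Submodule.measurableEquivProd_symm_apply, Prod.map_fst,
    Prod.map_snd, id, he, vadd_eq_add]
  abel

theorem isometry_hyperplane (n p₀ : Euc d) :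
    Isometry (fun y : (ℝ ∙ n)ᗮ => p₀ + (y : Euc d)) :=
  (isometry_add_left p₀).comp isometry_subtype_coe

theorem measurableEmbedding_hyperplane (n p₀ : Euc d) :
    MeasurableEmbedding (fun y : (ℝ ∙ n)ᗮ => p₀ + (y : Euc d)) :=
  (isometry_hyperplane n p₀).isClosedEmbedding.measurableEmbedding

/-- The surface measure on a hyperplane is Lebesgue measure in orthonormal coordinates. -/
theorem map_hyperplane {n : Euc d} (hn : ‖n‖ = 1) (p₀ : Euc d) :
    (volume : Measure (ℝ ∙ n)ᗮ).map (fun y : (ℝ ∙ n)ᗮ => p₀ + (y : Euc d)) =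
      (μHE[d - 1]).restrict {x : Euc d | ⟪n, x⟫ = ⟪n, p₀⟫} := by
  have h1 := (isometry_hyperplane n p₀).map_euclideanHausdorffMeasure (d := d - 1)
  have h2 : (μHE[d - 1] : Measure (ℝ ∙ n)ᗮ) = volume := by
    rw [← finrank_orthogonal_span_unit hn]
    exact InnerProductSpace.euclideanHausdorffMeasure_eq_volume
  rw [h2] at h1
  rw [h1]
  congr 1
  ext x
  simp only [Set.mem_range, Set.mem_ofPred_eq]
  constructor
  · rintro ⟨y, rfl⟩
    rw [inner_add_right, Submodule.mem_orthogonal_singleton_iff_inner_right.1 y.2, add_zero]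
  · intro hx
    refine ⟨⟨x - p₀, ?_⟩, by simp⟩
    rw [Submodule.mem_orthogonal_singleton_iff_inner_right, inner_sub_right, hx, sub_self]

/-! ### Boundary layers of a polytope -/

/-- A smooth step: `0` up to `t = 1`, `1` from `t = 2` on. -/
noncomputable def smoothStep (t : ℝ) : ℝ := Real.smoothTransition (t - 1)

theorem contDiff_smoothStep : ContDiff ℝ ∞ smoothStep :=
  Real.smoothTransition.contDiff.comp (contDiff_id.sub contDiff_const)

theorem smoothStep_of_le {t : ℝ} (h : t ≤ 1) : smoothStep t = 0 :=
  Real.smoothTransition.zero_of_nonpos (by linarith)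

theorem smoothStep_of_ge {t : ℝ} (h : 2 ≤ t) : smoothStep t = 1 :=
  Real.smoothTransition.one_of_one_le (by linarith)

theorem smoothStep_nonneg (t : ℝ) : 0 ≤ smoothStep t := Real.smoothTransition.nonneg _

theorem smoothStep_le_one (t : ℝ) : smoothStep t ≤ 1 := Real.smoothTransition.le_one _

theorem continuous_deriv_smoothStep : Continuous (deriv smoothStep) :=
  contDiff_smoothStep.continuous_deriv (by simp)

theorem monotone_smoothStep : Monotone smoothStep :=
  fun _ _ h => Real.smoothTransition.monotone (by linarith)

theorem deriv_smoothStep_nonneg (t : ℝ) : 0 ≤ deriv smoothStep t :=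
  monotone_smoothStep.deriv_nonneg

theorem deriv_smoothStep_eq_zero {t : ℝ} (h : t ∉ Set.Icc (1 : ℝ) 2) : deriv smoothStep t = 0 := by
  rw [Set.mem_Icc, not_and_or, not_le, not_le] at h
  rcases h with h | h
  · have : smoothStep =ᶠ[𝓝 t] fun _ => 0 := by
      filter_upwards [Iio_mem_nhds h] with s hs using smoothStep_of_le (le_of_lt hs)
    rw [this.deriv_eq, deriv_const]
  · have : smoothStep =ᶠ[𝓝 t] fun _ => 1 := by
      filter_upwards [Ioi_mem_nhds h] with s hs using smoothStep_of_ge (le_of_lt hs)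
    rw [this.deriv_eq, deriv_const]

theorem hasCompactSupport_deriv_smoothStep : HasCompactSupport (deriv smoothStep) :=
  HasCompactSupport.intro isCompact_Icc fun _ h => deriv_smoothStep_eq_zero h

theorem integral_deriv_smoothStep : ∫ t, deriv smoothStep t = 1 := by
  have h := integral_of_hasDerivAt_of_tendsto (f := smoothStep) (f' := deriv smoothStep)
    (m := 0) (n := 1)
    (fun x => (contDiff_smoothStep.differentiable (by simp) x).hasDerivAt)
    (continuous_deriv_smoothStep.integrable_of_hasCompactSupport hasCompactSupport_deriv_smoothStep)
    (tendsto_const_nhds.congr' ?_) (tendsto_const_nhds.congr' ?_)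
  · simpa using h
  · filter_upwards [eventually_le_atBot (1 : ℝ)] with t ht using (smoothStep_of_le ht).symm
  · filter_upwards [eventually_ge_atTop (2 : ℝ)] with t ht using (smoothStep_of_ge ht).symm

/-- A smooth cut-off, `0` at distance at most `δ` and `1` at distance at least `2δ` from all the facet
hyperplanes. -/
noncomputable def cutoff (S : Finset (Euc d × ℝ)) (δ : ℝ) (x : Euc d) : ℝ :=
  ∏ p ∈ S, smoothStep (gap p x / δ)

open Classical in
/-- The part of the gradient of `cutoff S δ` due to the half-space `p`: the inner normal derivative,
concentrated in a layer of width `δ` along the hyperplane of `p` and of total mass tending to the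
surface measure of the facet. -/
noncomputable def layer (S : Finset (Euc d × ℝ)) (p : Euc d × ℝ) (δ : ℝ) (x : Euc d) : ℝ :=
  δ⁻¹ * (deriv smoothStep (gap p x / δ) * ∏ q ∈ S.erase p, smoothStep (gap q x / δ))

theorem contDiff_cutoff (S : Finset (Euc d × ℝ)) (δ : ℝ) : ContDiff ℝ ∞ (cutoff S δ) :=
  contDiff_prod fun p _ => contDiff_smoothStep.comp ((contDiff_gap p).div_const δ)

theorem continuous_layer (S : Finset (Euc d × ℝ)) (p : Euc d × ℝ) (δ : ℝ) :
    Continuous (layer S p δ) := by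
  have h1 := continuous_deriv_smoothStep
  have h2 := contDiff_smoothStep.continuous
  unfold layer
  fun_prop

theorem layer_nonneg (S : Finset (Euc d × ℝ)) (p : Euc d × ℝ) {δ : ℝ} (hδ : 0 < δ) (x : Euc d) :
    0 ≤ layer S p δ x :=
  mul_nonneg (by positivity) (mul_nonneg (deriv_smoothStep_nonneg _)
    (Finset.prod_nonneg fun _ _ => smoothStep_nonneg _))

theorem fderiv_cutoff (S : Finset (Euc d × ℝ)) (δ : ℝ) (x v : Euc d) :
    fderiv ℝ (cutoff S δ) x v = -∑ p ∈ S, layer S p δ x * ⟪p.1, v⟫ := by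
  classical
  have h1 : ∀ p ∈ S, HasFDerivAt (fun y => smoothStep (gap p y / δ))
      ((deriv smoothStep (gap p x / δ)) • (δ⁻¹ • (-(innerSL ℝ p.1)))) x := by
    intro p _
    have hg : HasFDerivAt (gap p) (-(innerSL ℝ p.1)) x :=
      ((innerSL ℝ p.1).hasFDerivAt).const_sub p.2
    have hg' : HasFDerivAt (fun y => gap p y / δ) (δ⁻¹ • (-(innerSL ℝ p.1))) x := by
      simpa only [div_eq_inv_mul] using hg.const_mul δ⁻¹
    exact (contDiff_smoothStep.differentiable (by simp) _).hasDerivAt.comp_hasFDerivAt x hg'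
  have h2 : HasFDerivAt (cutoff S δ) _ x := HasFDerivAt.finsetProd h1
  rw [h2.fderiv, sum_apply, ← Finset.sum_neg_distrib]
  refine Finset.sum_congr rfl fun p _ => ?_
  simp only [layer, smul_apply, neg_apply, innerSL_apply_apply,
    smul_eq_mul]
  have : S.erase p = @Finset.erase _ (fun a b => Classical.propDecidable _) S p := by congr!
  rw [this]
  ring

namespace IsHalfSpaceRep

variable {K : Set (Euc d)} {S : Finset (Euc d × ℝ)}

theorem cutoff_eq_zero {δ : ℝ} (hδ : 0 < δ) {x : Euc d}
    (hx : x ∉ {x | ∀ p ∈ S, δ ≤ gap p x}) : cutoff S δ x = 0 := by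
  simp only [Set.mem_ofPred_eq, not_forall, not_le] at hx
  obtain ⟨p, hp, hlt⟩ := hx
  refine Finset.prod_eq_zero hp (smoothStep_of_le ?_)
  rw [div_le_one hδ]; exact hlt.le

theorem inner_set_subset (h : IsHalfSpaceRep K S) {δ : ℝ} (hδ : 0 < δ) :
    {x | ∀ p ∈ S, δ ≤ gap p x} ⊆ interior K := by
  rw [h.interior_eq]
  exact fun x hx p hp => hδ.trans_le (hx p hp)

theorem tsupport_cutoff_subset (h : IsHalfSpaceRep K S) {δ : ℝ} (hδ : 0 < δ) :
    tsupport (cutoff S δ) ⊆ interior K := by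
  refine subset_trans (closure_minimal ?_ ?_) (h.inner_set_subset hδ)
  · intro x hx
    by_contra hc
    exact hx (cutoff_eq_zero hδ hc)
  · simp only [Set.ofPred_forall]
    exact isClosed_biInter fun p _ => isClosed_le continuous_const (continuous_gap p)

theorem cutoff_mem_Icc (δ : ℝ) (x : Euc d) : cutoff S δ x ∈ Set.Icc (0 : ℝ) 1 :=
  ⟨Finset.prod_nonneg fun _ _ => smoothStep_nonneg _,
    Finset.prod_le_one (fun _ _ => smoothStep_nonneg _) fun _ _ => smoothStep_le_one _⟩

theorem tendsto_cutoff (h : IsHalfSpaceRep K S) {x : Euc d} (hx : x ∈ interior K) :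
    Tendsto (fun δ => cutoff S δ x) (𝓝[>] 0) (𝓝 1) := by
  rw [h.interior_eq] at hx
  have : ∀ᶠ δ : ℝ in 𝓝[>] 0, ∀ p ∈ S, smoothStep (gap p x / δ) = 1 := by
    rw [Filter.eventually_all_finset]
    intro p hp
    have h1 : Tendsto (fun δ : ℝ => gap p x / δ) (𝓝[>] 0) atTop :=
      Tendsto.const_mul_atTop (hx p hp) tendsto_inv_nhdsGT_zero
    filter_upwards [h1.eventually_ge_atTop 2] with δ hδ using smoothStep_of_ge hδ
  refine tendsto_const_nhds.congr' ?_
  filter_upwards [this] with δ hδ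
  exact (Finset.prod_eq_one hδ).symm

theorem layer_eq_zero (h : IsHalfSpaceRep K S) {p : Euc d × ℝ} {δ : ℝ}
    (hδ : 0 < δ) {x : Euc d} (hx : x ∉ K) : layer S p δ x = 0 := by
  classical
  rw [h.eq] at hx
  simp only [Set.mem_ofPred_eq, not_forall, not_le] at hx
  obtain ⟨q, hq, hlt⟩ := hx
  have hle : gap q x / δ < 1 := (div_neg_of_neg_of_pos hlt hδ).trans one_pos
  by_cases hqp : q = p
  · subst hqp
    rw [layer, deriv_smoothStep_eq_zero (fun hm => absurd hm.1 (not_le.2 hle))]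
    simp
  · rw [layer, Finset.prod_eq_zero (Finset.mem_erase.2 ⟨hqp, hq⟩) (smoothStep_of_le hle.le)]
    simp

end IsHalfSpaceRep

theorem integral_slicePoint_smul {n : Euc d} (hn : ‖n‖ = 1) (p₀ : Euc d) {δ : ℝ} (hδ : 0 < δ)
    {F : Euc d → ℝ} (hF : Continuous F) :
    ∫ z : (ℝ ∙ n)ᗮ × ℝ, F (slicePoint n p₀ (z.1, δ * z.2)) = δ⁻¹ * ∫ x, F x := by
  have hm := measurePreserving_slicePoint hn p₀
  have hc : Continuous (slicePoint n p₀) := by unfold slicePoint; fun_prop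
  have h1 : Measure.map (Prod.map (id : (ℝ ∙ n)ᗮ → (ℝ ∙ n)ᗮ) (δ * ·)) volume =
      ENNReal.ofReal |δ⁻¹| • (volume : Measure ((ℝ ∙ n)ᗮ × ℝ)) := by
    rw [Measure.volume_eq_prod, ← Measure.map_prod_map _ _ measurable_id (by fun_prop),
      Real.map_volume_mul_left hδ.ne', Measure.map_id, Measure.prod_smul_right]
  have h2 : ∫ z : (ℝ ∙ n)ᗮ × ℝ, F (slicePoint n p₀ (z.1, δ * z.2)) =
      ∫ z, F (slicePoint n p₀ z)
        ∂(Measure.map (Prod.map (id : (ℝ ∙ n)ᗮ → (ℝ ∙ n)ᗮ) (δ * ·)) volume) := by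
    rw [integral_map (f := fun z => F (slicePoint n p₀ z))
      (by fun_prop) (hF.comp hc).aestronglyMeasurable]
    rfl
  rw [h2, h1, integral_smul_measure, ← hm.map_eq,
    integral_map hm.aemeasurable hF.aestronglyMeasurable, abs_of_pos (by positivity),
    ENNReal.toReal_ofReal (by positivity), smul_eq_mul]

theorem norm_le_of_slicePoint {n p₀ : Euc d} (hn : ‖n‖ = 1) {y : (ℝ ∙ n)ᗮ} {s R : ℝ}
    (h : ‖slicePoint n p₀ (y, s) - p₀‖ ≤ R) : ‖y‖ ≤ R + |s| := by
  have : (y : Euc d) = (slicePoint n p₀ (y, s) - p₀) + s • n := by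
    simp [slicePoint]; abel
  calc ‖y‖ = ‖(y : Euc d)‖ := rfl
    _ ≤ ‖slicePoint n p₀ (y, s) - p₀‖ + ‖s • n‖ := by rw [this]; exact norm_add_le _ _
    _ ≤ R + |s| := by rw [norm_smul, hn, mul_one, Real.norm_eq_abs]; gcongr

namespace IsHalfSpaceRep

variable {K : Set (Euc d)} {S : Finset (Euc d × ℝ)}

/-- Almost every point of a facet hyperplane lies on no other facet hyperplane. -/
theorem ae_gap_ne_zero (h : IsHalfSpaceRep K S) {p : Euc d × ℝ} (hp : p ∈ S) :
    ∀ᵐ x ∂(μHE[d - 1] : Measure (Euc d)).restrict {x | gap p x = 0},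
      ∀ q ∈ S, q ≠ p → gap q x ≠ 0 := by
  rw [ae_restrict_iff' (isClosed_eq (continuous_gap p) continuous_const).measurableSet]
  have : ∀ q ∈ S, ∀ᵐ x ∂(μHE[d - 1] : Measure (Euc d)), q ≠ p → ¬ (gap p x = 0 ∧ gap q x = 0) := by
    intro q hq
    by_cases hqp : q = p
    · simp [hqp]
    · have := measure_eq_zero_iff_ae_notMem.1 (h.surface_hyperplanes_inter hp hq (Ne.symm hqp))
      filter_upwards [this] with x hx _ using hx
  have := (Finset.eventually_all S).2 this
  filter_upwards [this] with x hx hpx q hq hqp hqx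
  exact hx q hq hqp ⟨hpx, hqx⟩

/-- As the width of the layer along a facet tends to zero, the layer density converges to the surface
measure on the facet. -/
theorem tendsto_integral_layer (h : IsHalfSpaceRep K S) {p : Euc d × ℝ} (hp : p ∈ S)
    {f : Euc d → ℝ} (hf : Continuous f) :
    Tendsto (fun δ => ∫ x, f x * layer S p δ x) (𝓝[>] 0)
      (𝓝 (∫ x in K ∩ {x | gap p x = 0}, f x ∂μHE[d - 1])) := by
  classical
  have hn := h.unit p hp
  set n := p.1 with hn_def
  set p₀ : Euc d := p.2 • n with hp₀
  have hset : {x : Euc d | ⟪n, x⟫ = ⟪n, p₀⟫} = {x | gap p x = 0} := hyperplane_eq hn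
  have hgp : ∀ (y : (ℝ ∙ n)ᗮ) (s : ℝ), gap p (slicePoint n p₀ (y, s)) = s := by
    intro y s
    have h1 : ⟪n, (y : Euc d)⟫ = 0 := Submodule.mem_orthogonal_singleton_iff_inner_right.1 y.2
    simp only [gap, slicePoint, hp₀, inner_sub_right, inner_add_right, inner_smul_right, ← hn_def, h1,
      real_inner_self_eq_norm_sq, hn]
    ring
  have hsl : Continuous (slicePoint n p₀) := by unfold slicePoint; fun_prop
  obtain ⟨M, hM⟩ := h.isCompact.exists_bound_of_continuousOn hf.continuousOn
  obtain ⟨D, hD⟩ := hasCompactSupport_deriv_smoothStep.exists_bound_of_continuous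
    continuous_deriv_smoothStep
  obtain ⟨R, hR⟩ := h.bounded.subset_closedBall p₀
  -- `Φ δ` is the integrand in coordinates along the facet, with the depth rescaled by `δ`; it converges
  -- pointwise to `Φ₀`, in which the depth separates
  let Φ : ℝ → (ℝ ∙ n)ᗮ × ℝ → ℝ := fun δ z =>
    δ * (f (slicePoint n p₀ (z.1, δ * z.2)) * layer S p δ (slicePoint n p₀ (z.1, δ * z.2)))
  let G : Euc d → ℝ := (K ∩ {x | gap p x = 0}).indicator f
  let Φ₀ : (ℝ ∙ n)ᗮ × ℝ → ℝ := fun z => G (p₀ + z.1) * deriv smoothStep z.2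
  have hKm := h.measurableSet_facet p
  have e1 : ∀ δ : ℝ, 0 < δ → ∫ x, f x * layer S p δ x = ∫ z, Φ δ z := by
    intro δ hδ
    rw [integral_const_mul, integral_slicePoint_smul (F := fun x => f x * layer S p δ x) hn p₀ hδ
      (hf.mul (continuous_layer S p δ)), mul_inv_cancel_left₀ hδ.ne']
  have e2 : ∫ z, Φ₀ z = ∫ x in K ∩ {x | gap p x = 0}, f x ∂μHE[d - 1] := by
    have hprod : ∫ z, Φ₀ z = (∫ y : (ℝ ∙ n)ᗮ, G (p₀ + y)) * ∫ t, deriv smoothStep t :=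
      integral_prod_mul (μ := (volume : Measure (ℝ ∙ n)ᗮ)) (ν := (volume : Measure ℝ))
        (fun y : (ℝ ∙ n)ᗮ => G (p₀ + (y : Euc d))) (deriv smoothStep)
    rw [hprod, integral_deriv_smoothStep, mul_one,
      ← (measurableEmbedding_hyperplane n p₀).integral_map, map_hyperplane hn, hset,
      integral_indicator hKm, Measure.restrict_restrict hKm]
    congr 2
    ext x; simp
  rw [← e2]
  refine Tendsto.congr' (f₁ := fun δ => ∫ z, Φ δ z) ?_ ?_
  · filter_upwards [self_mem_nhdsWithin] with δ hδ using (e1 δ hδ).symm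
  have hsm := contDiff_smoothStep.continuous
  refine tendsto_integral_filter_of_dominated_convergence
    ((Metric.closedBall 0 (R + 2) ×ˢ Set.Icc (1 : ℝ) 2).indicator fun _ => M * D) ?_ ?_ ?_ ?_
  · filter_upwards with δ
    have := continuous_layer S p δ
    exact Continuous.aestronglyMeasurable (by fun_prop)
  · filter_upwards [Ioo_mem_nhdsGT (zero_lt_one' ℝ)] with δ hδ
    filter_upwards with z
    have hM0 : 0 ≤ M := by
      obtain ⟨x, hx⟩ := h.nonempty
      exact (norm_nonneg _).trans (hM x (interior_subset hx))
    have hD0 : 0 ≤ D := (norm_nonneg _).trans (hD 0)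
    by_cases hK : slicePoint n p₀ (z.1, δ * z.2) ∈ K
    swap
    · simp only [Φ, h.layer_eq_zero hδ.1 hK, mul_zero, norm_zero]
      exact Set.indicator_nonneg (fun _ _ => by positivity) _
    have hval : Φ δ z = f (slicePoint n p₀ (z.1, δ * z.2)) * (deriv smoothStep z.2 *
        ∏ q ∈ S.erase p, smoothStep (gap q (slicePoint n p₀ (z.1, δ * z.2)) / δ)) := by
      simp only [Φ, layer, hgp]
      rw [mul_div_cancel_left₀ _ hδ.1.ne']
      have := hδ.1.ne'
      field_simp
    by_cases hz : z.2 ∈ Set.Icc (1 : ℝ) 2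
    swap
    · rw [hval, deriv_smoothStep_eq_zero hz]
      simp only [zero_mul, mul_zero, norm_zero]
      exact Set.indicator_nonneg (fun _ _ => by positivity) _
    have hmem : z ∈ Metric.closedBall (0 : (ℝ ∙ n)ᗮ) (R + 2) ×ˢ Set.Icc (1 : ℝ) 2 := by
      refine ⟨?_, hz⟩
      rw [mem_closedBall_zero_iff]
      have h1 := hR hK
      rw [mem_closedBall_iff_norm] at h1
      refine (norm_le_of_slicePoint hn h1).trans ?_
      rw [abs_of_nonneg (by have := hδ.1; have := hz.1; positivity)]
      have := hδ.1; have := hδ.2; have := hz.2; have := hz.1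
      nlinarith
    rw [Set.indicator_of_mem hmem, hval, norm_mul, norm_mul]
    refine mul_le_mul (hM _ hK) ?_ (by positivity) hM0
    have h2 : ‖∏ q ∈ S.erase p, smoothStep (gap q (slicePoint n p₀ (z.1, δ * z.2)) / δ)‖ ≤ 1 := by
      rw [Real.norm_of_nonneg (Finset.prod_nonneg fun _ _ => smoothStep_nonneg _)]
      exact Finset.prod_le_one (fun _ _ => smoothStep_nonneg _) fun _ _ => smoothStep_le_one _
    calc _ ≤ D * 1 := mul_le_mul (hD _) h2 (norm_nonneg _) hD0
      _ = D := mul_one D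
  · rw [integrable_indicator_iff (by measurability)]
    refine integrableOn_const ?_
    rw [Measure.volume_eq_prod, Measure.prod_prod]
    exact (ENNReal.mul_lt_top measure_closedBall_lt_top (by simp)).ne
  · have hae : ∀ᵐ y : (ℝ ∙ n)ᗮ, ∀ q ∈ S, q ≠ p → gap q (p₀ + y) ≠ 0 := by
      have h1 := h.ae_gap_ne_zero hp
      rw [← hset, ← map_hyperplane hn] at h1
      exact ae_of_ae_map (measurableEmbedding_hyperplane n p₀).measurable.aemeasurable h1
    have hae2 : ∀ᵐ z : (ℝ ∙ n)ᗮ × ℝ, ∀ q ∈ S, q ≠ p → gap q (p₀ + z.1) ≠ 0 :=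
      (Measure.quasiMeasurePreserving_fst (μ := (volume : Measure (ℝ ∙ n)ᗮ))
        (ν := (volume : Measure ℝ))).ae hae
    filter_upwards [hae2] with z hz
    have hlim : Tendsto (fun δ : ℝ => slicePoint n p₀ (z.1, δ * z.2)) (𝓝[>] 0)
        (𝓝 (p₀ + z.1)) := by
      have : Continuous fun δ : ℝ => slicePoint n p₀ (z.1, δ * z.2) := by fun_prop
      have h1 := (this.tendsto 0).mono_left (nhdsWithin_le_nhds (s := Set.Ioi 0))
      simpa [slicePoint] using h1
    -- off the other hyperplanes, the remaining factors tend to the indicator function of the facet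
    have hfac : ∀ q ∈ S.erase p, Tendsto
        (fun δ : ℝ => smoothStep (gap q (slicePoint n p₀ (z.1, δ * z.2)) / δ)) (𝓝[>] 0)
        (𝓝 (if 0 < gap q (p₀ + z.1) then 1 else 0)) := by
      intro q hq
      obtain ⟨hqp, hq⟩ := Finset.mem_erase.1 hq
      have hg := ((continuous_gap q).tendsto _).comp hlim
      rcases lt_or_gt_of_ne (hz q hq hqp) with hlt | hgt
      · rw [if_neg (not_lt.2 hlt.le)]
        refine tendsto_const_nhds.congr' ?_
        filter_upwards [hg.eventually_lt_const hlt, self_mem_nhdsWithin] with δ h1 h2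
        exact (smoothStep_of_le ((div_neg_of_neg_of_pos h1 h2).le.trans zero_le_one)).symm
      · rw [if_pos hgt]
        have h1 : Tendsto (fun δ : ℝ => gap q (slicePoint n p₀ (z.1, δ * z.2)) / δ) (𝓝[>] 0)
            atTop := Tendsto.pos_mul_atTop hgt hg tendsto_inv_nhdsGT_zero
        refine tendsto_const_nhds.congr' ?_
        filter_upwards [h1.eventually_ge_atTop 2] with δ hδ using (smoothStep_of_ge hδ).symm
    have hlim2 := (((hf.tendsto _).comp hlim).mul
      ((tendsto_finsetProd _ hfac).const_mul (deriv smoothStep z.2)))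
    have hΦ₀ : Φ₀ z = f (p₀ + z.1) * (deriv smoothStep z.2 *
        ∏ q ∈ S.erase p, if 0 < gap q (p₀ + z.1) then (1 : ℝ) else 0) := by
      have hg0 : gap p (p₀ + z.1) = 0 := by simpa [slicePoint] using hgp z.1 0
      by_cases hK : p₀ + (z.1 : Euc d) ∈ K
      · have hmem : p₀ + (z.1 : Euc d) ∈ K ∩ {x | gap p x = 0} := ⟨hK, hg0⟩
        rw [Finset.prod_eq_one, mul_one]
        · simp only [Φ₀, G, Set.indicator_of_mem hmem]
        · intro q hq
          obtain ⟨hqp, hq⟩ := Finset.mem_erase.1 hq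
          rw [h.eq] at hK
          rw [if_pos (lt_of_le_of_ne (hK q hq) (hz q hq hqp).symm)]
      · have hmem : p₀ + (z.1 : Euc d) ∉ K ∩ {x | gap p x = 0} := fun h => hK h.1
        simp only [Φ₀, G, Set.indicator_of_notMem hmem, zero_mul]
        rw [h.eq] at hK
        simp only [Set.mem_ofPred_eq, not_forall, not_le] at hK
        obtain ⟨q, hq, hlt⟩ := hK
        have hqp : q ≠ p := by rintro rfl; rw [hg0] at hlt; exact lt_irrefl _ hlt
        rw [Finset.prod_eq_zero (Finset.mem_erase.2 ⟨hqp, hq⟩) (if_neg (not_lt.2 hlt.le))]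
        simp
    rw [hΦ₀]
    refine hlim2.congr' ?_
    filter_upwards [self_mem_nhdsWithin] with δ hδ
    have hδ0 : δ ≠ 0 := ne_of_gt hδ
    simp only [Φ, layer, hgp, Function.comp_apply]
    rw [mul_div_cancel_left₀ _ hδ0]
    field_simp

end IsHalfSpaceRep

/-! ### The surface measure of a polytope boundary -/

namespace IsHalfSpaceRep

variable {K : Set (Euc d)} {S : Finset (Euc d × ℝ)}

theorem surface_facet_lt_top (h : IsHalfSpaceRep K S) {p : Euc d × ℝ} (hp : p ∈ S) :
    (μHE[d - 1] : Measure (Euc d)) (K ∩ {x | gap p x = 0}) < ⊤ := by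
  have hn := h.unit p hp
  set p₀ : Euc d := p.2 • p.1
  have hset : {x : Euc d | ⟪p.1, x⟫ = ⟪p.1, p₀⟫} = {x | gap p x = 0} := hyperplane_eq hn
  rw [← hset, ← Measure.restrict_apply h.isClosed.measurableSet, ← map_hyperplane hn,
    (measurableEmbedding_hyperplane p.1 p₀).map_apply]
  refine Bornology.IsBounded.measure_lt_top ?_
  obtain ⟨R, hR⟩ := h.bounded.subset_closedBall p₀
  refine (Metric.isBounded_closedBall (x := (0 : (ℝ ∙ p.1)ᗮ)) (r := R)).subset fun y hy => ?_
  have := hR hy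
  rw [mem_closedBall_iff_norm, add_sub_cancel_left] at this
  rw [mem_closedBall_zero_iff]
  exact this

theorem aedisjoint_facets (h : IsHalfSpaceRep K S) {p q : Euc d × ℝ} (hp : p ∈ S) (hq : q ∈ S)
    (hpq : p ≠ q) : AEDisjoint (μHE[d - 1] : Measure (Euc d))
      (K ∩ {x | gap p x = 0}) (K ∩ {x | gap q x = 0}) :=
  measure_mono_null (t := {x | gap p x = 0 ∧ gap q x = 0}) (fun _ hx => ⟨hx.1.2, hx.2.2⟩)
    (h.surface_hyperplanes_inter hp hq hpq)

theorem bdryMeasure_eq_sum (h : IsHalfSpaceRep K S) :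
    bdryMeasure K = ∑ p ∈ S, (μHE[d - 1] : Measure (Euc d)).restrict (K ∩ {x | gap p x = 0}) := by
  rw [bdryMeasure, h.frontier_eq]
  have h1 : (⋃ p ∈ S, K ∩ {x | gap p x = 0}) = ⋃ p : S, K ∩ {x : Euc d | gap p x = 0} := by
    ext; simp
  rw [h1, Measure.restrict_iUnion_ae, Measure.sum_fintype]
  · exact Finset.sum_coe_sort S
      fun p => (μHE[d - 1] : Measure (Euc d)).restrict (K ∩ {x | gap p x = 0})
  · intro p q hpq
    exact h.aedisjoint_facets p.2 q.2 fun e => hpq (Subtype.ext e)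
  · exact fun p => (h.measurableSet_facet p).nullMeasurableSet

theorem isFiniteMeasure_bdryMeasure (h : IsHalfSpaceRep K S) : IsFiniteMeasure (bdryMeasure K) := by
  constructor
  rw [h.bdryMeasure_eq_sum, Measure.finsetSum_apply]
  refine ENNReal.sum_lt_top.2 fun p hp => ?_
  simpa using h.surface_facet_lt_top hp

theorem bdryMeasure_compl (h : IsHalfSpaceRep K S) : bdryMeasure K Kᶜ = 0 := by
  rw [bdryMeasure, Measure.restrict_apply h.isClosed.measurableSet.compl]
  have : Kᶜ ∩ frontier K = ∅ := by
    ext x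
    simp only [Set.mem_inter_iff, Set.mem_compl_iff, Set.mem_empty_iff_false, iff_false, not_and]
    exact fun hx hf => hx (h.isClosed.frontier_subset hf)
  rw [this, measure_empty]

theorem integrable_bdryMeasure (h : IsHalfSpaceRep K S) {F : Type*} [NormedAddCommGroup F]
    {f : Euc d → F} (hf : Continuous f) : Integrable f (bdryMeasure K) := by
  have := h.isFiniteMeasure_bdryMeasure
  obtain ⟨M, hM⟩ := h.isCompact.exists_bound_of_continuousOn hf.continuousOn
  refine Integrable.of_bound hf.aestronglyMeasurable M ?_
  filter_upwards [measure_eq_zero_iff_ae_notMem.1 h.bdryMeasure_compl] with x hx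
  exact hM x (by simpa using hx)

theorem memLp_of_continuous (h : IsHalfSpaceRep K S) {f : Euc d → Euc d}
    (hf : Continuous f) : MemLp f 2 (volume.restrict K) := by
  have hfin : IsFiniteMeasure (volume.restrict K) := ⟨by simpa using h.isCompact.measure_lt_top⟩
  obtain ⟨M, hM⟩ := h.isCompact.exists_bound_of_continuousOn hf.continuousOn
  exact MemLp.of_bound hf.aestronglyMeasurable M (by
    filter_upwards [ae_restrict_mem h.isClosed.measurableSet] with x hx using hM x hx)

theorem memLp_bdry_of_continuous (h : IsHalfSpaceRep K S) {f : Euc d → Euc d}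
    (hf : Continuous f) : MemLp f 2 (bdryMeasure K) := by
  have := h.isFiniteMeasure_bdryMeasure
  obtain ⟨M, hM⟩ := h.isCompact.exists_bound_of_continuousOn hf.continuousOn
  refine MemLp.of_bound hf.aestronglyMeasurable M ?_
  filter_upwards [measure_eq_zero_iff_ae_notMem.1 h.bdryMeasure_compl] with x hx
  exact hM x (by simpa using hx)

theorem integral_bdryMeasure (h : IsHalfSpaceRep K S) {f : Euc d → ℝ} (hf : Continuous f) :
    ∫ x, f x ∂(bdryMeasure K) = ∑ p ∈ S, ∫ x in K ∩ {x | gap p x = 0}, f x ∂μHE[d - 1] := by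
  have hi := h.integrable_bdryMeasure hf
  rw [h.bdryMeasure_eq_sum] at hi ⊢
  exact integral_finsetSum_measure (integrable_finsetSum_measure.1 hi)

end IsHalfSpaceRep

/-! ### Green's formula with boundary layers -/

section Green

variable {K : Set (Euc d)} {S : Finset (Euc d × ℝ)}

theorem integrableOn_clm_apply (hK : IsCompact K) {X : Euc d → Euc d} {B : ℝ}
    (hX : AEStronglyMeasurable X (volume.restrict K)) (hB : ∀ᵐ x ∂volume.restrict K, ‖X x‖ ≤ B)
    {F : Euc d → Euc d →L[ℝ] ℝ} (hF : Continuous F) :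
    IntegrableOn (fun x => F x (X x)) K := by
  obtain ⟨M, hM⟩ := hK.exists_bound_of_continuousOn hF.continuousOn
  have : IsFiniteMeasure (volume.restrict K) := ⟨by simpa using hK.measure_lt_top⟩
  refine Integrable.of_bound
    (ContinuousLinearMap.aestronglyMeasurable_comp₂ (ContinuousLinearMap.id ℝ (Euc d →L[ℝ] ℝ))
      hF.aestronglyMeasurable hX) (M * B) ?_
  filter_upwards [hB, ae_restrict_mem hK.measurableSet] with x hx hxK
  exact ((F x).le_opNorm _).trans
    (mul_le_mul (hM x hxK) hx (norm_nonneg _) ((norm_nonneg _).trans (hM x hxK)))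

namespace IsHalfSpaceRep

theorem ae_mem_interior (h : IsHalfSpaceRep K S) :
    ∀ᵐ x ∂volume.restrict K, x ∈ interior K := by
  have h1 : volume (frontier K) = 0 := h.convex.addHaar_frontier volume
  have h2 := ae_restrict_of_ae (s := K) (measure_eq_zero_iff_ae_notMem.1 h1)
  filter_upwards [h2, ae_restrict_mem h.isClosed.measurableSet] with x hx hxK
  by_contra hc
  exact hx ⟨subset_closure hxK, hc⟩

theorem tendsto_integral_cutoff (h : IsHalfSpaceRep K S) {f : Euc d → ℝ} (hf : IntegrableOn f K) :
    Tendsto (fun δ => ∫ x in K, cutoff S δ x * f x) (𝓝[>] 0) (𝓝 (∫ x in K, f x)) := by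
  refine tendsto_integral_filter_of_dominated_convergence (fun x => ‖f x‖) ?_ ?_ hf.norm ?_
  · filter_upwards with δ
    exact (contDiff_cutoff S δ).continuous.aestronglyMeasurable.mul hf.aestronglyMeasurable
  · filter_upwards with δ
    filter_upwards with x
    rw [norm_mul, Real.norm_of_nonneg (cutoff_mem_Icc δ x).1]
    exact mul_le_of_le_one_left (norm_nonneg _) (cutoff_mem_Icc δ x).2
  · filter_upwards [h.ae_mem_interior] with x hx
    simpa using (h.tendsto_cutoff hx).mul_const (f x)

/-- Green's formula for a bounded field `X` with integrable divergence `q`: the boundary term is the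
limit of the flux of `X` through the boundary layers. -/
theorem tendsto_layer_flux (h : IsHalfSpaceRep K S) {X : Euc d → Euc d} {q : Euc d → ℝ} {B : ℝ}
    (hX : AEStronglyMeasurable X (volume.restrict K)) (hB : ∀ᵐ x ∂volume.restrict K, ‖X x‖ ≤ B)
    (hq : IntegrableOn q K) (hdiv : HasWeakDiv K X q) {φ : Euc d → ℝ} (hφ : ContDiff ℝ ∞ φ) :
    Tendsto (fun δ => ∑ p ∈ S, ∫ x in K, φ x * ⟪p.1, X x⟫ * layer S p δ x) (𝓝[>] 0)
      (𝓝 ((∫ x in K, fderiv ℝ φ x (X x)) + ∫ x in K, q x * φ x)) := by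
  have hφd : Continuous (fderiv ℝ φ) := hφ.continuous_fderiv (by simp)
  have hi1 : IntegrableOn (fun x => fderiv ℝ φ x (X x)) K :=
    integrableOn_clm_apply h.isCompact hX hB hφd
  have hi2 : IntegrableOn (fun x => q x * φ x) K := by
    obtain ⟨M, hM⟩ := h.isCompact.exists_bound_of_continuousOn hφ.continuous.continuousOn
    refine Integrable.mul_bdd (c := M) hq hφ.continuous.aestronglyMeasurable ?_
    filter_upwards [ae_restrict_mem h.isClosed.measurableSet] with x hx using hM x hx
  have hlim := (h.tendsto_integral_cutoff hi1).add (h.tendsto_integral_cutoff hi2)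
  refine hlim.congr' ?_
  filter_upwards [self_mem_nhdsWithin] with δ hδ
  have hδ : 0 < δ := hδ
  have hχ := contDiff_cutoff S δ
  have hsub : tsupport (fun x => φ x * cutoff S δ x) ⊆ tsupport (cutoff S δ) :=
    closure_mono fun x hx => by
      simp only [Function.mem_support, ne_eq, mul_eq_zero, not_or] at hx
      exact hx.2
  have hsub' := h.tsupport_cutoff_subset hδ
  have htest := hdiv (fun x => φ x * cutoff S δ x) (hφ.mul hχ)
    (HasCompactSupport.intro h.isCompact fun x hx => by
      by_contra hc
      exact hx (interior_subset (hsub' (hsub (subset_tsupport _ hc))))) (hsub.trans hsub')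
  have hder : ∀ x, fderiv ℝ (fun x => φ x * cutoff S δ x) x (X x) =
      cutoff S δ x * fderiv ℝ φ x (X x) - ∑ p ∈ S, φ x * ⟪p.1, X x⟫ * layer S p δ x := by
    intro x
    rw [fderiv_fun_mul (hφ.differentiable (by simp) x) (hχ.differentiable (by simp) x)]
    simp only [add_apply, smul_apply, smul_eq_mul, fderiv_cutoff, mul_neg, Finset.mul_sum]
    rw [neg_add_eq_sub]
    congr 1
    exact Finset.sum_congr rfl fun p _ => by ring
  have hi3 : IntegrableOn (fun x => cutoff S δ x * fderiv ℝ φ x (X x)) K :=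
    integrableOn_clm_apply (F := fun x => cutoff S δ x • fderiv ℝ φ x) h.isCompact hX hB
      (hχ.continuous.smul hφd)
  have hi4 : ∀ p ∈ S, IntegrableOn (fun x => φ x * ⟪p.1, X x⟫ * layer S p δ x) K := by
    intro p _
    have h1 : Continuous fun x => (φ x * layer S p δ x) • innerSL ℝ p.1 :=
      (hφ.continuous.mul (continuous_layer S p δ)).smul continuous_const
    refine (integrableOn_clm_apply h.isCompact hX hB h1).congr_fun (fun x _ => ?_)
      h.isClosed.measurableSet
    simp only [smul_apply, innerSL_apply_apply, smul_eq_mul]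
    ring
  simp only [hder] at htest
  rw [integral_sub hi3 (integrable_finsetSum _ hi4), integral_finsetSum _ hi4] at htest
  have e : ∫ x in K, q x * (φ x * cutoff S δ x) = ∫ x in K, cutoff S δ x * (q x * φ x) := by
    congr 1; ext x; ring
  rw [e] at htest
  linarith

theorem setIntegral_layer (h : IsHalfSpaceRep K S) {p : Euc d × ℝ} {δ : ℝ} (hδ : 0 < δ)
    (f : Euc d → ℝ) : ∫ x in K, f x * layer S p δ x = ∫ x, f x * layer S p δ x :=
  setIntegral_eq_integral_of_forall_compl_eq_zero fun x hx => by
    rw [h.layer_eq_zero hδ hx, mul_zero]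

/-- A bounded divergence-free field `b` pairs with gradients through the boundary values only. -/
theorem abs_integral_fderiv_le (h : IsHalfSpaceRep K S) {b : Euc d → Euc d} {B : ℝ}
    (hb : AEStronglyMeasurable b (volume.restrict K)) (hB : ∀ᵐ x ∂volume.restrict K, ‖b x‖ ≤ B)
    (hdiv : HasWeakDiv K b 0) {φ : Euc d → ℝ} (hφ : ContDiff ℝ ∞ φ) :
    |∫ x in K, fderiv ℝ φ x (b x)| ≤ B * ∫ x, |φ x| ∂(bdryMeasure K) := by
  have hlim := h.tendsto_layer_flux hb hB (q := 0) (integrable_zero _ _ _) hdiv hφ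
  simp only [Pi.zero_apply, zero_mul, integral_zero, add_zero] at hlim
  have hlim2 : Tendsto (fun δ => B * ∑ p ∈ S, ∫ x, |φ x| * layer S p δ x) (𝓝[>] 0)
      (𝓝 (B * ∫ x, |φ x| ∂(bdryMeasure K))) := by
    rw [h.integral_bdryMeasure hφ.continuous.abs]
    exact (tendsto_finsetSum _ fun p hp =>
      h.tendsto_integral_layer hp hφ.continuous.abs).const_mul B
  refine le_of_tendsto_of_tendsto hlim.abs hlim2 ?_
  filter_upwards [self_mem_nhdsWithin] with δ hδ
  have hδ : 0 < δ := hδ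
  rw [Finset.mul_sum]
  refine (Finset.abs_sum_le_sum_abs _ _).trans (Finset.sum_le_sum fun p hp => ?_)
  rw [← h.setIntegral_layer hδ, ← integral_const_mul, ← Real.norm_eq_abs]
  have hcont : Continuous fun x => B * (|φ x| * layer S p δ x) :=
    continuous_const.mul (hφ.continuous.abs.mul (continuous_layer S p δ))
  refine norm_integral_le_of_norm_le (hcont.continuousOn.integrableOn_compact h.isCompact) ?_
  filter_upwards [hB] with x hx
  rw [norm_mul, norm_mul, Real.norm_eq_abs, Real.norm_of_nonneg (layer_nonneg S p hδ x)]
  have h1 : ‖⟪p.1, b x⟫‖ ≤ B :=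
    (norm_inner_le_norm _ _).trans (by rw [h.unit p hp, one_mul]; exact hx)
  have h2 := mul_le_mul_of_nonneg_left h1
    (mul_nonneg (abs_nonneg (φ x)) (layer_nonneg S p hδ x))
  linarith

end IsHalfSpaceRep

/-- The divergence of `x ↦ x - z` is the dimension. -/
theorem hasWeakDiv_sub (K : Set (Euc d)) (z : Euc d) :
    HasWeakDiv K (fun x => x - z) fun _ => d := by
  intro φ hφ hc hsub
  have hz : ∀ x ∉ K, φ x = 0 := fun x hx => by
    by_contra hne
    exact hx (interior_subset (hsub (subset_tsupport _ hne)))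
  have hz' : ∀ x ∉ K, fderiv ℝ φ x = 0 := fun x hx => by
    by_contra hne
    exact hx (interior_subset (hsub (support_fderiv_subset ℝ hne)))
  rw [setIntegral_eq_integral_of_forall_compl_eq_zero (fun x hx => by simp [hz' x hx]),
    setIntegral_eq_integral_of_forall_compl_eq_zero (fun x hx => by simp [hz x hx])]
  have hφd : Continuous (fderiv ℝ φ) := hφ.continuous_fderiv (by simp)
  have hpart : ∀ i : Fin d, ∫ x, (x i - z i) * fderiv ℝ φ x (stdVec i) = -∫ x, φ x := by
    intro i
    let c : Euc d →L[ℝ] ℝ := EuclideanSpace.proj i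
    have hder : ∀ x, HasFDerivAt (fun x : Euc d => x i - z i) c x := fun x =>
      c.hasFDerivAt.sub_const (z i)
    have hval : ∀ x, fderiv ℝ (fun x : Euc d => x i - z i) x (stdVec i) = 1 := fun x => by
      rw [(hder x).fderiv]; simp [c, stdVec]
    have := integral_mul_fderiv_eq_neg_fderiv_mul_of_integrable (μ := (volume : Measure (Euc d)))
      (f := fun x : Euc d => x i - z i) (g := φ) (v := stdVec i) ?_ ?_ ?_
      (fun x _ => (hder x).differentiableAt) (fun x _ => hφ.differentiable (by simp) x)
    · simpa only [hval, one_mul] using this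
    · simp only [hval, one_mul]
      exact hφ.continuous.integrable_of_hasCompactSupport hc
    · refine Continuous.integrable_of_hasCompactSupport (by fun_prop) ?_
      exact HasCompactSupport.mul_left ((hc.fderiv ℝ).comp_left
        (g := fun L : Euc d →L[ℝ] ℝ => L (stdVec i)) rfl)
    · refine Continuous.integrable_of_hasCompactSupport ?_ hc.mul_left
      have := hφ.continuous
      fun_prop
  have hsum : ∀ x, fderiv ℝ φ x (x - z) = ∑ i, (x i - z i) * fderiv ℝ φ x (stdVec i) := by
    intro x
    conv_lhs => rw [← (EuclideanSpace.basisFun (Fin d) ℝ).sum_repr (x - z)]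
    simp [map_sum, stdVec]
  simp only [hsum]
  rw [integral_finsetSum, Finset.sum_congr rfl fun i _ => hpart i, integral_const_mul]
  · simp
  · intro i _
    refine Continuous.integrable_of_hasCompactSupport (by fun_prop) ?_
    exact HasCompactSupport.mul_left ((hc.fderiv ℝ).comp_left
      (g := fun L : Euc d →L[ℝ] ℝ => L (stdVec i)) rfl)

theorem apply_eq_sum_stdVec {F : Type*} [NormedAddCommGroup F] [NormedSpace ℝ F]
    (L : Euc d →L[ℝ] F) (v : Euc d) : L v = ∑ i, v i • L (stdVec i) := by
  conv_lhs => rw [← (EuclideanSpace.basisFun (Fin d) ℝ).sum_repr v]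
  simp [map_sum, stdVec]

theorem norm_sum_smul_sq_le {F : Type*} [NormedAddCommGroup F] [NormedSpace ℝ F]
    (v : Euc d) (a : Fin d → F) : ‖∑ i, v i • a i‖ ^ 2 ≤ ‖v‖ ^ 2 * ∑ i, ‖a i‖ ^ 2 := by
  have h1 : ‖∑ i, v i • a i‖ ≤ ∑ i, |v i| * ‖a i‖ :=
    (norm_sum_le _ _).trans (Finset.sum_le_sum fun i _ => by rw [norm_smul, Real.norm_eq_abs])
  calc ‖∑ i, v i • a i‖ ^ 2 ≤ (∑ i, |v i| * ‖a i‖) ^ 2 := by gcongr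
    _ ≤ (∑ i, |v i| ^ 2) * ∑ i, ‖a i‖ ^ 2 := Finset.sum_mul_sq_le_sq_mul_sq _ _ _
    _ = _ := by rw [EuclideanSpace.norm_sq_eq]; simp

/-- The trace inequality for functions smooth up to the boundary, from Green's formula for the field
`‖φ‖² (x - z)`, whose flux through each facet is at least a positive multiple of `‖φ‖²`. -/
theorem IsHalfSpaceRep.exists_trace_inequality (h : IsHalfSpaceRep K S) :
    ∃ C : ℝ, ∀ φ : Euc d → Euc d, ContDiff ℝ ∞ φ →
      ∫ x, ‖φ x‖ ^ 2 ∂(bdryMeasure K) ≤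
        C * ((∫ x in K, ‖φ x‖ ^ 2) + ∑ i, ∫ x in K, ‖fderiv ℝ φ x (stdVec i)‖ ^ 2) := by
  obtain ⟨z, hz⟩ := h.nonempty
  have hz' := hz
  rw [h.interior_eq] at hz'
  obtain ⟨r, hr0, hr⟩ : ∃ r > 0, ∀ p ∈ S, r ≤ gap p z := by
    rcases S.eq_empty_or_nonempty with rfl | hne
    · exact ⟨1, one_pos, by simp⟩
    · obtain ⟨p, hp, hmin⟩ := S.exists_min_image (fun p => gap p z) hne
      exact ⟨gap p z, hz' p hp, hmin⟩
  obtain ⟨R, hR⟩ := h.bounded.subset_closedBall z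
  have hR0 : 0 ≤ R := by
    have := hR (interior_subset hz)
    simpa using this
  refine ⟨(d + 1 + R ^ 2) / r, fun φ hφ => ?_⟩
  have hφ2 : ContDiff ℝ ∞ fun x => ‖φ x‖ ^ 2 := hφ.norm_sq ℝ
  have hφd : Continuous (fderiv ℝ φ) := hφ.continuous_fderiv (by simp)
  have hc := hφ.continuous
  have hX : ∀ᵐ x ∂volume.restrict K, ‖x - z‖ ≤ R := by
    filter_upwards [ae_restrict_mem h.isClosed.measurableSet] with x hx
    simpa [dist_eq_norm] using hR hx
  have : IsFiniteMeasure (volume.restrict K) := ⟨by simpa using h.isCompact.measure_lt_top⟩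
  have hlim := h.tendsto_layer_flux (X := fun x => x - z) (q := fun _ => (d : ℝ))
    (by fun_prop) hX (integrable_const _) (hasWeakDiv_sub K z) hφ2
  have hlim2 : Tendsto (fun δ => ∑ p ∈ S, ∫ x in K, ‖φ x‖ ^ 2 * ⟪p.1, x - z⟫ * layer S p δ x)
      (𝓝[>] 0) (𝓝 (∑ p ∈ S, ∫ x in K ∩ {x | gap p x = 0}, ‖φ x‖ ^ 2 * ⟪p.1, x - z⟫ ∂μHE[d - 1])) := by
    refine tendsto_finsetSum _ fun p hp => ?_
    refine (h.tendsto_integral_layer hp (f := fun x => ‖φ x‖ ^ 2 * ⟪p.1, x - z⟫)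
      (by fun_prop)).congr' ?_
    filter_upwards [self_mem_nhdsWithin] with δ hδ using (h.setIntegral_layer hδ _).symm
  have heq := tendsto_nhds_unique hlim hlim2
  have hfac : ∀ p ∈ S, ∫ x in K ∩ {x | gap p x = 0}, ‖φ x‖ ^ 2 * ⟪p.1, x - z⟫ ∂μHE[d - 1] =
      gap p z * ∫ x in K ∩ {x | gap p x = 0}, ‖φ x‖ ^ 2 ∂μHE[d - 1] := by
    intro p hp
    rw [← integral_const_mul]
    refine setIntegral_congr_fun (h.measurableSet_facet p) fun x hx => ?_
    have hx2 : gap p x = 0 := hx.2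
    simp only [gap] at hx2 ⊢
    rw [inner_sub_right, ← sub_eq_zero.1 hx2, mul_comm]
  have hlow : r * ∫ x, ‖φ x‖ ^ 2 ∂(bdryMeasure K) ≤
      ∑ p ∈ S, ∫ x in K ∩ {x | gap p x = 0}, ‖φ x‖ ^ 2 * ⟪p.1, x - z⟫ ∂μHE[d - 1] := by
    rw [h.integral_bdryMeasure hφ2.continuous, Finset.mul_sum]
    refine Finset.sum_le_sum fun p hp => ?_
    rw [hfac p hp]
    exact mul_le_mul_of_nonneg_right (hr p hp) (integral_nonneg fun _ => by positivity)
  have hint : ∀ {f : Euc d → ℝ}, Continuous f → IntegrableOn f K := fun hf =>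
    hf.continuousOn.integrableOn_compact h.isCompact
  have hup : ∫ x in K, fderiv ℝ (fun x => ‖φ x‖ ^ 2) x (x - z) ≤
      (∫ x in K, ‖φ x‖ ^ 2) + R ^ 2 * ∑ i, ∫ x in K, ‖fderiv ℝ φ x (stdVec i)‖ ^ 2 := by
    rw [← integral_finsetSum _ fun i _ => hint (by fun_prop), ← integral_const_mul,
      ← integral_add (hint (by fun_prop)) (hint (by fun_prop))]
    refine setIntegral_mono_on (hint ?_) (hint (by fun_prop)) h.isClosed.measurableSet
      fun x hx => ?_
    · have := hφ2.continuous_fderiv (by simp)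
      fun_prop
    have hxR : ‖x - z‖ ≤ R := by simpa [dist_eq_norm] using hR hx
    have hD : fderiv ℝ (fun x => ‖φ x‖ ^ 2) x (x - z) = 2 * ⟪φ x, fderiv ℝ φ x (x - z)⟫ := by
      rw [((hφ.differentiable (by simp) x).hasFDerivAt.norm_sq).fderiv]
      simp
    rw [hD]
    have h1 := real_inner_le_norm (φ x) (fderiv ℝ φ x (x - z))
    have h2 : ‖fderiv ℝ φ x (x - z)‖ ^ 2 ≤ R ^ 2 * ∑ i, ‖fderiv ℝ φ x (stdVec i)‖ ^ 2 := by
      rw [apply_eq_sum_stdVec]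
      refine (norm_sum_smul_sq_le (x - z) _).trans ?_
      gcongr
    nlinarith [sq_nonneg (‖φ x‖ - ‖fderiv ℝ φ x (x - z)‖)]
  rw [integral_const_mul] at heq
  rw [div_mul_eq_mul_div, le_div_iff₀ hr0, mul_comm]
  have hA : 0 ≤ ∫ x in K, ‖φ x‖ ^ 2 := integral_nonneg fun _ => by positivity
  have hD : 0 ≤ ∑ i, ∫ x in K, ‖fderiv ℝ φ x (stdVec i)‖ ^ 2 :=
    Finset.sum_nonneg fun i _ => integral_nonneg fun _ => by positivity
  have hd : (0 : ℝ) ≤ d := Nat.cast_nonneg d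
  nlinarith [mul_nonneg hd hD, mul_nonneg (sq_nonneg R) hA]

end Green

/-! ### The normal trace of a bounded divergence-free field -/

section NormalTrace

theorem norm_toLp_sq {α F : Type*} [MeasurableSpace α] {μ : Measure α} [NormedAddCommGroup F]
    [InnerProductSpace ℝ F] {f : α → F} (hf : MemLp f 2 μ) :
    ‖hf.toLp f‖ ^ 2 = ∫ x, ‖f x‖ ^ 2 ∂μ := by
  rw [← real_inner_self_eq_norm_sq, L2.inner_def]
  refine integral_congr_ae ?_
  filter_upwards [hf.coeFn_toLp] with x hx
  rw [hx, real_inner_self_eq_norm_sq]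

/-- The inclusion `L² ⊆ L¹` for a finite measure. -/
noncomputable def inclL2L1 {α : Type*} [MeasurableSpace α] (μ : Measure α) [IsFiniteMeasure μ] :
    Lp ℝ 2 μ →L[ℝ] Lp ℝ 1 μ :=
  LinearMap.mkContinuous
    { toFun := fun h => ((Lp.memLp h).mono_exponent one_le_two).toLp h
      map_add' := fun u v => by
        rw [← MemLp.toLp_add]; exact MemLp.toLp_congr _ _ (Lp.coeFn_add u v)
      map_smul' := fun c u => by
        rw [RingHom.id_apply, ← MemLp.toLp_const_smul]
        exact MemLp.toLp_congr _ _ (Lp.coeFn_smul c u) }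
    (μ Set.univ ^ (1 / (1 : ℝ≥0∞).toReal - 1 / (2 : ℝ≥0∞).toReal)).toReal (fun h => by
      have h1 := eLpNorm_le_eLpNorm_mul_rpow_measure_univ (p := 1) (q := 2) one_le_two
        (Lp.aestronglyMeasurable h)
      have hfin : μ Set.univ ^ (1 / (1 : ℝ≥0∞).toReal - 1 / (2 : ℝ≥0∞).toReal) ≠ ⊤ :=
        ENNReal.rpow_ne_top_of_nonneg (by norm_num) (measure_ne_top _ _)
      change ‖((Lp.memLp h).mono_exponent one_le_two).toLp h‖ ≤ _
      rw [Lp.norm_toLp, Lp.norm_def, mul_comm, ← ENNReal.toReal_mul]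
      exact ENNReal.toReal_mono (ENNReal.mul_ne_top (Lp.eLpNorm_ne_top h) hfin) h1)

theorem coeFn_inclL2L1 {α : Type*} [MeasurableSpace α] (μ : Measure α) [IsFiniteMeasure μ]
    (h : Lp ℝ 2 μ) : inclL2L1 μ h =ᵐ[μ] h :=
  MemLp.coeFn_toLp ((Lp.memLp h).mono_exponent one_le_two)

/-- A linear functional on Schwartz functions that is bounded by `B` times the `L¹`-norm for a finite
measure is integration against a density bounded by `B`. -/
theorem exists_bounded_density (μ : Measure (Euc d)) [IsFiniteMeasure μ]
    (Λ : SchwartzMap (Euc d) ℝ →ₗ[ℝ] ℝ) (B : ℝ) (hΛ : ∀ φ, |Λ φ| ≤ B * ∫ x, |φ x| ∂μ) :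
    ∃ g : Euc d → ℝ, AEStronglyMeasurable g μ ∧ (∀ᵐ x ∂μ, |g x| ≤ B) ∧
      ∀ φ, Λ φ = ∫ x, g x * φ x ∂μ := by
  have hdense := SchwartzMap.denseRange_toLpCLM (E := Euc d) (F := ℝ) (p := 1) (μ := μ) (by simp)
  have hbound : ∀ φ, ‖Λ φ‖ ≤ B * ‖(SchwartzMap.toLpCLM ℝ ℝ 1 μ).toLinearMap φ‖ := by
    intro φ
    have := SchwartzMap.norm_toLp_one (f := φ) (μ := μ)
    simpa [this] using hΛ φ
  let Λ₁ : Lp ℝ 1 μ →L[ℝ] ℝ := Λ.extendOfNorm (SchwartzMap.toLpCLM ℝ ℝ 1 μ).toLinearMap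
  have hΛ₁ : ∀ u, ‖Λ₁ u‖ ≤ B * ‖u‖ := LinearMap.norm_extendOfNorm_apply_le hdense B hbound
  have hΛ₁' : ∀ φ, Λ₁ (SchwartzMap.toLp φ 1 μ) = Λ φ :=
    fun φ => LinearMap.extendOfNorm_eq hdense ⟨B, hbound⟩ φ
  -- the density is found in the Hilbert space `L²`; testing with indicator functions bounds it by `B`
  let g : Lp ℝ 2 μ := (InnerProductSpace.toDual ℝ _).symm (Λ₁.comp (inclL2L1 μ))
  have hg : ∀ u : Lp ℝ 2 μ, ⟪g, u⟫ = Λ₁ (inclL2L1 μ u) := fun u => by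
    simp only [g, InnerProductSpace.toDual_symm_apply]; rfl
  have hgi : Integrable g μ := (Lp.memLp g).integrable one_le_two
  have hset : ∀ s, MeasurableSet s → |∫ x in s, g x ∂μ| ≤ B * μ.real s := by
    intro s hs
    have h1 := L2.inner_indicatorConstLp_one (𝕜 := ℝ) hs (measure_ne_top μ s) g
    rw [← h1, real_inner_comm, hg]
    refine (hΛ₁ _).trans_eq ?_
    congr 1
    rw [L1.norm_eq_integral_norm]
    have : (fun x => ‖inclL2L1 μ (indicatorConstLp 2 hs (measure_ne_top μ s) (1 : ℝ)) x‖) =ᵐ[μ]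
        s.indicator fun _ => (1 : ℝ) := by
      filter_upwards [coeFn_inclL2L1 μ (indicatorConstLp 2 hs (measure_ne_top μ s) (1 : ℝ)),
        indicatorConstLp_coeFn (p := 2) (hs := hs) (hμs := measure_ne_top μ s) (c := (1 : ℝ))]
        with x h1 h2
      rw [h1, h2]
      by_cases hx : x ∈ s <;> simp [hx]
    rw [integral_congr_ae this, integral_indicator hs]
    simp
  refine ⟨g, Lp.aestronglyMeasurable g, ?_, fun φ => ?_⟩
  · have hup : (fun x => g x) ≤ᵐ[μ] fun _ => B := by
      refine ae_le_of_forall_setIntegral_le hgi (integrable_const _) fun s hs _ => ?_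
      rw [setIntegral_const, smul_eq_mul, mul_comm]
      exact (abs_le.1 (hset s hs)).2
    have hlow : (fun _ => -B) ≤ᵐ[μ] fun x => g x := by
      refine ae_le_of_forall_setIntegral_le (integrable_const _) hgi fun s hs _ => ?_
      rw [setIntegral_const, smul_eq_mul, mul_neg, mul_comm]
      exact (abs_le.1 (hset s hs)).1
    filter_upwards [hup, hlow] with x h1 h2
    exact abs_le.2 ⟨h2, h1⟩
  · have h1 : inclL2L1 μ (SchwartzMap.toLp φ 2 μ) = SchwartzMap.toLp φ 1 μ :=
      MemLp.toLp_congr ((Lp.memLp (SchwartzMap.toLp φ 2 μ)).mono_exponent one_le_two) (φ.memLp 1 μ)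
        (SchwartzMap.coeFn_toLp φ 2 μ)
    rw [← hΛ₁', ← h1, ← hg, L2.inner_def]
    refine integral_congr_ae ?_
    filter_upwards [SchwartzMap.coeFn_toLp φ 2 μ] with x hx
    rw [hx]
    simp [mul_comm]

variable {K : Set (Euc d)} {S : Finset (Euc d × ℝ)}

theorem IsHalfSpaceRep.exists_normalTrace (h : IsHalfSpaceRep K S) {b : Euc d → Euc d} {B : ℝ}
    (hb : AEStronglyMeasurable b (volume.restrict K)) (hB : ∀ᵐ x ∂volume.restrict K, ‖b x‖ ≤ B)
    (hdiv : HasWeakDiv K b 0) :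
    ∃ g : Euc d → ℝ, MemLp g ⊤ (bdryMeasure K) ∧ (∀ᵐ x ∂(bdryMeasure K), |g x| ≤ B) ∧
      HasNormalTrace K b 0 g := by
  have := h.isFiniteMeasure_bdryMeasure
  have hint : ∀ φ : SchwartzMap (Euc d) ℝ, IntegrableOn (fun x => fderiv ℝ φ x (b x)) K := fun φ =>
    integrableOn_clm_apply h.isCompact hb hB ((φ.smooth ⊤).continuous_fderiv (by simp))
  have hdiff : ∀ φ : SchwartzMap (Euc d) ℝ, Differentiable ℝ φ := fun φ =>
    (φ.smooth ⊤).differentiable (by simp)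
  let Λ : SchwartzMap (Euc d) ℝ →ₗ[ℝ] ℝ :=
    { toFun := fun φ => ∫ x in K, fderiv ℝ φ x (b x)
      map_add' := fun φ ψ => by
        rw [← integral_add (hint φ) (hint ψ)]
        congr 1; ext x
        have : fderiv ℝ (⇑(φ + ψ)) x = fderiv ℝ φ x + fderiv ℝ ψ x :=
          fderiv_add (hdiff φ x) (hdiff ψ x)
        rw [this, add_apply]
      map_smul' := fun c φ => by
        rw [RingHom.id_apply, smul_eq_mul, ← integral_const_mul]
        congr 1; ext x
        have : fderiv ℝ (⇑(c • φ)) x = c • fderiv ℝ φ x := fderiv_const_smul (hdiff φ x) c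
        rw [this, smul_apply, smul_eq_mul] }
  obtain ⟨g, hgm, hgB, hg⟩ := exists_bounded_density (bdryMeasure K) Λ B fun φ =>
    h.abs_integral_fderiv_le hb hB hdiv (φ.smooth ⊤)
  refine ⟨g, memLp_top_of_bound hgm B hgB, hgB, fun φ hφ hc => ?_⟩
  have := hg (hc.toSchwartzMap hφ)
  change ∫ x in K, fderiv ℝ φ x (b x) = ∫ x, g x * φ x ∂(bdryMeasure K) at this
  simpa using this

theorem HasNormalTrace.ae_eq [IsFiniteMeasure (bdryMeasure K)] {b : Euc d → Euc d}
    {q g g' : Euc d → ℝ} (hg : MemLp g ⊤ (bdryMeasure K)) (hg' : MemLp g' ⊤ (bdryMeasure K))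
    (h : HasNormalTrace K b q g) (h' : HasNormalTrace K b q g') : g =ᵐ[bdryMeasure K] g' := by
  refine ae_eq_of_integral_contDiff_smul_eq (hg.integrable le_top).locallyIntegrable
    (hg'.integrable le_top).locallyIntegrable fun φ hφ hc => ?_
  have := (h φ hφ hc).symm.trans (h' φ hφ hc)
  simpa [mul_comm] using this

/-- The properties of the normal trace of a bounded divergence-free field on a polytope. -/
theorem IsHalfSpaceRep.normalTrace_spec (h : IsHalfSpaceRep K S) {b : Euc d → Euc d} {B : ℝ}
    (hb : AEStronglyMeasurable b (volume.restrict K)) (hB : ∀ᵐ x ∂volume.restrict K, ‖b x‖ ≤ B)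
    (hdiv : HasWeakDiv K b 0) :
    MemLp (normalTrace K b) ⊤ (bdryMeasure K) ∧
      (∀ᵐ x ∂(bdryMeasure K), |normalTrace K b x| ≤ B) ∧
      HasNormalTrace K b 0 (normalTrace K b) := by
  have := h.isFiniteMeasure_bdryMeasure
  obtain ⟨g, hg, hgB, hgt⟩ := h.exists_normalTrace hb hB hdiv
  have hex : ∃ g, MemLp g ⊤ (bdryMeasure K) ∧ HasNormalTrace K b 0 g := ⟨g, hg, hgt⟩
  have hs : MemLp (normalTrace K b) ⊤ (bdryMeasure K) ∧ HasNormalTrace K b 0 (normalTrace K b) := by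
    rw [normalTrace, dif_pos hex]
    exact hex.choose_spec
  refine ⟨hs.1, ?_, hs.2⟩
  filter_upwards [hgB, HasNormalTrace.ae_eq hg hs.1 hgt hs.2] with x h1 h2
  rwa [← h2]

end NormalTrace

/-! ### Mollification in `L²` -/

theorem lintegral_mul_sq_le {α : Type*} [MeasurableSpace α] {μ : Measure α} {k f : α → ℝ≥0∞}
    (hk : AEMeasurable k μ) (hf : AEMeasurable f μ) :
    (∫⁻ a, k a * f a ∂μ) ^ 2 ≤ (∫⁻ a, k a ∂μ) * ∫⁻ a, k a * f a ^ 2 ∂μ := by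
  have hh : (0 : ℝ) ≤ 1 / 2 := by norm_num
  have h := ENNReal.lintegral_mul_le_Lp_mul_Lq μ Real.HolderConjugate.two_two
    (f := fun a => k a ^ (1 / 2 : ℝ)) (g := fun a => k a ^ (1 / 2 : ℝ) * f a)
    (hk.pow_const _) ((hk.pow_const _).mul hf)
  have e0 : ∀ y : ℝ≥0∞, y ^ (1 / 2 : ℝ) * y ^ (1 / 2 : ℝ) = y := fun y => by
    rw [← ENNReal.rpow_add_of_nonneg _ _ hh hh]; norm_num
  have e1 : ∀ a, ((fun a => k a ^ (1 / 2 : ℝ)) * fun a => k a ^ (1 / 2 : ℝ) * f a) a = k a * f a := by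
    intro a; rw [Pi.mul_apply, ← mul_assoc, e0]
  have e2 : ∀ y : ℝ≥0∞, (y ^ (1 / 2 : ℝ)) ^ (2 : ℝ) = y := fun y => by
    rw [← ENNReal.rpow_mul]; norm_num
  have e3 : ∀ a, (k a ^ (1 / 2 : ℝ) * f a) ^ (2 : ℝ) = k a * f a ^ 2 := fun a => by
    rw [ENNReal.mul_rpow_of_nonneg _ _ zero_le_two, e2, ENNReal.rpow_two]
  simp only [e1, e2, e3] at h
  calc (∫⁻ a, k a * f a ∂μ) ^ 2 ≤
      ((∫⁻ a, k a ∂μ) ^ (1 / 2 : ℝ) * (∫⁻ a, k a * f a ^ 2 ∂μ) ^ (1 / 2 : ℝ)) ^ 2 := by gcongr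
    _ = _ := by rw [mul_pow, ← ENNReal.rpow_two, ← ENNReal.rpow_two, e2, e2]

/-- Mollification does not increase the `L²`-norm. -/
theorem eLpNorm_normed_convolution_le (κ : ContDiffBump (0 : Euc d)) {h : Euc d → Euc d}
    (hh : AEStronglyMeasurable h volume) :
    eLpNorm (convolution (κ.normed volume) h (ContinuousLinearMap.lsmul ℝ ℝ) volume) 2 volume ≤
      eLpNorm h 2 volume := by
  set k := κ.normed (volume : Measure (Euc d))
  have hkc : Continuous k := κ.continuous_normed
  have hk0 : ∀ t, 0 ≤ k t := κ.nonneg_normed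
  have hk1 : ∫⁻ t, ‖k t‖ₑ = 1 := by
    have h1 : ∫⁻ t, ‖k t‖ₑ = ∫⁻ t, ENNReal.ofReal (k t) := by
      congr 1; ext t; exact Real.enorm_of_nonneg (hk0 t)
    rw [h1, ← ofReal_integral_eq_lintegral_ofReal κ.integrable_normed (ae_of_all _ hk0),
      κ.integral_normed, ENNReal.ofReal_one]
  have hjoint : AEMeasurable (fun p : Euc d × Euc d => ‖k p.2‖ₑ * ‖h (p.1 - p.2)‖ₑ ^ 2)
      (volume.prod volume) := by
    have h2 : AEStronglyMeasurable (fun p : Euc d × Euc d => h (p.1 - p.2))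
        (volume.prod volume) :=
      hh.comp_quasiMeasurePreserving (quasiMeasurePreserving_sub_of_right_invariant volume volume)
    exact ((hkc.comp continuous_snd).measurable.enorm.aemeasurable).mul (h2.enorm.pow_const 2)
  rw [eLpNorm_eq_lintegral_rpow_enorm_toReal two_ne_zero ENNReal.ofNat_ne_top,
    eLpNorm_eq_lintegral_rpow_enorm_toReal two_ne_zero ENNReal.ofNat_ne_top]
  refine ENNReal.rpow_le_rpow ?_ (by positivity)
  simp only [ENNReal.toReal_ofNat, ENNReal.rpow_two]
  calc ∫⁻ x, ‖convolution k h (ContinuousLinearMap.lsmul ℝ ℝ) volume x‖ₑ ^ 2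
      ≤ ∫⁻ x, ∫⁻ t, ‖k t‖ₑ * ‖h (x - t)‖ₑ ^ 2 := by
        refine lintegral_mono fun x => ?_
        have hx : AEStronglyMeasurable (fun t => h (x - t)) volume :=
          hh.comp_quasiMeasurePreserving (quasiMeasurePreserving_sub_left_of_right_invariant volume x)
        have h1 : ‖convolution k h (ContinuousLinearMap.lsmul ℝ ℝ) volume x‖ₑ ≤
            ∫⁻ t, ‖k t‖ₑ * ‖h (x - t)‖ₑ := by
          refine (enorm_integral_le_lintegral_enorm _).trans_eq ?_
          congr 1; ext t
          rw [ContinuousLinearMap.lsmul_apply, enorm_smul]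
        calc _ ≤ (∫⁻ t, ‖k t‖ₑ * ‖h (x - t)‖ₑ) ^ 2 := by gcongr
          _ ≤ _ := lintegral_mul_sq_le hkc.measurable.enorm.aemeasurable hx.enorm
          _ = _ := by rw [hk1, one_mul]
    _ = ∫⁻ t, ∫⁻ x, ‖k t‖ₑ * ‖h (x - t)‖ₑ ^ 2 := lintegral_lintegral_swap hjoint
    _ = ∫⁻ t, ‖k t‖ₑ * ∫⁻ x, ‖h x‖ₑ ^ 2 := by
        congr 1; ext t
        rw [lintegral_const_mul' _ _ enorm_ne_top,
          lintegral_sub_right_eq_self (fun x => ‖h x‖ₑ ^ 2) t]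
    _ = ∫⁻ x, ‖h x‖ₑ ^ 2 := by
        rw [lintegral_mul_const _ hkc.measurable.enorm, hk1, one_mul]

/-- The contraction of factor `l` towards `z`. -/
noncomputable def contraction (z : Euc d) (l : ℝ) (x : Euc d) : Euc d := z + l • (x - z)

theorem map_contraction (z : Euc d) {l : ℝ} (hl : 0 < l) :
    Measure.map (contraction z l) volume =
      ENNReal.ofReal ((l ^ d)⁻¹) • (volume : Measure (Euc d)) := by
  have h1 : contraction z l = (fun x => (z - l • z) + x) ∘ (fun x => l • x) := by
    ext1 x; simp only [contraction, Function.comp_apply, smul_sub]; abel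
  rw [h1, ← Measure.map_map (by fun_prop) (by fun_prop), Measure.map_addHaar_smul _ hl.ne',
    Measure.map_smul, map_add_left_eq_self, finrank_euclideanSpace_fin, abs_of_pos (by positivity)]

theorem eLpNorm_comp_contraction_le (z : Euc d) {l : ℝ} (hl : 1 / 2 ≤ l) {f : Euc d → Euc d}
    (hf : AEStronglyMeasurable f volume) (K : Set (Euc d)) :
    eLpNorm (fun x => f (contraction z l x)) 2 (volume.restrict K) ≤
      ENNReal.ofReal (2 ^ d) ^ (1 / 2 : ℝ) * eLpNorm f 2 volume := by
  have hl0 : 0 < l := by linarith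
  have hc : Measurable (contraction z l) := by unfold contraction; fun_prop
  have hm := map_contraction z hl0
  have hf' : AEStronglyMeasurable f (Measure.map (contraction z l) volume) := by
    rw [hm]; exact hf.mono_ac (Measure.smul_absolutelyContinuous)
  calc eLpNorm (fun x => f (contraction z l x)) 2 (volume.restrict K)
      ≤ eLpNorm (f ∘ contraction z l) 2 volume :=
        eLpNorm_mono_measure _ Measure.restrict_le_self
    _ = eLpNorm f 2 (Measure.map (contraction z l) volume) :=
        (eLpNorm_map_measure hf' hc.aemeasurable).symm
    _ = ENNReal.ofReal ((l ^ d)⁻¹) ^ (1 / 2 : ℝ) * eLpNorm f 2 volume := by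
        rw [hm, eLpNorm_smul_measure_of_ne_top ENNReal.ofNat_ne_top]
        simp
    _ ≤ _ := by
        have h1 : (l ^ d)⁻¹ ≤ 2 ^ d := by
          rw [← inv_pow]
          refine pow_le_pow_left₀ (by positivity) ?_ _
          rw [inv_le_comm₀ hl0 two_pos]; linarith
        gcongr

/-! ### Approximation by functions smooth up to the boundary -/

/-- The bump function of radius `r / (n + 2)` used in the `n`-th smooth approximation. -/
noncomputable def approxBump {r : ℝ} (hr : 0 < r) (n : ℕ) : ContDiffBump (0 : Euc d) where
  rIn := r / (n + 2) / 2
  rOut := r / (n + 2)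
  rIn_pos := by positivity
  rIn_lt_rOut := half_lt_self (by positivity)

/-- The `n`-th smooth approximation: mollification at scale `r / (n + 2)` after a contraction by the
factor `1 - 1 / (n + 2)` towards `z`. If `K` is convex and `z` has distance more than `r` to the
complement of `K`, it only uses values in the interior of `K` when evaluated in `K`. -/
noncomputable def smoothApprox (z : Euc d) {r : ℝ} (hr : 0 < r) (n : ℕ) (h : Euc d → Euc d)
    (x : Euc d) : Euc d :=
  convolution ((approxBump hr n).normed volume) h (ContinuousLinearMap.lsmul ℝ ℝ) volume
    (contraction z (1 - 1 / (n + 2)) x)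

theorem half_le_factor (n : ℕ) : (1 : ℝ) / 2 ≤ 1 - 1 / (n + 2) := by
  have h1 : (1 : ℝ) / (n + 2) ≤ 1 / 2 := by
    apply one_div_le_one_div_of_le two_pos
    have : (0 : ℝ) ≤ n := n.cast_nonneg
    linarith
  linarith

theorem contDiff_smoothApprox (z : Euc d) {r : ℝ} (hr : 0 < r) (n : ℕ) {h : Euc d → Euc d}
    (hh : LocallyIntegrable h volume) : ContDiff ℝ ∞ (smoothApprox z hr n h) := by
  have h1 : ContDiff ℝ ∞ (contraction z (1 - 1 / (n + 2))) := by unfold contraction; fun_prop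
  exact ((approxBump hr n).hasCompactSupport_normed.contDiff_convolution_left _
    (approxBump hr n).contDiff_normed hh).comp h1

theorem smoothApprox_add (z : Euc d) {r : ℝ} (hr : 0 < r) (n : ℕ) {f g : Euc d → Euc d}
    (hf : LocallyIntegrable f volume) (hg : LocallyIntegrable g volume) (x : Euc d) :
    smoothApprox z hr n (f + g) x = smoothApprox z hr n f x + smoothApprox z hr n g x := by
  have hc := (approxBump (d := d) hr n).hasCompactSupport_normed (μ := volume)
  have hc' := (approxBump (d := d) hr n).continuous_normed (μ := volume)
  unfold smoothApprox
  rw [(hc.convolutionExists_left _ hc' hf).distrib_add (hc.convolutionExists_left _ hc' hg)]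
  rfl

theorem eLpNorm_smoothApprox_le (z : Euc d) {r : ℝ} (hr : 0 < r) (n : ℕ) {h : Euc d → Euc d}
    (hh : LocallyIntegrable h volume) (K : Set (Euc d)) :
    eLpNorm (smoothApprox z hr n h) 2 (volume.restrict K) ≤
      ENNReal.ofReal (2 ^ d) ^ (1 / 2 : ℝ) * eLpNorm h 2 volume := by
  have hcont : Continuous (convolution ((approxBump (d := d) hr n).normed volume) h
      (ContinuousLinearMap.lsmul ℝ ℝ) volume) :=
    ((approxBump hr n).hasCompactSupport_normed.contDiff_convolution_left (n := 0) _
      (approxBump hr n).contDiff_normed hh).continuous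
  refine (eLpNorm_comp_contraction_le z (half_le_factor n) hcont.aestronglyMeasurable K).trans ?_
  gcongr
  exact eLpNorm_normed_convolution_le _ hh.aestronglyMeasurable

theorem tendsto_inv_add_two : Tendsto (fun n : ℕ => (1 : ℝ) / (n + 2)) atTop (𝓝 0) := by
  have := (tendsto_add_atTop_iff_nat (f := fun n : ℕ => (1 : ℝ) / n) 2).2
    tendsto_one_div_atTop_nhds_zero_nat
  simpa using this

/-- On compactly supported continuous functions the approximations converge uniformly. -/
theorem eventually_dist_smoothApprox_le (z : Euc d) {r : ℝ} (hr : 0 < r) {f : Euc d → Euc d}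
    (hf : Continuous f) (hc : HasCompactSupport f) {K : Set (Euc d)} (hK : Bornology.IsBounded K)
    {ε : ℝ} (hε : 0 < ε) :
    ∀ᶠ n in atTop, ∀ x ∈ K, ‖smoothApprox z hr n f x - f x‖ ≤ ε := by
  have huc := hc.uniformContinuous_of_continuous hf
  obtain ⟨ρ, hρ, hρf⟩ := Metric.uniformContinuous_iff.1 huc (ε / 2) (half_pos hε)
  obtain ⟨R, hR⟩ := hK.subset_closedBall z
  have h1 : ∀ᶠ n : ℕ in atTop, r * (1 / ((n : ℝ) + 2)) < ρ :=
    (tendsto_inv_add_two.const_mul r).eventually_lt_const (by simpa using hρ)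
  have h2 : ∀ᶠ n : ℕ in atTop, (1 / ((n : ℝ) + 2)) * R < ρ :=
    (tendsto_inv_add_two.mul_const R).eventually_lt_const (by simpa using hρ)
  filter_upwards [h1, h2] with n hn1 hn2 x hx
  have hd1 : dist (smoothApprox z hr n f x) (f (contraction z (1 - 1 / (n + 2)) x)) ≤ ε / 2 := by
    refine ContDiffBump.dist_normed_convolution_le hf.aestronglyMeasurable fun y hy => ?_
    refine (hρf ((Metric.mem_ball.1 hy).trans ?_)).le
    simpa [approxBump, div_eq_mul_inv] using hn1
  have hd2 : dist (f (contraction z (1 - 1 / (n + 2)) x)) (f x) ≤ ε / 2 := by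
    refine (hρf ?_).le
    have e : contraction z (1 - 1 / ((n : ℝ) + 2)) x - x = -((1 / ((n : ℝ) + 2)) • (x - z)) := by
      simp only [contraction]; module
    rw [dist_eq_norm, e, norm_neg, norm_smul, Real.norm_of_nonneg (by positivity)]
    have hxR : ‖x - z‖ ≤ R := by simpa [dist_eq_norm] using hR hx
    exact (mul_le_mul_of_nonneg_left hxR (by positivity)).trans_lt hn2
  rw [← dist_eq_norm]
  linarith [dist_triangle (smoothApprox z hr n f x) (f (contraction z (1 - 1 / (n + 2)) x)) (f x)]

theorem tendsto_smoothApprox (z : Euc d) {r : ℝ} (hr : 0 < r) {h : Euc d → Euc d}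
    (hh : MemLp h 2 volume) {K : Set (Euc d)} (hK : IsCompact K) :
    Tendsto (fun n => eLpNorm (fun x => smoothApprox z hr n h x - h x) 2 (volume.restrict K))
      atTop (𝓝 0) := by
  rw [ENNReal.tendsto_nhds_zero]
  intro ε hε
  rcases eq_or_ne ε ⊤ with rfl | hεt
  · simp
  set C : ℝ≥0∞ := ENNReal.ofReal (2 ^ d) ^ (1 / 2 : ℝ)
  have hCt : C ≠ ⊤ := ENNReal.rpow_ne_top_of_nonneg (by norm_num) ENNReal.ofReal_ne_top
  set V : ℝ≥0∞ := volume K ^ (1 / 2 : ℝ) with hV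
  have hVt : V ≠ ⊤ := ENNReal.rpow_ne_top_of_nonneg (by norm_num) hK.measure_lt_top.ne
  obtain ⟨η, hη0, hη⟩ : ∃ η : ℝ≥0∞, η ≠ 0 ∧ (C + 1) * η ≤ ε / 2 := by
    refine ⟨ε / 2 / (C + 1), ?_, ?_⟩
    · exact (ENNReal.div_pos (ENNReal.div_pos hε.ne' ENNReal.ofNat_ne_top).ne'
        (ENNReal.add_ne_top.2 ⟨hCt, ENNReal.one_ne_top⟩)).ne'
    · exact ENNReal.mul_div_le
  obtain ⟨s, hs0, hs⟩ : ∃ s : ℝ, 0 < s ∧ V * ENNReal.ofReal s ≤ ε / 2 := by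
    refine ⟨(ε / 2 / (V + 1)).toReal, ?_, ?_⟩
    · refine ENNReal.toReal_pos (ENNReal.div_pos (ENNReal.div_pos hε.ne' ENNReal.ofNat_ne_top).ne'
        (ENNReal.add_ne_top.2 ⟨hVt, ENNReal.one_ne_top⟩)).ne' ?_
      exact ENNReal.div_ne_top (ENNReal.div_ne_top hεt two_ne_zero) (by simp)
    · rw [ENNReal.ofReal_toReal (ENNReal.div_ne_top (ENNReal.div_ne_top hεt two_ne_zero) (by simp))]
      calc V * (ε / 2 / (V + 1)) ≤ (V + 1) * (ε / 2 / (V + 1)) := by gcongr; exact le_self_add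
        _ ≤ ε / 2 := ENNReal.mul_div_le
  obtain ⟨f, hfc, hfe, hf, hfm⟩ :=
    hh.exists_hasCompactSupport_eLpNorm_sub_le ENNReal.ofNat_ne_top hη0
  filter_upwards [eventually_dist_smoothApprox_le z hr hf hfc hK.isBounded hs0] with n hn
  have hli : LocallyIntegrable h volume := hh.locallyIntegrable one_le_two
  have hlf : LocallyIntegrable f volume := hfm.locallyIntegrable one_le_two
  have e : (fun x => smoothApprox z hr n h x - h x) =
      (smoothApprox z hr n (h - f) + fun x => smoothApprox z hr n f x - f x) +
        fun x => f x - h x := by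
    ext1 x
    have hsplit := smoothApprox_add z hr n (hli.sub hlf) hlf x
    rw [sub_add_cancel] at hsplit
    simp only [Pi.add_apply, hsplit]
    abel
  have m1 := ((contDiff_smoothApprox z hr n (hli.sub hlf)).continuous).aestronglyMeasurable
    (μ := volume.restrict K)
  have m2 := (((contDiff_smoothApprox z hr n hlf).continuous).sub hf).aestronglyMeasurable
    (μ := volume.restrict K)
  have m3 := (hf.aestronglyMeasurable.sub hh.aestronglyMeasurable).restrict (s := K)
  have b1 : eLpNorm (smoothApprox z hr n (h - f)) 2 (volume.restrict K) ≤ C * η :=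
    (eLpNorm_smoothApprox_le z hr n (hli.sub hlf) K).trans (by gcongr)
  have b2 : eLpNorm (fun x => smoothApprox z hr n f x - f x) 2 (volume.restrict K) ≤
      V * ENNReal.ofReal s := by
    have := eLpNorm_le_of_ae_bound (p := 2) (μ := volume.restrict K) (C := s)
      (f := fun x => smoothApprox z hr n f x - f x) (by
        filter_upwards [ae_restrict_mem hK.measurableSet] with x hx using hn x hx)
    simpa [hV] using this
  have b3 : eLpNorm (fun x => f x - h x) 2 (volume.restrict K) ≤ η := by
    refine (eLpNorm_mono_measure _ Measure.restrict_le_self).trans ?_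
    have : (fun x => f x - h x) = f - h := rfl
    rw [this, eLpNorm_sub_comm]; exact hfe
  rw [e]
  calc _ ≤ (C * η + V * ENNReal.ofReal s) + η :=
        (eLpNorm_add_le (m1.add m2) m3 one_le_two).trans
          (add_le_add ((eLpNorm_add_le m1 m2 one_le_two).trans (add_le_add b1 b2)) b3)
    _ = (C + 1) * η + V * ENNReal.ofReal s := by ring
    _ ≤ ε / 2 + ε / 2 := add_le_add hη hs
    _ = ε := ENNReal.add_halves ε

/-- The approximations commute with weak differentiation, up to the contraction factor: in a convex set
the mollifier centred at a contracted point is a test function. -/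
theorem fderiv_smoothApprox {K : Set (Euc d)} (hKc : IsCompact K) (hKv : Convex ℝ K) {z : Euc d}
    {r : ℝ} (hr : 0 < r) (hz : Metric.closedBall z r ⊆ interior K) {w g : Euc d → Euc d} {i : Fin d}
    (hw : MemLp w 2 (volume.restrict K)) (hwg : HasWeakPartial K i w g)
    (n : ℕ) {x : Euc d} (hx : x ∈ K) :
    fderiv ℝ (smoothApprox z hr n (K.indicator w)) x (stdVec i) =
      (1 - 1 / ((n : ℝ) + 2)) • smoothApprox z hr n (K.indicator g) x := by
  set l : ℝ := 1 - 1 / ((n : ℝ) + 2) with hl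
  set κ := (approxBump (d := d) hr n).normed volume
  have hκd : ContDiff ℝ ∞ κ := (approxBump hr n).contDiff_normed
  have hκc : HasCompactSupport κ := (approxBump hr n).hasCompactSupport_normed
  have hKm := hKc.measurableSet
  have hli : LocallyIntegrable (K.indicator w) volume :=
    ((memLp_indicator_iff_restrict hKm).2 hw).locallyIntegrable one_le_two
  set y := contraction z l x with hy
  have hcd : HasFDerivAt (contraction z l) (l • ContinuousLinearMap.id ℝ (Euc d)) x :=
    (((hasFDerivAt_id x).sub_const z).const_smul l).const_add z
  have hconv := hκc.hasFDerivAt_convolution_left (ContinuousLinearMap.lsmul ℝ ℝ)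
    (hκd.of_le (by simp)) hli y
  have hcomp := hconv.comp x hcd
  have hfd : fderiv ℝ (smoothApprox z hr n (K.indicator w)) x = _ := hcomp.fderiv
  rw [hfd]
  simp only [ContinuousLinearMap.comp_apply, smul_apply, ContinuousLinearMap.id_apply, map_smul]
  congr 1
  -- the test function centred at the contracted point
  have hsub : tsupport (fun t => κ (y - t)) ⊆ interior K := by
    have h1 : Function.support (fun t => κ (y - t)) ⊆ Metric.closedBall y (r / (n + 2)) := by
      intro t ht
      have : y - t ∈ Metric.ball (0 : Euc d) (approxBump (d := d) hr n).rOut := by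
        rw [← (approxBump (d := d) hr n).support_normed_eq (μ := volume)]; exact ht
      rw [mem_ball_zero_iff] at this
      rw [Metric.mem_closedBall, dist_comm, dist_eq_norm]
      exact this.le
    refine (closure_minimal h1 Metric.isClosed_closedBall).trans fun t ht => ?_
    have hn : (0 : ℝ) < n + 2 := by positivity
    have hu : z + ((n : ℝ) + 2) • (t - y) ∈ interior K := by
      apply hz
      rw [mem_closedBall_iff_norm, add_sub_cancel_left, norm_smul, Real.norm_of_nonneg hn.le]
      rw [mem_closedBall_iff_norm, le_div_iff₀ hn] at ht
      linarith
    have ht : t = l • x + (1 / ((n : ℝ) + 2)) • (z + ((n : ℝ) + 2) • (t - y)) := by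
      rw [smul_add, smul_smul, one_div_mul_cancel hn.ne', hy, contraction, hl]
      module
    rw [ht]
    exact hKv.combo_self_interior_mem_interior hx hu
      (by have := half_le_factor n; rw [← hl] at this; linarith) (by positivity) (by rw [hl]; ring)
  have hty : ContDiff ℝ ∞ fun t => κ (y - t) := hκd.comp (contDiff_const.sub contDiff_id)
  have htest := hwg _ hty (HasCompactSupport.intro hKc fun t ht => by
    by_contra hc
    exact ht (interior_subset (hsub (subset_tsupport _ hc)))) hsub
  have hder : ∀ t, fderiv ℝ (fun t => κ (y - t)) t (stdVec i) = -fderiv ℝ κ (y - t) (stdVec i) := by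
    intro t
    have h1 : HasFDerivAt (fun t => y - t) (-ContinuousLinearMap.id ℝ (Euc d)) t :=
      (hasFDerivAt_id t).const_sub y
    have h2 := (hκd.differentiable (by simp) (y - t)).hasFDerivAt.comp t h1
    have h3 : fderiv ℝ (fun t => κ (y - t)) t = _ := h2.fderiv
    rw [h3]; simp
  simp only [hder, neg_smul, integral_neg, neg_inj] at htest
  have hind : ∀ (a : Euc d → ℝ) (f : Euc d → Euc d),
      ∫ t, a t • K.indicator f t = ∫ t in K, a t • f t := by
    intro a f
    rw [← integral_indicator hKm]
    congr 1; ext1 t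
    by_cases ht : t ∈ K <;> simp [ht]
  have hexL := (hκc.fderiv (𝕜 := ℝ)).convolutionExists_left
    ((ContinuousLinearMap.lsmul ℝ ℝ).precompL (Euc d)) (hκd.continuous_fderiv (by simp)) hli y
  have hswap : smoothApprox z hr n (K.indicator g) x = ∫ t, κ (y - t) • K.indicator g t :=
    convolution_lsmul_swap
  rw [hswap, hind, ← htest, ← hind (fun t => fderiv ℝ κ (y - t) (stdVec i)), convolution_def,
    ContinuousLinearMap.integral_apply hexL,
    ← integral_sub_left_eq_self (fun t => fderiv ℝ κ (y - t) (stdVec i) • K.indicator w t) volume y]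
  congr 1; ext1 t
  simp

/-! ### Traces of Sobolev functions -/

section Trace

variable {K : Set (Euc d)} {S : Finset (Euc d × ℝ)}

theorem weakPartial_spec {i : Fin d} {w : Euc d → Euc d}
    (h : ∃ g, MemLp g 2 (volume.restrict K) ∧ HasWeakPartial K i w g) :
    MemLp (weakPartial K i w) 2 (volume.restrict K) ∧ HasWeakPartial K i w (weakPartial K i w) := by
  rw [weakPartial, dif_pos h]
  exact h.choose_spec

theorem dist_toLp_sq {α F : Type*} [MeasurableSpace α] {μ : Measure α} [NormedAddCommGroup F]
    [InnerProductSpace ℝ F] {f g : α → F} (hf : MemLp f 2 μ) (hg : MemLp g 2 μ) :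
    dist (hf.toLp f) (hg.toLp g) ^ 2 = ∫ x, ‖f x - g x‖ ^ 2 ∂μ := by
  rw [dist_eq_norm, ← MemLp.toLp_sub]
  exact norm_toLp_sq (hf.sub hg)

theorem tendsto_toLp {α F : Type*} [MeasurableSpace α] {μ : Measure α} [NormedAddCommGroup F]
    {f : ℕ → α → F} {g : α → F} (hf : ∀ n, MemLp (f n) 2 μ) (hg : MemLp g 2 μ)
    (h : Tendsto (fun n => eLpNorm (fun x => f n x - g x) 2 μ) atTop (𝓝 0)) :
    Tendsto (fun n => (hf n).toLp (f n)) atTop (𝓝 (hg.toLp g)) :=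
  (Lp.tendsto_Lp_iff_tendsto_eLpNorm'' f hf g hg).2 h

/-- Functions smooth up to the boundary are dense in `H¹` of a convex polytope. -/
theorem IsHalfSpaceRep.exists_smooth_approx (h : IsHalfSpaceRep K S) {w : Euc d → Euc d}
    (hw : MemLp w 2 (volume.restrict K))
    (hD : ∀ i, ∃ g, MemLp g 2 (volume.restrict K) ∧ HasWeakPartial K i w g) :
    ∃ φ : ℕ → Euc d → Euc d, (∀ n, ContDiff ℝ ∞ (φ n)) ∧
      Tendsto (fun n => eLpNorm (fun x => φ n x - w x) 2 (volume.restrict K)) atTop (𝓝 0) ∧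
      ∀ i, Tendsto (fun n => eLpNorm (fun x => fderiv ℝ (φ n) x (stdVec i) - weakPartial K i w x) 2
        (volume.restrict K)) atTop (𝓝 0) := by
  have hKm := h.isClosed.measurableSet
  obtain ⟨z, hz⟩ := h.nonempty
  obtain ⟨r, hr, hzr⟩ : ∃ r > 0, Metric.closedBall z r ⊆ interior K :=
    Metric.nhds_basis_closedBall.mem_iff.1 (isOpen_interior.mem_nhds hz)
  have hwi : MemLp (K.indicator w) 2 volume := (memLp_indicator_iff_restrict hKm).2 hw
  let φ : ℕ → Euc d → Euc d := fun n => smoothApprox z hr n (K.indicator w)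
  have hφ : ∀ n, ContDiff ℝ ∞ (φ n) := fun n =>
    contDiff_smoothApprox z hr n (hwi.locallyIntegrable one_le_two)
  have hcongr : ∀ (f g : Euc d → Euc d), eLpNorm (fun x => f x - K.indicator g x) 2
      (volume.restrict K) = eLpNorm (fun x => f x - g x) 2 (volume.restrict K) := fun f g => by
    refine eLpNorm_congr_ae ?_
    filter_upwards [ae_restrict_mem hKm] with x hx
    rw [Set.indicator_of_mem hx]
  have hlim0 : Tendsto (fun n => eLpNorm (fun x => φ n x - w x) 2 (volume.restrict K)) atTop
      (𝓝 0) := by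
    simpa only [hcongr] using tendsto_smoothApprox z hr hwi h.isCompact
  refine ⟨φ, hφ, hlim0, fun i => ?_⟩
  obtain ⟨hg, hwg⟩ := weakPartial_spec (hD i)
  set g := weakPartial K i w
  have hgi : MemLp (K.indicator g) 2 volume := (memLp_indicator_iff_restrict hKm).2 hg
  have h1 := tendsto_smoothApprox z hr hgi h.isCompact
  simp only [hcongr] at h1
  have h2 : Tendsto (fun n : ℕ => ENNReal.ofReal (1 / ((n : ℝ) + 2)) *
      eLpNorm g 2 (volume.restrict K)) atTop (𝓝 0) := by
    have := ENNReal.Tendsto.mul_const (b := eLpNorm g 2 (volume.restrict K))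
      (ENNReal.tendsto_ofReal tendsto_inv_add_two) (Or.inr hg.eLpNorm_ne_top)
    simpa using this
  have h3 := h1.add h2
  rw [add_zero] at h3
  refine tendsto_of_tendsto_of_tendsto_of_le_of_le tendsto_const_nhds h3 (fun _ => zero_le)
    fun n => ?_
  set l : ℝ := 1 - 1 / ((n : ℝ) + 2) with hl
  have hl0 : 0 ≤ l := by have := half_le_factor n; rw [← hl] at this; linarith
  have hl1 : l ≤ 1 := by rw [hl]; linarith [show (0 : ℝ) ≤ 1 / ((n : ℝ) + 2) by positivity]
  have hsm := (contDiff_smoothApprox z hr n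
    (hgi.locallyIntegrable one_le_two)).continuous.aestronglyMeasurable
    (μ := volume.restrict K)
  have e : (fun x => fderiv ℝ (φ n) x (stdVec i) - g x) =ᵐ[volume.restrict K]
      (l • fun x => smoothApprox z hr n (K.indicator g) x - g x) +
        (-(1 / ((n : ℝ) + 2))) • g := by
    filter_upwards [ae_restrict_mem hKm] with x hx
    simp only [φ, fderiv_smoothApprox h.isCompact h.convex hr hzr hw hwg n hx, Pi.add_apply,
      Pi.smul_apply, hl]
    module
  calc _ = _ := eLpNorm_congr_ae e
    _ ≤ _ := eLpNorm_add_le ((hsm.sub hg.aestronglyMeasurable).const_smul l)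
        (hg.aestronglyMeasurable.const_smul _) one_le_two
    _ ≤ _ := by
      rw [eLpNorm_const_smul, eLpNorm_const_smul]
      gcongr
      · refine mul_le_of_le_one_left zero_le ?_
        rw [Real.enorm_of_nonneg hl0]
        exact ENNReal.ofReal_le_one.2 hl1
      · rw [enorm_neg, Real.enorm_of_nonneg (by positivity)]

/-- Functions with weak derivatives in `L²` have a trace on the boundary of a convex polytope: the
boundary values of smooth approximations converge by the trace inequality. -/
theorem IsHalfSpaceRep.exists_isTrace (h : IsHalfSpaceRep K S) {w : Euc d → Euc d}
    (hw : MemLp w 2 (volume.restrict K))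
    (hD : ∀ i, ∃ g, MemLp g 2 (volume.restrict K) ∧ HasWeakPartial K i w g) :
    ∃ τ, IsTrace K w τ := by
  obtain ⟨φ, hφ, hlim0, hlim1⟩ := h.exists_smooth_approx hw hD
  obtain ⟨C, hC⟩ := h.exists_trace_inequality
  have hφd : ∀ n i, Continuous fun x => fderiv ℝ (φ n) x (stdVec i) := fun n i =>
    ((hφ n).continuous_fderiv (by simp)).clm_apply continuous_const
  let a : ℕ → Lp (Euc d) 2 (volume.restrict K) := fun n =>
    (h.memLp_of_continuous (hφ n).continuous).toLp (φ n)
  let b : Fin d → ℕ → Lp (Euc d) 2 (volume.restrict K) := fun i n =>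
    (h.memLp_of_continuous (hφd n i)).toLp _
  let u : ℕ → Lp (Euc d) 2 (bdryMeasure K) := fun n =>
    (h.memLp_bdry_of_continuous (hφ n).continuous).toLp (φ n)
  have ha : CauchySeq a :=
    (tendsto_toLp (fun n => h.memLp_of_continuous (hφ n).continuous) hw hlim0).cauchySeq
  have hb : ∀ i, CauchySeq (b i) := fun i =>
    (tendsto_toLp (fun n => h.memLp_of_continuous (hφd n i)) (weakPartial_spec (hD i)).1
      (hlim1 i)).cauchySeq
  have hu : ∀ m n, dist (u m) (u n) ^ 2 ≤
      C * (dist (a m) (a n) ^ 2 + ∑ i, dist (b i m) (b i n) ^ 2) := by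
    intro m n
    simp only [u, a, b, dist_toLp_sq]
    refine (hC (fun x => φ m x - φ n x) ((hφ m).sub (hφ n))).trans_eq ?_
    congr 3
    ext i
    congr 1; ext x
    rw [fderiv_fun_sub ((hφ m).differentiable (by simp) x) ((hφ n).differentiable (by simp) x)]
    rfl
  have huC : CauchySeq u := by
    rw [cauchySeq_iff_tendsto_dist_atTop_0]
    have h1 := cauchySeq_iff_tendsto_dist_atTop_0.1 ha
    have h2 := fun i => cauchySeq_iff_tendsto_dist_atTop_0.1 (hb i)
    have h3 := (((h1.pow 2).add (tendsto_finsetSum Finset.univ fun i _ => (h2 i).pow 2)).const_mul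
      C).sqrt
    simp only [ne_eq, OfNat.ofNat_ne_zero, not_false_eq_true, zero_pow, Finset.sum_const_zero,
      add_zero, mul_zero, Real.sqrt_zero] at h3
    exact squeeze_zero (fun _ => dist_nonneg) (fun p => Real.le_sqrt_of_sq_le (hu p.1 p.2)) h3
  obtain ⟨τ, hτ⟩ := cauchySeq_tendsto_of_complete huC
  refine ⟨τ, Lp.memLp τ, φ, hφ, hlim0, hlim1, ?_⟩
  refine (Lp.tendsto_Lp_iff_tendsto_eLpNorm'' φ
    (fun n => h.memLp_bdry_of_continuous (hφ n).continuous) τ (Lp.memLp τ)).1 ?_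
  rwa [Lp.toLp_coeFn]

theorem isTrace_trace {w : Euc d → Euc d} (h : ∃ τ, IsTrace K w τ) : IsTrace K w (trace K w) := by
  rw [trace, dif_pos h]
  exact h.choose_spec

end Trace

/-! ### The product rule with traces -/

section ProductRule

theorem memLp_smul_of_bound {α : Type*} [MeasurableSpace α] {μ : Measure α} {f : α → Euc d}
    (hf : MemLp f 2 μ) {c : α → ℝ} (hc : AEStronglyMeasurable c μ) {B : ℝ}
    (hB : ∀ᵐ x ∂μ, |c x| ≤ B) : MemLp (fun x => c x • f x) 2 μ := by
  refine MemLp.of_le_mul (c := B) hf (hc.smul hf.aestronglyMeasurable) ?_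
  filter_upwards [hB] with x hx
  rw [norm_smul, Real.norm_eq_abs]
  gcongr

theorem integrable_mul_inner {α : Type*} [MeasurableSpace α] {μ : Measure α} {f g : α → Euc d}
    (hf : MemLp f 2 μ) (hg : MemLp g 2 μ) {c : α → ℝ} (hc : AEStronglyMeasurable c μ) {B : ℝ}
    (hB : ∀ᵐ x ∂μ, |c x| ≤ B) : Integrable (fun x => c x * ⟪f x, g x⟫) μ := by
  have h := L2.integrable_inner (𝕜 := ℝ) ((memLp_smul_of_bound hf hc hB).toLp _) (hg.toLp g)
  refine h.congr ?_
  filter_upwards [(memLp_smul_of_bound hf hc hB).coeFn_toLp, hg.coeFn_toLp] with x h1 h2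
  rw [h1, h2, real_inner_smul_left]

/-- Weighted `L²` inner products with a bounded weight are continuous. -/
theorem tendsto_integral_mul_inner {α : Type*} [MeasurableSpace α] {μ : Measure α}
    {f h : ℕ → α → Euc d} {f₀ h₀ : α → Euc d} (hf : ∀ n, MemLp (f n) 2 μ) (hf₀ : MemLp f₀ 2 μ)
    (hh : ∀ n, MemLp (h n) 2 μ) (hh₀ : MemLp h₀ 2 μ)
    (hfl : Tendsto (fun n => eLpNorm (fun x => f n x - f₀ x) 2 μ) atTop (𝓝 0))
    (hhl : Tendsto (fun n => eLpNorm (fun x => h n x - h₀ x) 2 μ) atTop (𝓝 0))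
    {c : α → ℝ} (hc : AEStronglyMeasurable c μ) {B : ℝ} (hB : ∀ᵐ x ∂μ, |c x| ≤ B) :
    Tendsto (fun n => ∫ x, c x * ⟪f n x, h n x⟫ ∂μ) atTop (𝓝 (∫ x, c x * ⟪f₀ x, h₀ x⟫ ∂μ)) := by
  have hcl : Tendsto (fun n => eLpNorm (fun x => c x • f n x - c x • f₀ x) 2 μ) atTop (𝓝 0) := by
    have h1 := ENNReal.Tendsto.const_mul (a := ENNReal.ofReal B) hfl (Or.inr ENNReal.ofReal_ne_top)
    rw [mul_zero] at h1
    refine tendsto_of_tendsto_of_tendsto_of_le_of_le tendsto_const_nhds h1 (fun _ => zero_le)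
      fun n => ?_
    refine eLpNorm_le_mul_eLpNorm_of_ae_le_mul ?_ 2
    filter_upwards [hB] with x hx
    rw [← smul_sub, norm_smul, Real.norm_eq_abs]
    gcongr
  have h1 := tendsto_toLp (fun n => memLp_smul_of_bound (hf n) hc hB)
    (memLp_smul_of_bound hf₀ hc hB) hcl
  have h2 := tendsto_toLp hh hh₀ hhl
  have e : ∀ {u v : α → Euc d} (hu : MemLp u 2 μ) (hv : MemLp v 2 μ),
      ⟪(memLp_smul_of_bound hu hc hB).toLp _, hv.toLp v⟫ = ∫ x, c x * ⟪u x, v x⟫ ∂μ := by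
    intro u v hu hv
    rw [L2.inner_def]
    refine integral_congr_ae ?_
    filter_upwards [(memLp_smul_of_bound hu hc hB).coeFn_toLp, hv.coeFn_toLp] with x h1 h2
    rw [h1, h2, real_inner_smul_left]
  have h3 := h1.inner (𝕜 := ℝ) h2
  rw [e hf₀ hh₀] at h3
  exact h3.congr fun n => e (hf n) (hh n)

/-- `w` and its first weak derivatives are in `L²(K)`. -/
def MemH1 (K : Set (Euc d)) (w : Euc d → Euc d) : Prop :=
  MemLp w 2 (volume.restrict K) ∧
    ∀ i, ∃ g, MemLp g 2 (volume.restrict K) ∧ HasWeakPartial K i w g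

variable {K : Set (Euc d)} {S : Finset (Euc d × ℝ)}

theorem abs_apply_le_norm (v : Euc d) (i : Fin d) : |v i| ≤ ‖v‖ := by
  simpa using PiLp.norm_apply_le v i

theorem aestronglyMeasurable_apply {α : Type*} [MeasurableSpace α] {μ : Measure α} {b : α → Euc d}
    (hb : AEStronglyMeasurable b μ) (i : Fin d) : AEStronglyMeasurable (fun x => b x i) μ :=
  (EuclideanSpace.proj (𝕜 := ℝ) i).continuous.comp_aestronglyMeasurable hb

theorem IsHalfSpaceRep.green_smooth (h : IsHalfSpaceRep K S) {b : Euc d → Euc d} {B : ℝ}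
    (hb : AEStronglyMeasurable b (volume.restrict K)) (hB : ∀ᵐ x ∂volume.restrict K, ‖b x‖ ≤ B)
    {g : Euc d → ℝ} (hg : HasNormalTrace K b 0 g) {φ ψ : Euc d → Euc d}
    (hφ : ContDiff ℝ ∞ φ) (hψ : ContDiff ℝ ∞ ψ) :
    (∑ i, ∫ x in K, b x i * ⟪fderiv ℝ φ x (stdVec i), ψ x⟫) +
        ∑ i, ∫ x in K, b x i * ⟪φ x, fderiv ℝ ψ x (stdVec i)⟫ =
      ∫ x, g x * ⟪φ x, ψ x⟫ ∂(bdryMeasure K) := by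
  obtain ⟨R, hR⟩ := h.bounded.subset_closedBall 0
  let χ : ContDiffBump (0 : Euc d) :=
    { rIn := |R| + 1, rOut := |R| + 2, rIn_pos := by positivity, rIn_lt_rOut := by linarith }
  have hχ : ∀ x ∈ K, (χ : Euc d → ℝ) =ᶠ[𝓝 x] fun _ => 1 := by
    intro x hx
    have h1 : x ∈ Metric.ball (0 : Euc d) (|R| + 1) := by
      have h2 := hR hx
      rw [mem_closedBall_zero_iff] at h2
      rw [mem_ball_zero_iff]
      linarith [le_abs_self R]
    filter_upwards [Metric.isOpen_ball.mem_nhds h1] with y hy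
    exact χ.one_of_mem_closedBall (Metric.ball_subset_closedBall hy)
  have hin : ContDiff ℝ ∞ fun x => ⟪φ x, ψ x⟫ := hφ.inner ℝ hψ
  have hkey := hg (fun x => χ x * ⟪φ x, ψ x⟫) (χ.contDiff.mul hin) χ.hasCompactSupport.mul_right
  have hφd : ∀ i, Continuous fun x => fderiv ℝ φ x (stdVec i) := fun i =>
    (hφ.continuous_fderiv (by simp)).clm_apply continuous_const
  have hψd : ∀ i, Continuous fun x => fderiv ℝ ψ x (stdVec i) := fun i =>
    (hψ.continuous_fderiv (by simp)).clm_apply continuous_const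
  have hBi : ∀ i, ∀ᵐ x ∂volume.restrict K, |b x i| ≤ B := fun i => by
    filter_upwards [hB] with x hx using (abs_apply_le_norm _ _).trans hx
  have hint1 : ∀ i ∈ Finset.univ, Integrable (fun x => b x i * ⟪fderiv ℝ φ x (stdVec i), ψ x⟫)
      (volume.restrict K) := fun i _ =>
    integrable_mul_inner (h.memLp_of_continuous (hφd i)) (h.memLp_of_continuous hψ.continuous)
      (aestronglyMeasurable_apply hb i) (hBi i)
  have hint2 : ∀ i ∈ Finset.univ, Integrable (fun x => b x i * ⟪φ x, fderiv ℝ ψ x (stdVec i)⟫)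
      (volume.restrict K) := fun i _ =>
    integrable_mul_inner (h.memLp_of_continuous hφ.continuous) (h.memLp_of_continuous (hψd i))
      (aestronglyMeasurable_apply hb i) (hBi i)
  have e1 : ∫ x in K, fderiv ℝ (fun x => χ x * ⟪φ x, ψ x⟫) x (b x) =
      (∑ i, ∫ x in K, b x i * ⟪fderiv ℝ φ x (stdVec i), ψ x⟫) +
        ∑ i, ∫ x in K, b x i * ⟪φ x, fderiv ℝ ψ x (stdVec i)⟫ := by
    rw [← integral_finsetSum _ hint1, ← integral_finsetSum _ hint2,
      ← integral_add (integrable_finsetSum _ hint1) (integrable_finsetSum _ hint2)]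
    refine setIntegral_congr_fun h.isClosed.measurableSet fun x hx => ?_
    have h1 : (fun x => χ x * ⟪φ x, ψ x⟫) =ᶠ[𝓝 x] fun x => ⟪φ x, ψ x⟫ := by
      filter_upwards [hχ x hx] with y hy
      rw [hy, one_mul]
    simp only
    rw [h1.fderiv_eq, fderiv_inner_apply ℝ (hφ.differentiable (by simp) x)
      (hψ.differentiable (by simp) x), apply_eq_sum_stdVec (fderiv ℝ φ x),
      apply_eq_sum_stdVec (fderiv ℝ ψ x), inner_sum, sum_inner, add_comm]
    simp only [real_inner_smul_left, real_inner_smul_right]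
  have e2 : ∫ x, g x * (χ x * ⟪φ x, ψ x⟫) ∂(bdryMeasure K) =
      ∫ x, g x * ⟪φ x, ψ x⟫ ∂(bdryMeasure K) := by
    refine integral_congr_ae ?_
    filter_upwards [measure_eq_zero_iff_ae_notMem.1 h.bdryMeasure_compl] with x hx
    rw [(hχ x (by simpa using hx)).self_of_nhds, one_mul]
  rw [e1, e2] at hkey
  simpa using hkey

/-- Integration by parts on an element: Green's formula for the product of two `H¹` functions along a
bounded divergence-free field. -/
theorem IsHalfSpaceRep.green (h : IsHalfSpaceRep K S) {b : Euc d → Euc d} {B : ℝ}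
    (hb : AEStronglyMeasurable b (volume.restrict K)) (hB : ∀ᵐ x ∂volume.restrict K, ‖b x‖ ≤ B)
    (hdiv : HasWeakDiv K b 0) {w v : Euc d → Euc d} (hw : MemH1 K w) (hv : MemH1 K v) :
    (∑ i, ∫ x in K, b x i * ⟪weakPartial K i w x, v x⟫) +
        ∑ i, ∫ x in K, b x i * ⟪w x, weakPartial K i v x⟫ =
      ∫ x, normalTrace K b x * ⟪trace K w x, trace K v x⟫ ∂(bdryMeasure K) := by
  obtain ⟨hgm, hgB, hg⟩ := h.normalTrace_spec hb hB hdiv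
  obtain ⟨hτ, φ, hφ, hφ0, hφ1, hφt⟩ := isTrace_trace (h.exists_isTrace hw.1 hw.2)
  obtain ⟨hσ, ψ, hψ, hψ0, hψ1, hψt⟩ := isTrace_trace (h.exists_isTrace hv.1 hv.2)
  have hBi : ∀ i, ∀ᵐ x ∂volume.restrict K, |b x i| ≤ B := fun i => by
    filter_upwards [hB] with x hx using (abs_apply_le_norm _ _).trans hx
  have hφd : ∀ n i, MemLp (fun x => fderiv ℝ (φ n) x (stdVec i)) 2 (volume.restrict K) :=
    fun n i => h.memLp_of_continuous
      (((hφ n).continuous_fderiv (by simp)).clm_apply continuous_const)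
  have hψd : ∀ n i, MemLp (fun x => fderiv ℝ (ψ n) x (stdVec i)) 2 (volume.restrict K) :=
    fun n i => h.memLp_of_continuous
      (((hψ n).continuous_fderiv (by simp)).clm_apply continuous_const)
  have hφm := fun n => h.memLp_of_continuous (hφ n).continuous
  have hψm := fun n => h.memLp_of_continuous (hψ n).continuous
  have l1 := tendsto_finsetSum Finset.univ fun i (_ : i ∈ Finset.univ) =>
    tendsto_integral_mul_inner (fun n => hφd n i) (weakPartial_spec (hw.2 i)).1 hψm hv.1 (hφ1 i) hψ0
      (aestronglyMeasurable_apply hb i) (hBi i)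
  have l2 := tendsto_finsetSum Finset.univ fun i (_ : i ∈ Finset.univ) =>
    tendsto_integral_mul_inner hφm hw.1 (fun n => hψd n i) (weakPartial_spec (hv.2 i)).1 hφ0 (hψ1 i)
      (aestronglyMeasurable_apply hb i) (hBi i)
  have l3 := tendsto_integral_mul_inner (fun n => h.memLp_bdry_of_continuous (hφ n).continuous) hτ
    (fun n => h.memLp_bdry_of_continuous (hψ n).continuous) hσ hφt hψt hgm.aestronglyMeasurable hgB
  refine tendsto_nhds_unique (l1.add l2) (l3.congr fun n => ?_)
  exact (h.green_smooth hb hB hg (hφ n) (hψ n)).symm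

end ProductRule

/-! ### Regular boundary points and the combinatorics of the mesh skeleton -/

/-- `x` lies in the relative interior of a facet of `K` with outer unit normal `n`: near `x`, the body
`K` is a half-space. -/
structure IsRegularPoint (K : Set (Euc d)) (x n : Euc d) : Prop where
  unit : ‖n‖ = 1
  inner_le : ∀ y ∈ K, ⟪n, y⟫ ≤ ⟪n, x⟫
  mem : ∀ᶠ y in 𝓝 x, ⟪n, y⟫ ≤ ⟪n, x⟫ → y ∈ K
  mem_interior : ∀ᶠ y in 𝓝 x, ⟪n, y⟫ < ⟪n, x⟫ → y ∈ interior K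

/-- Almost all boundary points of a polytope are regular. -/
theorem IsHalfSpaceRep.ae_isRegularPoint {K : Set (Euc d)} {S : Finset (Euc d × ℝ)}
    (h : IsHalfSpaceRep K S) :
    ∀ᵐ x ∂(μHE[d - 1] : Measure (Euc d)), x ∈ frontier K → ∃ n, IsRegularPoint K x n := by
  have h1 : ∀ᵐ x ∂(μHE[d - 1] : Measure (Euc d)), ∀ p ∈ S, ∀ q ∈ S, p ≠ q →
      ¬ (gap p x = 0 ∧ gap q x = 0) := by
    refine (Finset.eventually_all S).2 fun p hp => (Finset.eventually_all S).2 fun q hq => ?_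
    by_cases hpq : p = q
    · simp [hpq]
    · filter_upwards [measure_eq_zero_iff_ae_notMem.1 (h.surface_hyperplanes_inter hp hq hpq)]
        with x hx _ using hx
  filter_upwards [h1] with x hx hxf
  rw [h.frontier_eq] at hxf
  simp only [Set.mem_iUnion, Set.mem_inter_iff, Set.mem_ofPred_eq, exists_prop] at hxf
  obtain ⟨p, hp, hxK, hpx⟩ := hxf
  rw [h.eq] at hxK
  have hpx' : ⟪p.1, x⟫ = p.2 := by simp only [gap] at hpx; linarith
  have hev : ∀ᶠ y in 𝓝 x, ∀ q ∈ S, q ≠ p → 0 < gap q y := by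
    refine (Finset.eventually_all S).2 fun q hq => ?_
    by_cases hqp : q = p
    · simp [hqp]
    · have hpos : 0 < gap q x :=
        lt_of_le_of_ne (hxK q hq) fun e => hx p hp q hq (Ne.symm hqp) ⟨hpx, e.symm⟩
      filter_upwards [(continuous_gap q).continuousAt.eventually_const_lt hpos] with y hy _ using hy
  refine ⟨p.1, h.unit p hp, fun y hy => ?_, ?_, ?_⟩
  · rw [h.eq] at hy
    have := hy p hp
    simp only [gap] at this
    linarith
  · filter_upwards [hev] with y hy hle
    rw [h.eq]
    intro q hq
    by_cases hqp : q = p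
    · rw [hqp, gap]; linarith
    · exact (hy q hq hqp).le
  · filter_upwards [hev] with y hy hle
    rw [h.interior_eq]
    intro q hq
    by_cases hqp : q = p
    · rw [hqp, gap]; linarith
    · exact hy q hq hqp

section Adjacent

variable {K K' : Set (Euc d)} {x n n' : Euc d}

theorem IsRegularPoint.self_mem (h : IsRegularPoint K x n) : x ∈ K :=
  h.mem.self_of_nhds le_rfl

/-- At a common regular boundary point, bodies with disjoint interiors have opposite normals. -/
theorem IsRegularPoint.eq_neg (h : IsRegularPoint K x n) (h' : IsRegularPoint K' x n')
    (hd : Disjoint (interior K) (interior K')) : n' = -n := by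
  by_contra hne
  have hgt : -1 < ⟪n, n'⟫ := by
    refine lt_of_le_of_ne ?_ fun e => ?_
    · have := neg_le_of_abs_le (abs_real_inner_le_norm n n')
      rwa [h.unit, h'.unit, one_mul] at this
    · have h1 : ⟪n', -n⟫ = 1 := by rw [inner_neg_right, real_inner_comm, ← e, neg_neg]
      exact hne ((inner_eq_one_iff_of_norm_eq_one h'.unit (by rw [norm_neg, h.unit])).1 h1)
  have hc : Tendsto (fun t : ℝ => x + t • (-(n + n'))) (𝓝[>] 0) (𝓝 x) := by
    have : Continuous fun t : ℝ => x + t • (-(n + n')) := by fun_prop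
    simpa using (this.tendsto 0).mono_left nhdsWithin_le_nhds
  obtain ⟨t, ⟨h1, h2⟩, ht⟩ := (((hc.eventually h.mem_interior).and
    (hc.eventually h'.mem_interior)).and self_mem_nhdsWithin).exists
  have ht : 0 < t := ht
  have hn := real_inner_self_eq_norm_sq n
  have hn' := real_inner_self_eq_norm_sq n'
  rw [h.unit] at hn
  rw [h'.unit] at hn'
  refine Set.disjoint_left.1 hd (h1 ?_) (h2 ?_)
  · rw [inner_add_right, inner_smul_right, inner_neg_right, inner_add_right, hn]
    nlinarith
  · rw [inner_add_right, inner_smul_right, inner_neg_right, inner_add_right, hn',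
      real_inner_comm n n']
    nlinarith

theorem IsRegularPoint.shareFacet (h : IsRegularPoint K x n) (h' : IsRegularPoint K' x n')
    (hd : Disjoint (interior K) (interior K')) : ShareFacet K K' := by
  have hneg := h.eq_neg h' hd
  refine ⟨⟨x, h.self_mem, h'.self_mem⟩, ?_⟩
  have hspan : vectorSpan ℝ (K ∩ K') = (ℝ ∙ n)ᗮ := by
    refine le_antisymm (vectorSpan_le_orthogonal (c := ⟪n, x⟫) fun y hy => ?_) fun u hu => ?_
    · have h1 := h'.inner_le y hy.2
      rw [hneg, inner_neg_left, inner_neg_left] at h1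
      exact le_antisymm (h.inner_le y hy.1) (by linarith)
    · rw [Submodule.mem_orthogonal_singleton_iff_inner_right] at hu
      have hc : Tendsto (fun t : ℝ => x + t • u) (𝓝[>] 0) (𝓝 x) := by
        have : Continuous fun t : ℝ => x + t • u := by fun_prop
        simpa using (this.tendsto 0).mono_left nhdsWithin_le_nhds
      obtain ⟨t, ⟨h1, h2⟩, ht⟩ := (((hc.eventually h.mem).and
        (hc.eventually h'.mem)).and self_mem_nhdsWithin).exists
      have ht : 0 < t := ht
      have m1 : x + t • u ∈ K := h1 (by rw [inner_add_right, inner_smul_right, hu]; simp)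
      have m2 : x + t • u ∈ K' := h2 (by
        rw [hneg, inner_add_right, inner_smul_right, inner_neg_left, inner_neg_left, hu]; simp)
      have h3 := vsub_mem_vectorSpan ℝ (s := K ∩ K') ⟨m1, m2⟩ ⟨h.self_mem, h'.self_mem⟩
      rw [vsub_eq_sub, add_sub_cancel_left] at h3
      have h4 := (vectorSpan ℝ (K ∩ K')).smul_mem t⁻¹ h3
      rwa [smul_smul, inv_mul_cancel₀ ht.ne', one_smul] at h4
  have h0 : n ≠ 0 := by
    intro e
    have := h.unit
    rw [e, norm_zero] at this
    exact zero_ne_one this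
  have h1 := (ℝ ∙ n).finrank_add_finrank_orthogonal
  rw [finrank_span_singleton h0, finrank_euclideanSpace_fin] at h1
  rw [hspan, add_comm]
  exact h1

end Adjacent

namespace Mesh

variable {Ω : Set (Euc d)} (𝒯 : Mesh Ω)

theorem isClosed_of_mem {K : Set (Euc d)} (hK : K ∈ 𝒯.cells) : IsClosed K := by
  obtain ⟨S, hS⟩ := (𝒯.polytope K hK).exists_isHalfSpaceRep
  exact hS.isClosed

theorem inter_subset_frontier {K K' : Set (Euc d)} (hK : K ∈ 𝒯.cells) (hK' : K' ∈ 𝒯.cells)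
    (hne : K ≠ K') : K ∩ K' ⊆ frontier K := by
  intro x hx
  refine ⟨subset_closure hx.1, fun hi => ?_⟩
  obtain ⟨S', hS'⟩ := (𝒯.polytope K' hK').exists_isHalfSpaceRep
  have hcl : x ∈ closure (interior K') := by
    rw [hS'.convex.closure_interior_eq_closure_of_nonempty_interior hS'.nonempty]
    exact subset_closure hx.2
  obtain ⟨y, hy1, hy2⟩ := mem_closure_iff.1 hcl _ isOpen_interior hi
  exact Set.disjoint_left.1 (𝒯.disjoint K hK K' hK' hne) hy1 hy2

theorem facet_subset_frontier {F : Set (Euc d) × Set (Euc d)} (hF : F ∈ 𝒯.intFacets) :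
    F.1 ∩ F.2 ⊆ frontier F.1 ∧ F.1 ∩ F.2 ⊆ frontier F.2 := by
  obtain ⟨h1, h2, hne, _⟩ := 𝒯.facet_mem F hF
  refine ⟨𝒯.inter_subset_frontier h1 h2 hne, ?_⟩
  rw [Set.inter_comm]
  exact 𝒯.inter_subset_frontier h2 h1 hne.symm

theorem interior_subset_domain {K : Set (Euc d)} (hK : K ∈ 𝒯.cells) : interior K ⊆ Ω := by
  conv_rhs => rw [𝒯.cover]
  exact interior_mono (Set.subset_biUnion_of_mem (u := fun K => K) hK)

/-- Almost every point of `ℝ^d`, for the surface measure, either lies on at most one element boundary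
and on no interior facet, or on exactly one interior facet and exactly the boundaries of the two
elements adjacent to it. -/
theorem ae_skeleton :
    ∀ᵐ x ∂(μHE[d - 1] : Measure (Euc d)),
      ((∀ F ∈ 𝒯.intFacets, x ∉ F.1 ∩ F.2) ∧
        ∀ K ∈ 𝒯.cells, ∀ K' ∈ 𝒯.cells, x ∈ frontier K → x ∈ frontier K' → K = K') ∨
      ∃ F₀ ∈ 𝒯.intFacets, x ∈ F₀.1 ∩ F₀.2 ∧ (∀ F ∈ 𝒯.intFacets, x ∈ F.1 ∩ F.2 → F = F₀) ∧
        ∀ K ∈ 𝒯.cells, x ∈ frontier K → K = F₀.1 ∨ K = F₀.2 := by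
  have hreg : ∀ᵐ x ∂(μHE[d - 1] : Measure (Euc d)), ∀ K ∈ 𝒯.cells, x ∈ frontier K →
      ∃ n, IsRegularPoint K x n := by
    refine (Finset.eventually_all 𝒯.cells).2 fun K hK => ?_
    obtain ⟨S, hS⟩ := (𝒯.polytope K hK).exists_isHalfSpaceRep
    exact hS.ae_isRegularPoint
  filter_upwards [hreg] with x hx
  -- three elements cannot meet at a regular point: their normals would be pairwise opposite
  have hthree : ∀ K ∈ 𝒯.cells, ∀ K' ∈ 𝒯.cells, ∀ K'' ∈ 𝒯.cells, x ∈ frontier K →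
      x ∈ frontier K' → x ∈ frontier K'' → K ≠ K' → K'' = K ∨ K'' = K' := by
    intro K hK K' hK' K'' hK'' hf hf' hf'' hne
    by_contra! hc
    obtain ⟨n, hn⟩ := hx K hK hf
    obtain ⟨n', hn'⟩ := hx K' hK' hf'
    obtain ⟨n'', hn''⟩ := hx K'' hK'' hf''
    have e1 := hn.eq_neg hn' (𝒯.disjoint K hK K' hK' hne)
    have e2 := hn.eq_neg hn'' (𝒯.disjoint K hK K'' hK'' hc.1.symm)
    have e3 := hn'.eq_neg hn'' (𝒯.disjoint K' hK' K'' hK'' hc.2.symm)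
    rw [e1, neg_neg, e2] at e3
    have h1 := congrArg (fun u => ⟪n, u⟫) e3
    have h2 := real_inner_self_eq_norm_sq n
    simp only [inner_neg_right] at h1
    rw [hn.unit] at h2
    linarith
  have huniq : ∀ F ∈ 𝒯.intFacets, ∀ F' ∈ 𝒯.intFacets, x ∈ F.1 ∩ F.2 → x ∈ F'.1 ∩ F'.2 →
      F' = F := by
    intro F hF F' hF' hxF hxF'
    obtain ⟨m1, m2, hne, hsh⟩ := 𝒯.facet_mem F hF
    obtain ⟨m1', m2', hne', hsh'⟩ := 𝒯.facet_mem F' hF'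
    have f1 := (𝒯.facet_subset_frontier hF).1 hxF
    have f2 := (𝒯.facet_subset_frontier hF).2 hxF
    have f1' := (𝒯.facet_subset_frontier hF').1 hxF'
    have f2' := (𝒯.facet_subset_frontier hF').2 hxF'
    have hor := 𝒯.facet_orient F.1 m1 F.2 m2 hne hsh
    rcases hthree F.1 m1 F.2 m2 F'.1 m1' f1 f2 f1' hne with a | a <;>
      rcases hthree F.1 m1 F.2 m2 F'.2 m2' f1 f2 f2' hne with c | c
    · exact absurd (a.trans c.symm) hne'
    · exact Prod.ext a c
    · exfalso
      have hF'' : (F.2, F.1) ∈ 𝒯.intFacets := by rw [← a, ← c]; exact hF'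
      rcases hor with h | h
      · exact h.2 hF''
      · exact h.2 hF
    · exact absurd (a.trans c.symm) hne'
  by_cases hone : ∀ K ∈ 𝒯.cells, ∀ K' ∈ 𝒯.cells, x ∈ frontier K → x ∈ frontier K' → K = K'
  · refine Or.inl ⟨fun F hF hxF => ?_, hone⟩
    obtain ⟨m1, m2, hne, _⟩ := 𝒯.facet_mem F hF
    exact hne (hone F.1 m1 F.2 m2 ((𝒯.facet_subset_frontier hF).1 hxF)
      ((𝒯.facet_subset_frontier hF).2 hxF))
  · push Not at hone
    obtain ⟨K, hK, K', hK', hf, hf', hne⟩ := hone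
    obtain ⟨n, hn⟩ := hx K hK hf
    obtain ⟨n', hn'⟩ := hx K' hK' hf'
    have hsh := hn.shareFacet hn' (𝒯.disjoint K hK K' hK' hne)
    right
    rcases 𝒯.facet_orient K hK K' hK' hne hsh with h | h
    · exact ⟨(K, K'), h.1, ⟨hn.self_mem, hn'.self_mem⟩,
        fun F hF hxF => huniq _ h.1 F hF ⟨hn.self_mem, hn'.self_mem⟩ hxF,
        fun L hL hLf => hthree K hK K' hK' L hL hf hf' hLf hne⟩
    · exact ⟨(K', K), h.1, ⟨hn'.self_mem, hn.self_mem⟩,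
        fun F hF hxF => huniq _ h.1 F hF ⟨hn'.self_mem, hn.self_mem⟩ hxF,
        fun L hL hLf => (hthree K hK K' hK' L hL hf hf' hLf hne).symm⟩

/-! ### Integrals over the domain and over the skeleton -/

theorem volume_restrict_domain :
    (volume : Measure (Euc d)).restrict Ω = ∑ K ∈ 𝒯.cells, volume.restrict K := by
  have hnull : ∀ K ∈ 𝒯.cells, volume (frontier K) = 0 := fun K hK => by
    obtain ⟨S, hS⟩ := (𝒯.polytope K hK).exists_isHalfSpaceRep
    exact hS.convex.addHaar_frontier volume
  have h1 : (Ω : Set (Euc d)) =ᵐ[volume] ⋃ K : 𝒯.cells, (K : Set (Euc d)) := by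
    have hae : ∀ᵐ x : Euc d, ∀ K ∈ 𝒯.cells, x ∉ frontier K :=
      (Finset.eventually_all 𝒯.cells).2 fun K hK => measure_eq_zero_iff_ae_notMem.1 (hnull K hK)
    filter_upwards [hae] with x hx
    apply propext
    change x ∈ Ω ↔ x ∈ ⋃ K : 𝒯.cells, (K : Set (Euc d))
    constructor
    · intro hxΩ
      rw [𝒯.cover] at hxΩ
      have := interior_subset hxΩ
      simpa using this
    · intro hxU
      obtain ⟨K, hxK⟩ := Set.mem_iUnion.1 hxU
      refine 𝒯.interior_subset_domain K.2 ?_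
      by_contra hc
      exact hx K K.2 ⟨subset_closure hxK, hc⟩
  rw [Measure.restrict_congr_set h1, Measure.restrict_iUnion_ae, Measure.sum_fintype]
  · exact Finset.sum_coe_sort 𝒯.cells fun K => (volume : Measure (Euc d)).restrict K
  · intro K K' hne
    exact measure_mono_null (𝒯.inter_subset_frontier K.2 K'.2 fun e => hne (Subtype.ext e))
      (hnull K K.2)
  · exact fun K => (𝒯.isClosed_of_mem K.2).measurableSet.nullMeasurableSet

theorem restrict_cell_le {K : Set (Euc d)} (hK : K ∈ 𝒯.cells) :
    (volume : Measure (Euc d)).restrict K ≤ volume.restrict Ω := by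
  rw [𝒯.volume_restrict_domain]
  refine Measure.le_intro fun s _ _ => ?_
  rw [Measure.finsetSum_apply]
  exact Finset.single_le_sum (f := fun K => (volume : Measure (Euc d)).restrict K s)
    (fun _ _ => zero_le) hK

theorem integral_domain {f : Euc d → ℝ} (hf : IntegrableOn f Ω) :
    ∫ x in Ω, f x = ∑ K ∈ 𝒯.cells, ∫ x in K, f x := by
  have hf' := hf
  rw [IntegrableOn, 𝒯.volume_restrict_domain] at hf'
  rw [𝒯.volume_restrict_domain, integral_finsetSum_measure (integrable_finsetSum_measure.1 hf')]

theorem integral_bdry_eq {K : Set (Euc d)} (f : Euc d → ℝ) :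
    ∫ x, f x ∂(bdryMeasure K) = ∫ x, (frontier K).indicator f x ∂μHE[d - 1] :=
  (integral_indicator isClosed_frontier.measurableSet).symm

theorem measurableSet_facet {F : Set (Euc d) × Set (Euc d)} (hF : F ∈ 𝒯.intFacets) :
    MeasurableSet (F.1 ∩ F.2) := by
  obtain ⟨m1, m2, _⟩ := 𝒯.facet_mem F hF
  exact (𝒯.isClosed_of_mem m1).measurableSet.inter (𝒯.isClosed_of_mem m2).measurableSet

theorem facetMeasure_le {F : Set (Euc d) × Set (Euc d)} (hF : F ∈ 𝒯.intFacets) :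
    facetMeasure F ≤ bdryMeasure F.1 ∧ facetMeasure F ≤ bdryMeasure F.2 :=
  ⟨Measure.restrict_mono (𝒯.facet_subset_frontier hF).1 le_rfl,
    Measure.restrict_mono (𝒯.facet_subset_frontier hF).2 le_rfl⟩

theorem sum_integral_bdry {a : Set (Euc d) → Euc d → ℝ}
    (ha : ∀ K ∈ 𝒯.cells, Integrable (a K) (bdryMeasure K)) :
    ∑ K ∈ 𝒯.cells, ∫ x, a K x ∂(bdryMeasure K) =
        ∫ x, ∑ K ∈ 𝒯.cells, (frontier K).indicator (a K) x ∂μHE[d - 1] ∧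
      Integrable (fun x => ∑ K ∈ 𝒯.cells, (frontier K).indicator (a K) x) (μHE[d - 1]) := by
  have h1 : ∀ K ∈ 𝒯.cells, Integrable ((frontier K).indicator (a K)) (μHE[d - 1]) := fun K hK =>
    (integrable_indicator_iff isClosed_frontier.measurableSet).2 (ha K hK)
  refine ⟨?_, integrable_finsetSum _ h1⟩
  rw [integral_finsetSum _ h1]
  exact Finset.sum_congr rfl fun K _ => integral_bdry_eq _

theorem sum_integral_facet {r : Set (Euc d) × Set (Euc d) → Euc d → ℝ}
    (hr : ∀ F ∈ 𝒯.intFacets, Integrable (r F) (facetMeasure F)) :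
    ∑ F ∈ 𝒯.intFacets, ∫ x, r F x ∂(facetMeasure F) =
        ∫ x, ∑ F ∈ 𝒯.intFacets, (F.1 ∩ F.2).indicator (r F) x ∂μHE[d - 1] ∧
      Integrable (fun x => ∑ F ∈ 𝒯.intFacets, (F.1 ∩ F.2).indicator (r F) x) (μHE[d - 1]) := by
  have h1 : ∀ F ∈ 𝒯.intFacets, Integrable ((F.1 ∩ F.2).indicator (r F)) (μHE[d - 1]) :=
    fun F hF => (integrable_indicator_iff (𝒯.measurableSet_facet hF)).2 (hr F hF)
  refine ⟨?_, integrable_finsetSum _ h1⟩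
  rw [integral_finsetSum _ h1]
  exact Finset.sum_congr rfl fun F hF => (integral_indicator (𝒯.measurableSet_facet hF)).symm

/-- The dichotomy of `ae_skeleton` for sums: at almost every point, a sum over the element boundaries
has at most two terms, and a sum over the interior facets has one term if the former has two, and none
otherwise. -/
theorem ae_skeleton_sum :
    ∀ᵐ x ∂(μHE[d - 1] : Measure (Euc d)),
      ((∀ r : Set (Euc d) × Set (Euc d) → Euc d → ℝ,
          ∑ F ∈ 𝒯.intFacets, (F.1 ∩ F.2).indicator (r F) x = 0) ∧
        ((∀ a : Set (Euc d) → Euc d → ℝ, ∑ K ∈ 𝒯.cells, (frontier K).indicator (a K) x = 0) ∨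
          ∃ K ∈ 𝒯.cells, x ∈ frontier K ∧ ∀ a : Set (Euc d) → Euc d → ℝ,
            ∑ K ∈ 𝒯.cells, (frontier K).indicator (a K) x = a K x)) ∨
      ∃ F ∈ 𝒯.intFacets, x ∈ F.1 ∩ F.2 ∧
        (∀ r : Set (Euc d) × Set (Euc d) → Euc d → ℝ,
          ∑ F ∈ 𝒯.intFacets, (F.1 ∩ F.2).indicator (r F) x = r F x) ∧
        ∀ a : Set (Euc d) → Euc d → ℝ,
          ∑ K ∈ 𝒯.cells, (frontier K).indicator (a K) x = a F.1 x + a F.2 x := by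
  classical
  filter_upwards [𝒯.ae_skeleton] with x hx
  rcases hx with ⟨hno, hone⟩ | ⟨F, hF, hxF, huniq, hcell⟩
  · refine Or.inl ⟨fun r => Finset.sum_eq_zero fun F hF =>
      Set.indicator_of_notMem (hno F hF) _, ?_⟩
    by_cases hex : ∃ K ∈ 𝒯.cells, x ∈ frontier K
    · obtain ⟨K, hK, hxK⟩ := hex
      refine Or.inr ⟨K, hK, hxK, fun a => ?_⟩
      rw [Finset.sum_eq_single_of_mem K hK fun L hL hne =>
        Set.indicator_of_notMem (fun hxL => hne (hone L hL K hK hxL hxK)) _,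
        Set.indicator_of_mem hxK]
    · push Not at hex
      exact Or.inl fun a => Finset.sum_eq_zero fun L hL => Set.indicator_of_notMem (hex L hL) _
  · obtain ⟨m1, m2, hne, _⟩ := 𝒯.facet_mem F hF
    have f1 := (𝒯.facet_subset_frontier hF).1 hxF
    have f2 := (𝒯.facet_subset_frontier hF).2 hxF
    refine Or.inr ⟨F, hF, hxF, fun r => ?_, fun a => ?_⟩
    · rw [Finset.sum_eq_single_of_mem F hF fun G hG hne' =>
        Set.indicator_of_notMem (fun hxG => hne' (huniq G hG hxG)) _, Set.indicator_of_mem hxF]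
    · have hsub : ({F.1, F.2} : Finset (Set (Euc d))) ⊆ 𝒯.cells := by
        intro L hL
        rcases Finset.mem_insert.1 hL with rfl | hL
        · exact m1
        · rw [Finset.mem_singleton.1 hL]; exact m2
      rw [← Finset.sum_subset hsub fun L hL hL' => Set.indicator_of_notMem (fun hxL => hL' (by
        rcases hcell L hL hxL with h | h <;> simp [h])) _, Finset.sum_pair hne,
        Set.indicator_of_mem f1, Set.indicator_of_mem f2]

end Mesh

/-! ### Elementwise regularity of the discrete and compound spaces -/

section Regularity

variable {K : Set (Euc d)} {S : Finset (Euc d × ℝ)}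

theorem MemSobolev.memLp {m : ℕ} {θ : ℝ} {w : Euc d → Euc d} (h : MemSobolev K m θ w) :
    MemLp w 2 (volume.restrict K) := by
  cases m with
  | zero => exact h.1
  | succ m => exact h.1

theorem MemH.memH1 {s : ℝ} (hs : 1 ≤ s) {w : Euc d → Euc d} (h : MemH K s w) : MemH1 K w := by
  obtain ⟨m, hm⟩ := Nat.exists_eq_add_of_le' (Nat.le_floor (n := 1) (by simpa using hs))
  rw [MemH, hm] at h
  refine ⟨h.1, fun i => ?_⟩
  obtain ⟨g, hg, hg'⟩ := h.2 i
  exact ⟨g, hg'.memLp, hg⟩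

theorem hasWeakPartial_congr {i : Fin d} {v p : Euc d → Euc d} (h : v =ᵐ[volume.restrict K] p) :
    HasWeakPartial K i v = HasWeakPartial K i p := by
  funext g
  apply propext
  have e : ∀ φ : Euc d → ℝ, ∫ x in K, (fderiv ℝ φ x (stdVec i)) • v x =
      ∫ x in K, (fderiv ℝ φ x (stdVec i)) • p x := fun φ =>
    integral_congr_ae (h.mono fun x hx => by simp only [hx])
  simp only [HasWeakPartial, e]

/-- `weakPartial` is chosen from a predicate that only depends on the class of the function almost
everywhere, so the chosen functions are the same. -/
theorem h1Semi_congr {v p : Euc d → Euc d} (h : v =ᵐ[volume.restrict K] p) :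
    h1Semi K v = h1Semi K p := by
  have e : ∀ i, weakPartial K i v = weakPartial K i p := fun i => by
    unfold weakPartial
    rw [hasWeakPartial_congr h]
  simp only [h1Semi, e]

theorem l2Norm_congr {v p : Euc d → Euc d} (h : v =ᵐ[volume.restrict K] p) :
    l2Norm K v = l2Norm K p := by
  have e : ∫ x in K, ‖v x‖ ^ 2 = ∫ x in K, ‖p x‖ ^ 2 :=
    integral_congr_ae (h.mono fun x hx => by simp only [hx])
  rw [l2Norm, l2Norm, e]

theorem MemH1.congr {v p : Euc d → Euc d} (hp : MemH1 K p) (h : v =ᵐ[volume.restrict K] p) :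
    MemH1 K v :=
  ⟨hp.1.ae_eq h.symm, fun i => by simpa only [hasWeakPartial_congr h] using hp.2 i⟩

theorem MemH1.add (hK : IsHalfSpaceRep K S) {v u : Euc d → Euc d} (hv : MemH1 K v)
    (hu : MemH1 K u) : MemH1 K (v + u) := by
  have hfin : IsFiniteMeasure (volume.restrict K) := ⟨by simpa using hK.isCompact.measure_lt_top⟩
  refine ⟨hv.1.add hu.1, fun i => ?_⟩
  obtain ⟨g, hg, hg'⟩ := hv.2 i
  obtain ⟨k, hk, hk'⟩ := hu.2 i
  refine ⟨g + k, hg.add hk, fun φ hφ hc hs => ?_⟩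
  have hint : ∀ {c : Euc d → ℝ}, Continuous c → ∀ {f : Euc d → Euc d},
      MemLp f 2 (volume.restrict K) → Integrable (fun x => c x • f x) (volume.restrict K) := by
    intro c hc f hf
    obtain ⟨M, hM⟩ := hK.isCompact.exists_bound_of_continuousOn hc.continuousOn
    refine (memLp_smul_of_bound hf hc.aestronglyMeasurable (B := M) ?_).integrable one_le_two
    filter_upwards [ae_restrict_mem hK.isClosed.measurableSet] with x hx using hM x hx
  have hD : Continuous fun x => fderiv ℝ φ x (stdVec i) :=
    (hφ.continuous_fderiv (by simp)).clm_apply continuous_const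
  simp only [Pi.add_apply, smul_add]
  rw [integral_add (hint hD hv.1) (hint hD hu.1),
    integral_add (hint hφ.continuous hg) (hint hφ.continuous hk), hg' φ hφ hc hs, hk' φ hφ hc hs,
    neg_add]

theorem memH1_of_mem_discreteSpace {Ω : Set (Euc d)} {𝒯 : Mesh Ω}
    {Vloc : Set (Euc d) → Submodule ℝ (Euc d → Euc d)}
    (hVloc : ∀ K ∈ 𝒯.cells, ∀ p ∈ Vloc K, MemH K 1 p) {v : Euc d → Euc d}
    (hv : v ∈ discreteSpace 𝒯 Vloc) (hK : K ∈ 𝒯.cells) : MemH1 K v := by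
  obtain ⟨p, hp, hvp⟩ := hv.2 K hK
  exact ((hVloc K hK p hp).memH1 le_rfl).congr hvp

theorem memH1_of_mem_compoundSpace {Ω : Set (Euc d)} {𝒯 : Mesh Ω}
    {Vloc : Set (Euc d) → Submodule ℝ (Euc d → Euc d)}
    (hVloc : ∀ K ∈ 𝒯.cells, ∀ p ∈ Vloc K, MemH K 1 p) {ε : ℝ} (hε : 0 < ε) {w : Euc d → Euc d}
    (hw : w ∈ compoundSpace 𝒯 Vloc ε) (hK : K ∈ 𝒯.cells) : MemH1 K w := by
  obtain ⟨v, hv, u, hu, rfl⟩ := hw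
  obtain ⟨S, hS⟩ := (𝒯.polytope K hK).exists_isHalfSpaceRep
  exact (memH1_of_mem_discreteSpace hVloc hv hK).add hS
    ((hu.2.2 K hK).memH1 (by linarith))

end Regularity

/-! ### Conservation of the flux across the skeleton -/

/-- `b` is a measurable divergence-free field on `Ω` with `|b| ≤ B` and vanishing normal trace. -/
structure IsSolenoidal (Ω : Set (Euc d)) (B : ℝ) (b : Euc d → Euc d) : Prop where
  meas : AEStronglyMeasurable b (volume.restrict Ω)
  bound : ∀ᵐ x ∂volume.restrict Ω, ‖b x‖ ≤ B
  divFree : HasWeakDiv Ω b 0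
  noPenetration : HasNormalTrace Ω b 0 0

namespace Mesh

variable {Ω : Set (Euc d)} {𝒯 : Mesh Ω} {B : ℝ} {b : Euc d → Euc d} {K : Set (Euc d)}

theorem meas_cell (hb : IsSolenoidal Ω B b) (hK : K ∈ 𝒯.cells) :
    AEStronglyMeasurable b (volume.restrict K) :=
  hb.meas.mono_measure (𝒯.restrict_cell_le hK)

theorem bound_cell (hb : IsSolenoidal Ω B b) (hK : K ∈ 𝒯.cells) :
    ∀ᵐ x ∂volume.restrict K, ‖b x‖ ≤ B :=
  ae_mono (𝒯.restrict_cell_le hK) hb.bound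

theorem hasWeakDiv_cell (hb : IsSolenoidal Ω B b) (hK : K ∈ 𝒯.cells) : HasWeakDiv K b 0 := by
  intro φ hφ hc hs
  have hΩ : interior Ω = Ω := by
    have h := 𝒯.cover
    rw [h, interior_interior]
  have hsub := 𝒯.interior_subset_domain hK
  have e : ∀ A : Set (Euc d), interior K ⊆ A →
      ∫ x in A, fderiv ℝ φ x (b x) = ∫ x, fderiv ℝ φ x (b x) := fun A hA =>
    setIntegral_eq_integral_of_forall_compl_eq_zero fun x hx => by
      have : fderiv ℝ φ x = 0 := by
        by_contra hne
        exact hx (hA (hs (support_fderiv_subset ℝ hne)))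
      rw [this]; rfl
  have h1 := hb.divFree φ hφ hc (by rw [hΩ]; exact hs.trans hsub)
  rw [e Ω hsub] at h1
  rw [e K interior_subset, h1]
  simp

theorem normalTrace_cell (hb : IsSolenoidal Ω B b) (hK : K ∈ 𝒯.cells) :
    MemLp (normalTrace K b) ⊤ (bdryMeasure K) ∧ (∀ᵐ x ∂bdryMeasure K, |normalTrace K b x| ≤ B) ∧
      HasNormalTrace K b 0 (normalTrace K b) := by
  obtain ⟨S, hS⟩ := (𝒯.polytope K hK).exists_isHalfSpaceRep
  exact hS.normalTrace_spec (meas_cell hb hK) (bound_cell hb hK) (hasWeakDiv_cell hb hK)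

/-- The outer normal fluxes of the elements cancel on interior facets and vanish on `∂Ω`. -/
theorem ae_sum_normalTrace_eq_zero (hb : IsSolenoidal Ω B b) :
    ∀ᵐ x ∂(μHE[d - 1] : Measure (Euc d)),
      ∑ K ∈ 𝒯.cells, (frontier K).indicator (normalTrace K b) x = 0 := by
  have hint : ∀ K ∈ 𝒯.cells, Integrable (normalTrace K b) (bdryMeasure K) := fun K hK => by
    obtain ⟨S, hS⟩ := (𝒯.polytope K hK).exists_isHalfSpaceRep
    have := hS.isFiniteMeasure_bdryMeasure
    exact (normalTrace_cell hb hK).1.integrable le_top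
  refine ae_eq_zero_of_integral_contDiff_smul_eq_zero
    (𝒯.sum_integral_bdry hint).2.locallyIntegrable fun φ hφ hc => ?_
  obtain ⟨M, hM⟩ := hc.exists_bound_of_continuous hφ.continuous
  have hint' : ∀ K ∈ 𝒯.cells, Integrable (fun x => normalTrace K b x * φ x) (bdryMeasure K) :=
    fun K hK => (hint K hK).mul_bdd (c := M) hφ.continuous.aestronglyMeasurable
      (Eventually.of_forall hM)
  have hD : ∀ K ∈ 𝒯.cells, IntegrableOn (fun x => fderiv ℝ φ x (b x)) K := fun K hK => by
    obtain ⟨S, hS⟩ := (𝒯.polytope K hK).exists_isHalfSpaceRep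
    exact integrableOn_clm_apply hS.isCompact (meas_cell hb hK) (bound_cell hb hK)
      (hφ.continuous_fderiv (by simp))
  have hDΩ : IntegrableOn (fun x => fderiv ℝ φ x (b x)) Ω := by
    rw [IntegrableOn, 𝒯.volume_restrict_domain]
    exact integrable_finsetSum_measure.2 hD
  have h1 := hb.noPenetration φ hφ hc
  simp only [Pi.zero_apply, zero_mul, integral_zero, add_zero] at h1
  have h2 := (𝒯.sum_integral_bdry hint').1
  calc ∫ x, φ x • ∑ K ∈ 𝒯.cells, (frontier K).indicator (normalTrace K b) x ∂μHE[d - 1]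
      = ∫ x, ∑ K ∈ 𝒯.cells, (frontier K).indicator (fun x => normalTrace K b x * φ x) x
          ∂μHE[d - 1] := by
        refine integral_congr_ae (Eventually.of_forall fun x => ?_)
        simp only [smul_eq_mul, Finset.mul_sum]
        refine Finset.sum_congr rfl fun K _ => ?_
        by_cases hx : x ∈ frontier K
        · simp only [Set.indicator_of_mem hx, mul_comm]
        · simp only [Set.indicator_of_notMem hx, mul_zero]
    _ = ∑ K ∈ 𝒯.cells, ∫ x in K, fderiv ℝ φ x (b x) := by
        rw [← h2]
        refine Finset.sum_congr rfl fun K hK => ?_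
        rw [← (normalTrace_cell hb hK).2.2 φ hφ hc]
        simp
    _ = 0 := by rw [← 𝒯.integral_domain hDΩ, h1]

/-- A sum of boundary fluxes of an elementwise quantity `s` is a sum over the interior facets of the
flux of its jump. -/
theorem sum_flux_eq (hb : IsSolenoidal Ω B b) {s : Set (Euc d) → Euc d → ℝ}
    (hs : ∀ K ∈ 𝒯.cells, Integrable (fun x => normalTrace K b x * s K x) (bdryMeasure K))
    (hs' : ∀ F ∈ 𝒯.intFacets,
      Integrable (fun x => facetFlux F b x * (s F.1 x - s F.2 x)) (facetMeasure F)) :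
    ∑ K ∈ 𝒯.cells, ∫ x, normalTrace K b x * s K x ∂(bdryMeasure K) =
      ∑ F ∈ 𝒯.intFacets, ∫ x, facetFlux F b x * (s F.1 x - s F.2 x) ∂(facetMeasure F) := by
  rw [(𝒯.sum_integral_bdry hs).1, (𝒯.sum_integral_facet hs').1]
  refine integral_congr_ae ?_
  filter_upwards [𝒯.ae_skeleton_sum, ae_sum_normalTrace_eq_zero hb] with x hx h0
  rcases hx with ⟨hr, ha | ⟨K, hK, _, ha⟩⟩ | ⟨F, hF, _, hr, ha⟩
  · rw [hr, ha]
  · rw [ha fun K => normalTrace K b] at h0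
    rw [hr, ha fun K x => normalTrace K b x * s K x, h0, zero_mul]
  · rw [ha fun K => normalTrace K b] at h0
    rw [hr, ha fun K x => normalTrace K b x * s K x, facetFlux, eq_neg_of_add_eq_zero_right h0]
    ring

/-- The interior facets, counted from both sides, are part of the element boundaries. -/
theorem sum_facet_le {s : Set (Euc d) → Euc d → ℝ}
    (hs : ∀ K ∈ 𝒯.cells, Integrable (s K) (bdryMeasure K)) (hs0 : ∀ K x, 0 ≤ s K x) :
    ∑ F ∈ 𝒯.intFacets, ∫ x, (s F.1 x + s F.2 x) ∂(facetMeasure F) ≤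
      ∑ K ∈ 𝒯.cells, ∫ x, s K x ∂(bdryMeasure K) := by
  have hs' : ∀ F ∈ 𝒯.intFacets, Integrable (fun x => s F.1 x + s F.2 x) (facetMeasure F) :=
    fun F hF => ((hs F.1 (𝒯.facet_mem F hF).1).mono_measure (𝒯.facetMeasure_le hF).1).add
      ((hs F.2 (𝒯.facet_mem F hF).2.1).mono_measure (𝒯.facetMeasure_le hF).2)
  rw [(𝒯.sum_integral_bdry hs).1, (𝒯.sum_integral_facet hs').1]
  refine integral_mono_ae (𝒯.sum_integral_facet hs').2 (𝒯.sum_integral_bdry hs).2 ?_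
  filter_upwards [𝒯.ae_skeleton_sum] with x hx
  rcases hx with ⟨hr, ha | ⟨K, hK, _, ha⟩⟩ | ⟨F, hF, _, hr, ha⟩
  · rw [hr, ha]
  · rw [hr, ha]
    exact hs0 K x
  · rw [hr fun F x => s F.1 x + s F.2 x, ha]

end Mesh

/-! ### The estimates -/

/-- Young's inequality, optimised over the weight: `s = P / η` if `P > 0`, and `s → 0` if `P = 0`. -/
theorem le_add_of_forall_weight {X W P V η : ℝ} (hW : 0 ≤ W) (hP : 0 ≤ P) (hV : 0 ≤ V) (hη : 0 < η)
    (h : ∀ s : ℝ, 0 < s → X ≤ s / 2 * W + P * V / (2 * s)) :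
    X ≤ P / (2 * η) * W + η / 2 * V := by
  rcases hP.eq_or_lt with rfl | hP
  · have h0 : X ≤ 0 := by
      by_contra! hX
      have h1 := h (X / (W + 1)) (by positivity)
      have h2 : X / (W + 1) * W ≤ X := by
        rw [div_mul_eq_mul_div, div_le_iff₀ (by positivity)]
        nlinarith
      simp only [zero_mul, zero_div, add_zero] at h1
      linarith
    have : 0 ≤ η / 2 * V := by positivity
    simpa using h0.trans this
  · refine (h (P / η) (by positivity)).trans_eq ?_
    field_simp

theorem l2Norm_sq (K : Set (Euc d)) (w : Euc d → Euc d) :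
    l2Norm K w ^ 2 = ∫ x in K, ‖w x‖ ^ 2 :=
  Real.sq_sqrt (integral_nonneg fun _ => by positivity)

section Element

variable {K : Set (Euc d)} {S : Finset (Euc d × ℝ)} {b : Euc d → Euc d} {B : ℝ}

/-- The elementwise convection term, with the derivative on a function that satisfies an inverse
inequality with constant `c`. -/
theorem abs_sum_integral_weakPartial_le (hb : AEStronglyMeasurable b (volume.restrict K))
    (hB : ∀ᵐ x ∂volume.restrict K, ‖b x‖ ≤ B) {w v : Euc d → Euc d} (hw : MemLp w 2 (volume.restrict K))
    (hv : MemH1 K v) {c : ℝ} (hinv : h1Semi K v ≤ c * l2Norm K v) {η : ℝ} (hη : 0 < η) :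
    |∑ i, ∫ x in K, b x i * ⟪w x, weakPartial K i v x⟫| ≤
      (B * c) ^ 2 / (2 * η) * l2Norm K w ^ 2 + η / 2 * l2Norm K v ^ 2 := by
  have hBi : ∀ i, ∀ᵐ x ∂volume.restrict K, |b x i| ≤ B := fun i => by
    filter_upwards [hB] with x hx using (abs_apply_le_norm _ _).trans hx
  have hD : ∀ i, MemLp (weakPartial K i v) 2 (volume.restrict K) := fun i =>
    (weakPartial_spec (hv.2 i)).1
  have hi : ∀ i ∈ Finset.univ, Integrable (fun x => b x i * ⟪w x, weakPartial K i v x⟫)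
      (volume.restrict K) := fun i _ =>
    integrable_mul_inner hw (hD i) (aestronglyMeasurable_apply hb i) (hBi i)
  have hDi : ∀ i ∈ Finset.univ, Integrable (fun x => ‖weakPartial K i v x‖ ^ 2)
      (volume.restrict K) := fun i _ => (hD i).integrable_norm_pow two_ne_zero
  have hwi : Integrable (fun x => ‖w x‖ ^ 2) (volume.restrict K) :=
    hw.integrable_norm_pow two_ne_zero
  have hsemi : h1Semi K v ^ 2 = ∫ x in K, ∑ i, ‖weakPartial K i v x‖ ^ 2 := by
    rw [integral_finsetSum _ hDi, h1Semi, Real.sq_sqrt]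
    exact Finset.sum_nonneg fun i _ => integral_nonneg fun _ => by positivity
  have hsq : h1Semi K v ^ 2 ≤ c ^ 2 * l2Norm K v ^ 2 := by
    rw [← mul_pow]
    exact pow_le_pow_left₀ (Real.sqrt_nonneg _) hinv 2
  refine le_add_of_forall_weight (by positivity) (by positivity) (by positivity) hη fun s hs => ?_
  calc |∑ i, ∫ x in K, b x i * ⟪w x, weakPartial K i v x⟫|
      = |∫ x in K, ∑ i, b x i * ⟪w x, weakPartial K i v x⟫| := by rw [integral_finsetSum _ hi]
    _ ≤ ∫ x in K, |∑ i, b x i * ⟪w x, weakPartial K i v x⟫| := abs_integral_le_integral_abs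
    _ ≤ ∫ x in K, (s / 2 * ‖w x‖ ^ 2 + B ^ 2 / (2 * s) * ∑ i, ‖weakPartial K i v x‖ ^ 2) := by
        refine integral_mono_ae (integrable_finsetSum _ hi).abs
          ((hwi.const_mul _).add ((integrable_finsetSum _ hDi).const_mul _)) ?_
        filter_upwards [hB] with x hx
        have e : ∑ i, b x i * ⟪w x, weakPartial K i v x⟫ = ⟪w x, ∑ i, b x i • weakPartial K i v x⟫ := by
          rw [inner_sum]
          simp only [real_inner_smul_right]
        have h1 := norm_sum_smul_sq_le (b x) fun i => weakPartial K i v x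
        have h2 := abs_real_inner_le_norm (w x) (∑ i, b x i • weakPartial K i v x)
        set D := ∑ i, ‖weakPartial K i v x‖ ^ 2
        have hD0 : 0 ≤ D := Finset.sum_nonneg fun _ _ => by positivity
        set y := ‖∑ i, b x i • weakPartial K i v x‖
        have h3 : y ^ 2 ≤ B ^ 2 * D :=
          h1.trans (mul_le_mul_of_nonneg_right (pow_le_pow_left₀ (norm_nonneg _) hx 2) hD0)
        rw [e]
        refine h2.trans ?_
        have h4 : s / 2 * ‖w x‖ ^ 2 + B ^ 2 / (2 * s) * D - ‖w x‖ * y =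
            ((s * ‖w x‖ - y) ^ 2 + (B ^ 2 * D - y ^ 2)) / (2 * s) := by
          field_simp
          ring
        have h5 : 0 ≤ ((s * ‖w x‖ - y) ^ 2 + (B ^ 2 * D - y ^ 2)) / (2 * s) :=
          div_nonneg (add_nonneg (sq_nonneg _) (sub_nonneg.2 h3)) (by positivity)
        linarith
    _ = s / 2 * l2Norm K w ^ 2 + B ^ 2 / (2 * s) * h1Semi K v ^ 2 := by
        rw [integral_add (hwi.const_mul _) ((integrable_finsetSum _ hDi).const_mul _),
          integral_const_mul, integral_const_mul, hsemi, l2Norm_sq]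
    _ ≤ s / 2 * l2Norm K w ^ 2 + (B * c) ^ 2 * l2Norm K v ^ 2 / (2 * s) := by
        have h1 : B ^ 2 / (2 * s) * h1Semi K v ^ 2 ≤ B ^ 2 / (2 * s) * (c ^ 2 * l2Norm K v ^ 2) :=
          mul_le_mul_of_nonneg_left hsq (by positivity)
        refine (add_le_add_right h1 _).trans_eq ?_
        ring

end Element

namespace Mesh

variable {Ω : Set (Euc d)} {𝒯 : Mesh Ω} {B γ : ℝ} {b w v : Euc d → Euc d} {K : Set (Euc d)}

theorem memLp_trace (hw : ∀ K ∈ 𝒯.cells, MemH1 K w) (hK : K ∈ 𝒯.cells) :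
    MemLp (trace K w) 2 (bdryMeasure K) := by
  obtain ⟨S, hS⟩ := (𝒯.polytope K hK).exists_isHalfSpaceRep
  exact (isTrace_trace (hS.exists_isTrace (hw K hK).1 (hw K hK).2)).1

theorem memLp_trace_facet (hw : ∀ K ∈ 𝒯.cells, MemH1 K w) {F : Set (Euc d) × Set (Euc d)}
    (hF : F ∈ 𝒯.intFacets) :
    MemLp (trace F.1 w) 2 (facetMeasure F) ∧ MemLp (trace F.2 w) 2 (facetMeasure F) :=
  ⟨(memLp_trace hw (𝒯.facet_mem F hF).1).mono_measure (𝒯.facetMeasure_le hF).1,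
    (memLp_trace hw (𝒯.facet_mem F hF).2.1).mono_measure (𝒯.facetMeasure_le hF).2⟩

theorem memLp_jump (hw : ∀ K ∈ 𝒯.cells, MemH1 K w) {F : Set (Euc d) × Set (Euc d)}
    (hF : F ∈ 𝒯.intFacets) : MemLp (jump F w) 2 (facetMeasure F) :=
  (memLp_trace_facet hw hF).1.sub (memLp_trace_facet hw hF).2

theorem memLp_avg (hw : ∀ K ∈ 𝒯.cells, MemH1 K w) {F : Set (Euc d) × Set (Euc d)}
    (hF : F ∈ 𝒯.intFacets) : MemLp (avg F w) 2 (facetMeasure F) :=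
  ((memLp_trace_facet hw hF).1.add (memLp_trace_facet hw hF).2).const_smul (1 / 2 : ℝ)

theorem facetFlux_spec (hb : IsSolenoidal Ω B b) {F : Set (Euc d) × Set (Euc d)}
    (hF : F ∈ 𝒯.intFacets) : AEStronglyMeasurable (facetFlux F b) (facetMeasure F) ∧
      ∀ᵐ x ∂facetMeasure F, |facetFlux F b x| ≤ B := by
  obtain ⟨h1, h2, _⟩ := normalTrace_cell hb (𝒯.facet_mem F hF).1
  exact ⟨h1.aestronglyMeasurable.mono_measure (𝒯.facetMeasure_le hF).1,
    ae_mono (𝒯.facetMeasure_le hF).1 h2⟩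

theorem inner_sub_inner_eq (F : Set (Euc d) × Set (Euc d)) (w v : Euc d → Euc d) (x : Euc d) :
    ⟪trace F.1 w x, trace F.1 v x⟫ - ⟪trace F.2 w x, trace F.2 v x⟫ =
      ⟪jump F w x, avg F v x⟫ + ⟪avg F w x, jump F v x⟫ := by
  simp only [jump, avg, inner_sub_left, inner_sub_right, inner_add_left, inner_add_right,
    real_inner_smul_left, real_inner_smul_right]
  ring

theorem integrable_flux_inner (hb : IsSolenoidal Ω B b) {F : Set (Euc d) × Set (Euc d)}
    (hF : F ∈ 𝒯.intFacets) {f g : Euc d → Euc d} (hf : MemLp f 2 (facetMeasure F))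
    (hg : MemLp g 2 (facetMeasure F)) :
    Integrable (fun x => facetFlux F b x * ⟪f x, g x⟫) (facetMeasure F) :=
  integrable_mul_inner hf hg (facetFlux_spec hb hF).1 (facetFlux_spec hb hF).2

theorem integrable_abs_flux_inner (hb : IsSolenoidal Ω B b) (γ : ℝ)
    {F : Set (Euc d) × Set (Euc d)}
    (hF : F ∈ 𝒯.intFacets) {f g : Euc d → Euc d} (hf : MemLp f 2 (facetMeasure F))
    (hg : MemLp g 2 (facetMeasure F)) :
    Integrable (fun x => γ / 2 * |facetFlux F b x| * ⟪f x, g x⟫) (facetMeasure F) := by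
  obtain ⟨h1, h2⟩ := facetFlux_spec hb hF
  have h := integrable_mul_inner hf hg (c := fun x => |facetFlux F b x|) (B := B) h1.norm
    (by simpa only [abs_abs] using h2)
  simpa only [mul_assoc] using h.const_mul (γ / 2)

theorem integrable_abs_flux_sq (hb : IsSolenoidal Ω B b) (γ : ℝ) {F : Set (Euc d) × Set (Euc d)}
    (hF : F ∈ 𝒯.intFacets) {f : Euc d → Euc d} (hf : MemLp f 2 (facetMeasure F)) :
    Integrable (fun x => γ / 2 * |facetFlux F b x| * ‖f x‖ ^ 2) (facetMeasure F) := by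
  simpa only [real_inner_self_eq_norm_sq] using integrable_abs_flux_inner hb γ hF hf hf

/-- Integration by parts: since the normal fluxes are conserved, only the jump of the test function
against the average of `w` remains on the facets. -/
theorem convForm_eq (hb : IsSolenoidal Ω B b) (γ : ℝ) (hw : ∀ K ∈ 𝒯.cells, MemH1 K w)
    (hv : ∀ K ∈ 𝒯.cells, MemH1 K v) :
    convForm 𝒯 γ b w v =
      -(∑ K ∈ 𝒯.cells, ∑ i, ∫ x in K, b x i * ⟪w x, weakPartial K i v x⟫) +
      ∑ F ∈ 𝒯.intFacets, ∫ x, (facetFlux F b x * ⟪avg F w x, jump F v x⟫ +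
        γ / 2 * |facetFlux F b x| * ⟪jump F w x, jump F v x⟫) ∂(facetMeasure F) := by
  have e1 : ∀ K ∈ 𝒯.cells, ∫ x in K, ⟪∑ i, b x i • weakPartial K i w x, v x⟫ =
      ∫ x, normalTrace K b x * ⟪trace K w x, trace K v x⟫ ∂(bdryMeasure K) -
        ∑ i, ∫ x in K, b x i * ⟪w x, weakPartial K i v x⟫ := by
    intro K hK
    obtain ⟨S, hS⟩ := (𝒯.polytope K hK).exists_isHalfSpaceRep
    rw [← hS.green (meas_cell hb hK) (bound_cell hb hK) (hasWeakDiv_cell hb hK) (hw K hK) (hv K hK),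
      add_sub_cancel_right, ← integral_finsetSum]
    · simp only [sum_inner, real_inner_smul_left]
    · intro i _
      refine integrable_mul_inner (weakPartial_spec ((hw K hK).2 i)).1 (hv K hK).1
        (aestronglyMeasurable_apply (meas_cell hb hK) i) (B := B) ?_
      filter_upwards [bound_cell hb hK] with x hx using (abs_apply_le_norm _ _).trans hx
  have e2 : ∑ K ∈ 𝒯.cells, ∫ x, normalTrace K b x * ⟪trace K w x, trace K v x⟫ ∂(bdryMeasure K) =
      ∑ F ∈ 𝒯.intFacets, ∫ x, facetFlux F b x *
        (⟪trace F.1 w x, trace F.1 v x⟫ - ⟪trace F.2 w x, trace F.2 v x⟫) ∂(facetMeasure F) := by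
    refine sum_flux_eq hb (s := fun K x => ⟪trace K w x, trace K v x⟫) (fun K hK => ?_)
      fun F hF => ?_
    · obtain ⟨h1, h2, _⟩ := normalTrace_cell hb hK
      exact integrable_mul_inner (memLp_trace hw hK) (memLp_trace hv hK) h1.aestronglyMeasurable h2
    · simp only [inner_sub_inner_eq, mul_add]
      exact (integrable_flux_inner hb hF (memLp_jump hw hF) (memLp_avg hv hF)).add
        (integrable_flux_inner hb hF (memLp_avg hw hF) (memLp_jump hv hF))
  have e3 : ∀ F ∈ 𝒯.intFacets, ∫ x, facetFlux F b x *
        (⟪trace F.1 w x, trace F.1 v x⟫ - ⟪trace F.2 w x, trace F.2 v x⟫) ∂(facetMeasure F) =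
      ∫ x, facetFlux F b x * ⟪jump F w x, avg F v x⟫ ∂(facetMeasure F) +
        ∫ x, facetFlux F b x * ⟪avg F w x, jump F v x⟫ ∂(facetMeasure F) := by
    intro F hF
    simp only [inner_sub_inner_eq, mul_add]
    exact integral_add (integrable_flux_inner hb hF (memLp_jump hw hF) (memLp_avg hv hF))
      (integrable_flux_inner hb hF (memLp_avg hw hF) (memLp_jump hv hF))
  have e4 : ∀ F ∈ 𝒯.intFacets, ∫ x, (facetFlux F b x * ⟪avg F w x, jump F v x⟫ +
        γ / 2 * |facetFlux F b x| * ⟪jump F w x, jump F v x⟫) ∂(facetMeasure F) =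
      ∫ x, facetFlux F b x * ⟪avg F w x, jump F v x⟫ ∂(facetMeasure F) +
        ∫ x, γ / 2 * |facetFlux F b x| * ⟪jump F w x, jump F v x⟫ ∂(facetMeasure F) := fun F hF =>
    integral_add (integrable_flux_inner hb hF (memLp_avg hw hF) (memLp_jump hv hF))
      (integrable_abs_flux_inner hb γ hF (memLp_jump hw hF) (memLp_jump hv hF))
  rw [convForm, Finset.sum_congr rfl e1, Finset.sum_sub_distrib, e2, Finset.sum_congr rfl e3,
    Finset.sum_congr rfl e4, Finset.sum_add_distrib, Finset.sum_add_distrib]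
  ring

/-- The pointwise form of the facet estimate; `p`, `m` are the one-sided values of `w`, `g` is the
flux and `j` the jump of the test function. -/
theorem facet_young {γ η g : ℝ} (hγ : 0 < γ) (hη : 0 < η) (hg : |g| ≤ B) (p m j : Euc d) :
    |g * ⟪(1 / 2 : ℝ) • (p + m), j⟫ + γ / 2 * |g| * ⟪p - m, j⟫| ≤
      B * γ⁻¹ / (2 * η) * (‖p‖ ^ 2 + ‖m‖ ^ 2) + 1 / (2 * η) * (γ / 2 * |g| * ‖p - m‖ ^ 2) +
        η * (γ / 2 * |g| * ‖j‖ ^ 2) := by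
  set a := (1 / 2 : ℝ) • (p + m) with ha
  have hg0 := abs_nonneg g
  have hB0 := hg0.trans hg
  have hpar : ‖a‖ ^ 2 ≤ (‖p‖ ^ 2 + ‖m‖ ^ 2) / 2 := by
    have h1 := parallelogram_law_with_norm ℝ p m
    have h2 : ‖a‖ = 1 / 2 * ‖p + m‖ := by
      rw [ha, norm_smul, Real.norm_of_nonneg (by norm_num)]
    rw [h2]
    nlinarith [mul_self_nonneg ‖p - m‖]
  have h1 : |g * ⟪a, j⟫| ≤ |g| * (‖a‖ * ‖j‖) := by
    rw [abs_mul]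
    exact mul_le_mul_of_nonneg_left (abs_real_inner_le_norm a j) hg0
  have h2 : |γ / 2 * |g| * ⟪p - m, j⟫| ≤ γ / 2 * |g| * (‖p - m‖ * ‖j‖) := by
    rw [abs_mul, abs_of_nonneg (by positivity : 0 ≤ γ / 2 * |g|)]
    exact mul_le_mul_of_nonneg_left (abs_real_inner_le_norm (p - m) j) (by positivity)
  -- the weights leave one half of the upwind term of the test function to each of the two products
  have y1 : ‖a‖ * ‖j‖ ≤ γ⁻¹ / η * ‖a‖ ^ 2 + η * γ / 4 * ‖j‖ ^ 2 := by
    have e : γ⁻¹ / η * ‖a‖ ^ 2 + η * γ / 4 * ‖j‖ ^ 2 - ‖a‖ * ‖j‖ =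
        (‖a‖ - η * γ / 2 * ‖j‖) ^ 2 / (γ * η) := by
      field_simp
      ring
    have : 0 ≤ (‖a‖ - η * γ / 2 * ‖j‖) ^ 2 / (γ * η) := by positivity
    linarith
  have y2 : ‖p - m‖ * ‖j‖ ≤ 1 / (2 * η) * ‖p - m‖ ^ 2 + η / 2 * ‖j‖ ^ 2 := by
    have e : 1 / (2 * η) * ‖p - m‖ ^ 2 + η / 2 * ‖j‖ ^ 2 - ‖p - m‖ * ‖j‖ =
        (‖p - m‖ - η * ‖j‖) ^ 2 / (2 * η) := by
      field_simp
      ring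
    have : 0 ≤ (‖p - m‖ - η * ‖j‖) ^ 2 / (2 * η) := by positivity
    linarith
  have z1 := mul_le_mul_of_nonneg_left y1 hg0
  have z2 := mul_le_mul_of_nonneg_left y2 (by positivity : 0 ≤ γ / 2 * |g|)
  have z3 : |g| * (γ⁻¹ / η * ‖a‖ ^ 2) ≤ B * γ⁻¹ / (2 * η) * (‖p‖ ^ 2 + ‖m‖ ^ 2) := by
    calc |g| * (γ⁻¹ / η * ‖a‖ ^ 2) ≤ B * (γ⁻¹ / η * ((‖p‖ ^ 2 + ‖m‖ ^ 2) / 2)) := by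
          gcongr
      _ = _ := by field_simp
  refine (abs_add_le _ _).trans ?_
  linarith

/-- The facet terms of the integrated form. -/
theorem abs_sum_facet_le (hb : IsSolenoidal Ω B b) (hB : 0 ≤ B) (hγ : 0 < γ)
    (hw : ∀ K ∈ 𝒯.cells, MemH1 K w) (hv : ∀ K ∈ 𝒯.cells, MemH1 K v) {η : ℝ} (hη : 0 < η) :
    |∑ F ∈ 𝒯.intFacets, ∫ x, (facetFlux F b x * ⟪avg F w x, jump F v x⟫ +
        γ / 2 * |facetFlux F b x| * ⟪jump F w x, jump F v x⟫) ∂(facetMeasure F)| ≤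
      γ⁻¹ / (2 * η) * (B * ∑ K ∈ 𝒯.cells, ∫ x, ‖trace K w x‖ ^ 2 ∂(bdryMeasure K)) +
        1 / (2 * η) * upwSq 𝒯 γ b w + η * upwSq 𝒯 γ b v := by
  have hT : ∀ F ∈ 𝒯.intFacets,
      Integrable (fun x => ‖trace F.1 w x‖ ^ 2 + ‖trace F.2 w x‖ ^ 2) (facetMeasure F) := fun F hF =>
    ((memLp_trace_facet hw hF).1.integrable_norm_pow two_ne_zero).add
      ((memLp_trace_facet hw hF).2.integrable_norm_pow two_ne_zero)
  have hterm : ∀ F ∈ 𝒯.intFacets,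
      |∫ x, (facetFlux F b x * ⟪avg F w x, jump F v x⟫ +
        γ / 2 * |facetFlux F b x| * ⟪jump F w x, jump F v x⟫) ∂(facetMeasure F)| ≤
      B * γ⁻¹ / (2 * η) * ∫ x, (‖trace F.1 w x‖ ^ 2 + ‖trace F.2 w x‖ ^ 2) ∂(facetMeasure F) +
        1 / (2 * η) * ∫ x, γ / 2 * |facetFlux F b x| * ‖jump F w x‖ ^ 2 ∂(facetMeasure F) +
        η * ∫ x, γ / 2 * |facetFlux F b x| * ‖jump F v x‖ ^ 2 ∂(facetMeasure F) := by
    intro F hF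
    have i1 := (hT F hF).const_mul (B * γ⁻¹ / (2 * η))
    have i2 := (integrable_abs_flux_sq hb γ hF (memLp_jump hw hF)).const_mul (1 / (2 * η))
    have i3 := (integrable_abs_flux_sq hb γ hF (memLp_jump hv hF)).const_mul η
    have i12 : Integrable (fun x => B * γ⁻¹ / (2 * η) * (‖trace F.1 w x‖ ^ 2 + ‖trace F.2 w x‖ ^ 2) +
      1 / (2 * η) * (γ / 2 * |facetFlux F b x| * ‖jump F w x‖ ^ 2)) (facetMeasure F) := i1.add i2
    rw [← integral_const_mul, ← integral_const_mul, ← integral_const_mul, ← integral_add i1 i2,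
      ← integral_add i12 i3]
    refine abs_integral_le_integral_abs.trans (integral_mono_ae ?_ (i12.add i3) ?_)
    · exact ((integrable_flux_inner hb hF (memLp_avg hw hF) (memLp_jump hv hF)).add
        (integrable_abs_flux_inner hb γ hF (memLp_jump hw hF) (memLp_jump hv hF))).abs
    · filter_upwards [(facetFlux_spec hb hF).2] with x hx
      exact facet_young hγ hη hx (trace F.1 w x) (trace F.2 w x) (jump F v x)
  have hsum := sum_facet_le (𝒯 := 𝒯) (s := fun K x => ‖trace K w x‖ ^ 2)
    (fun K hK => (memLp_trace hw hK).integrable_norm_pow two_ne_zero) fun _ _ => by positivity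
  refine (Finset.abs_sum_le_sum_abs _ _).trans ((Finset.sum_le_sum hterm).trans ?_)
  rw [Finset.sum_add_distrib, Finset.sum_add_distrib, ← Finset.mul_sum, ← Finset.mul_sum,
    ← Finset.mul_sum, upwSq, upwSq]
  have h1 := mul_le_mul_of_nonneg_left hsum (by positivity : 0 ≤ B * γ⁻¹ / (2 * η))
  have h2 : ∀ X : ℝ, γ⁻¹ / (2 * η) * (B * X) = B * γ⁻¹ / (2 * η) * X := fun X => by ring
  rw [h2]
  linarith

theorem upwSq_nonneg (hγ : 0 < γ) : 0 ≤ upwSq 𝒯 γ b w :=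
  Finset.sum_nonneg fun _ _ => integral_nonneg fun _ => by positivity

theorem sum_l2Norm_sq (hv : MemLp v 2 (volume.restrict Ω)) :
    ∑ K ∈ 𝒯.cells, l2Norm K v ^ 2 = l2Norm Ω v ^ 2 := by
  simp only [l2Norm_sq]
  exact (𝒯.integral_domain (hv.integrable_norm_pow two_ne_zero)).symm

/-- Boundedness of the convective form for a fixed convective field. -/
theorem abs_convForm_le (hb : IsSolenoidal Ω B b) (hB : 0 ≤ B) (hγ : 0 < γ)
    (hw : ∀ K ∈ 𝒯.cells, MemH1 K w) (hv : ∀ K ∈ 𝒯.cells, MemH1 K v)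
    (hvΩ : MemLp v 2 (volume.restrict Ω)) {C : ℝ}
    (hinv : ∀ K ∈ 𝒯.cells, h1Semi K v ≤ C * (Metric.diam K)⁻¹ * l2Norm K v) {η θ : ℝ}
    (hη : 0 < η) (hθ : 0 < θ) :
    |convForm 𝒯 γ b w v| ≤
      max 1 (max (C ^ 2) γ⁻¹) * (1 / (2 * η) + 1 / θ) * sharpSq 𝒯 γ B b w +
        η / 2 * l2Norm Ω v ^ 2 + θ * upwSq 𝒯 γ b v := by
  set M := max 1 (max (C ^ 2) γ⁻¹)
  have hM1 : 1 ≤ M := le_max_left _ _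
  have hMC : C ^ 2 ≤ M := (le_max_left _ _).trans (le_max_right _ _)
  have hMγ : γ⁻¹ ≤ M := (le_max_right _ _).trans (le_max_right _ _)
  set H := B ^ 2 * ∑ K ∈ 𝒯.cells, (Metric.diam K)⁻¹ ^ 2 * l2Norm K w ^ 2 with hH
  set Z := B * ∑ K ∈ 𝒯.cells, ∫ x, ‖trace K w x‖ ^ 2 ∂(bdryMeasure K)
  have hH0 : 0 ≤ H := by
    have : 0 ≤ ∑ K ∈ 𝒯.cells, (Metric.diam K)⁻¹ ^ 2 * l2Norm K w ^ 2 :=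
      Finset.sum_nonneg fun _ _ => by positivity
    positivity
  have hZ0 : 0 ≤ Z := by
    have : 0 ≤ ∑ K ∈ 𝒯.cells, ∫ x, ‖trace K w x‖ ^ 2 ∂(bdryMeasure K) :=
      Finset.sum_nonneg fun _ _ => integral_nonneg fun _ => by positivity
    positivity
  have hU0 : 0 ≤ upwSq 𝒯 γ b w := upwSq_nonneg hγ
  have hN0 : 0 ≤ l2Norm Ω w ^ 2 := by positivity
  have h1 : |∑ K ∈ 𝒯.cells, ∑ i, ∫ x in K, b x i * ⟪w x, weakPartial K i v x⟫| ≤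
      C ^ 2 / (2 * η) * H + η / 2 * l2Norm Ω v ^ 2 := by
    refine (Finset.abs_sum_le_sum_abs _ _).trans ((Finset.sum_le_sum fun K hK =>
      abs_sum_integral_weakPartial_le (meas_cell hb hK) (bound_cell hb hK) (hw K hK).1 (hv K hK)
        (hinv K hK) hη).trans_eq ?_)
    rw [Finset.sum_add_distrib, ← Finset.mul_sum, sum_l2Norm_sq hvΩ, hH, Finset.mul_sum,
      Finset.mul_sum]
    refine congrArg (· + _) (Finset.sum_congr rfl fun K _ => ?_)
    ring
  have h2 := abs_sum_facet_le hb hB hγ hw hv hθ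
  rw [convForm_eq hb γ hw hv]
  refine (abs_add_le _ _).trans ?_
  rw [abs_neg]
  have hq : 0 ≤ 1 / (2 * η) := by positivity
  have hr : 0 ≤ 1 / (2 * θ) := by positivity
  have hr2 : 1 / θ = 2 * (1 / (2 * θ)) := by field_simp
  -- the three terms of the estimates are below their counterparts in `M * (1 / (2 η) + 1 / θ) * sharpSq`,
  -- and the remaining products `m1`, `m2`, `m3` in the expansion `e` are nonnegative
  have k1 : C ^ 2 / (2 * η) * H ≤ M * (1 / (2 * η)) * H := by
    rw [div_eq_mul_one_div]
    gcongr
  have k2 : γ⁻¹ / (2 * θ) * Z ≤ M * (1 / (2 * θ)) * Z := by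
    rw [div_eq_mul_one_div]
    gcongr
  have k3 : 1 / (2 * θ) * upwSq 𝒯 γ b w ≤ M * (1 / (2 * θ)) * upwSq 𝒯 γ b w :=
    mul_le_mul_of_nonneg_right (le_mul_of_one_le_left hr hM1) hU0
  have hs : sharpSq 𝒯 γ B b w = l2Norm Ω w ^ 2 + upwSq 𝒯 γ b w + H + Z := rfl
  have hMq : 0 ≤ M * (1 / (2 * η)) := mul_nonneg (by linarith) hq
  have hMr : 0 ≤ M * (1 / (2 * θ)) := mul_nonneg (by linarith) hr
  have m1 := mul_nonneg hMq (add_nonneg (add_nonneg hN0 hU0) hZ0)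
  have m2 := mul_nonneg hMr (add_nonneg hN0 hH0)
  have m3 := mul_nonneg hMr (add_nonneg (add_nonneg (add_nonneg hN0 hU0) hH0) hZ0)
  rw [hs, hr2]
  have e : M * (1 / (2 * η) + 2 * (1 / (2 * θ))) * (l2Norm Ω w ^ 2 + upwSq 𝒯 γ b w + H + Z) =
      M * (1 / (2 * η)) * H + M * (1 / (2 * θ)) * Z + M * (1 / (2 * θ)) * upwSq 𝒯 γ b w +
        M * (1 / (2 * η)) * (l2Norm Ω w ^ 2 + upwSq 𝒯 γ b w + Z) +
        M * (1 / (2 * θ)) * (l2Norm Ω w ^ 2 + H) +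
        M * (1 / (2 * θ)) * (l2Norm Ω w ^ 2 + upwSq 𝒯 γ b w + H + Z) := by ring
  linarith

end Mesh

/-- At almost every time, the convective velocity is a solenoidal field bounded by its essential
supremum. -/
theorem IsConvectiveField.ae_isSolenoidal {Ω : Set (Euc d)} {T : ℝ} {β : ℝ → Euc d → Euc d}
    (h : IsConvectiveField Ω T β) :
    ∀ᵐ t ∂(volume.restrict (Set.Ioc 0 T)), IsSolenoidal Ω (eSupNorm Ω T β).toReal (β t) := by
  have h1 : ∀ᵐ t ∂(volume.restrict (Set.Ioc 0 T)),
      eLpNorm (β t) ⊤ (volume.restrict Ω) ≤ eSupNorm Ω T β := ae_le_essSup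
  filter_upwards [h1, h.meas.prodMk_left, h.divFree, h.noPenetration] with t ht hm hd hn
  refine ⟨hm, ?_, hd, hn⟩
  rw [eLpNorm_exponent_top] at ht
  filter_upwards [ae_le_eLpNormEssSup (f := β t) (μ := volume.restrict Ω)] with x hx
  have h2 := ENNReal.toReal_mono h.bounded.ne (hx.trans ht)
  rwa [toReal_enorm] at h2

end HdivFEM

theorem lemma3p4 {d : ℕ} (hd : d = 2 ∨ d = 3)
    -- the domain and the mesh
    (Ω : Set (Euc d)) (hΩo : IsOpen Ω) (hΩc : IsConnected Ω) (hΩb : Bornology.IsBounded Ω)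
    (𝒯 : Mesh Ω)
    -- the local spaces of piecewise polynomials and their inverse inequality
    (Vloc : Set (Euc d) → Submodule ℝ (Euc d → Euc d))
    (hVloc : ∀ K ∈ 𝒯.cells, ∀ p ∈ Vloc K, IsPiecewisePolynomial K p ∧ MemH K 1 p)
    (Cinv : ℝ) (hCinv : 0 < Cinv)
    (hinv : ∀ K ∈ 𝒯.cells, ∀ p ∈ Vloc K,
      h1Semi K p ≤ Cinv * (Metric.diam K)⁻¹ * l2Norm K p)
    -- the convective velocity
    (T : ℝ) (hT : 0 < T) (β : ℝ → Euc d → Euc d) (hβ : IsConvectiveField Ω T β)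
    -- the upwind parameter and the extra regularity
    (γ : ℝ) (hγ : 0 < γ) (ε : ℝ) (hε : 0 < ε) :
    ∀ᵐ t ∂(volume.restrict (Set.Ioc 0 T)),
      ∀ w ∈ compoundSpace 𝒯 Vloc ε, ∀ v ∈ discreteSpace 𝒯 Vloc,
      ∀ ε₁ ε₂ : ℝ, 0 < ε₁ → 0 < ε₂ →
        |convForm 𝒯 γ (β t) w v| ≤
          max 1 (max (Cinv ^ 2) γ⁻¹) * (1 / (2 * ε₁) + 1 / ε₂)
              * sharpSq 𝒯 γ (eSupNorm Ω T β).toReal (β t) w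
            + ε₁ / 2 * l2Norm Ω v ^ 2 + ε₂ * upwSq 𝒯 γ (β t) v := by
  filter_upwards [hβ.ae_isSolenoidal] with t ht w hw v hv ε₁ ε₂ h₁ h₂
  have hloc : ∀ K ∈ 𝒯.cells, ∀ p ∈ Vloc K, MemH K 1 p := fun K hK p hp => (hVloc K hK p hp).2
  refine Mesh.abs_convForm_le ht ENNReal.toReal_nonneg hγ
    (fun K hK => memH1_of_mem_compoundSpace hloc hε hw hK)
    (fun K hK => memH1_of_mem_discreteSpace hloc hv hK) hv.1.1 (fun K hK => ?_) h₁ h₂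
  obtain ⟨p, hp, hvp⟩ := hv.2 K hK
  rw [h1Semi_congr hvp, l2Norm_congr hvp]
  exact hinv K hK p hp
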